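/- Let $G$ be a second-countable, locally compact (Hausdorff) group with left Haar measure $\mu$, and let $B$ be a separable, stable C*-algebra. Put $A=C_0(G)\otimes B$, let $M(A)$ be its multiplier algebra, and let $\mathcal I(A)$, $\mathcal I(B)$ denote the sets of closed two-sided ideals of $A$ and $B$. For $J\in\mathcal I(A)$ put $M(A,J)=\{x\in M(A) : xA\subseteq J\}$. Let $\mathcal H_G^\infty=\ell^2(\mathbb N)\hat\otimes L^2(G,\mu)$, let $\mathcal K(\mathcal H_G^\infty)$ be the compact operators on it, and let $\lambda^\infty=1\otimes\lambda$ be the infinite repeat of the left regular representation $\lambda$ of $G$. Let $\alpha:G\curvearrowright A$ be a point-norm continuous action by $*$-automorphisms such that * $\alpha$ is conjugate (i.e. equivariantly $*$-isomorphic) to the action $\mathrm{Ad}(\lambda^\infty)\otimes\alpha$ on $\mathcal K(\mathcal H_G^\infty)\otimes A$, and * the induced action $\alpha^\sharp_g(I)=\alpha_g[I]$ on $\mathrm{Prim}(A)$ is a product action $\tau\times\gamma$, where $\tau:G\curvearrowright G$ is a continuous action on the space $G$ and $\gamma:G\curvearrowright\mathrm{Prim}(B)$ is a continuous action for the Jacobson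 topology. Here $\mathrm{Prim}(A)\cong G\times\mathrm{Prim}(B)$, with $(h,I)\in G\times\mathrm{Prim}(B)$ corresponding to the primitive ideal $C_0(G)\otimes I+C_0(G\setminus\{h\})\otimes B$ of $A$. Then there exists an injective, non-degenerate $*$-homomorphism $\varphi:A\to M(A)$ that is $\alpha$-to-$\alpha$-equivariant (for the canonical extension of $\alpha$ to $M(A)$), satisfies $\varphi(A)\cap A=\{0\}$, and is such that for every $J\in\mathcal I(A)$ the following are equivalent: 1. $\varphi(J)\subseteq\varphi(A)\cap M(A,J)$; 2. $J=C_0(G)\otimes I$ for some $I\in\mathcal I(B)$; 3. $\varphi(J)=\varphi(A)\cap M(A,J)$. -/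

import Mathlib

open MeasureTheory
open scoped MultiplierAlgebra ZeroAtInfty TensorProduct

universe u v

noncomputable section

/-! ### Closed two-sided ideals and the primitive ideal space -/

/-- `𝓘(A)`: the closed two-sided ideals of the C⋆-algebra `A`. -/
abbrev ClosedIdeal (A : Type u) [NonUnitalCStarAlgebra A] : Type u :=
  {I : TwoSidedIdeal A // IsClosed (I : Set A)}

/-- A closed subset with the ideal properties, as a closed two-sided ideal. -/
def ClosedIdeal.ofSet {A : Type u} [NonUnitalCStarAlgebra A] (s : Set A) (closed : IsClosed s)
    (zero : 0 ∈ s) (add : ∀ {x y}, x ∈ s → y ∈ s → x + y ∈ s) (neg : ∀ {x}, x ∈ s → -x ∈ s)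
    (left : ∀ {x y}, y ∈ s → x * y ∈ s) (right : ∀ {x y}, x ∈ s → x * y ∈ s) : ClosedIdeal A :=
  ⟨TwoSidedIdeal.mk' s zero add neg left right, by rwa [TwoSidedIdeal.coe_mk']⟩

theorem ClosedIdeal.mem_ofSet {A : Type u} [NonUnitalCStarAlgebra A] {s : Set A} {closed zero add
    neg left right} {x : A} :
    x ∈ (ClosedIdeal.ofSet s closed zero add neg left right).1 ↔ x ∈ s :=
  TwoSidedIdeal.mem_mk' s zero add neg left right x

/-- A nonzero irreducible representation of `A` on a Hilbert space `E`: the only closed invariant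
subspaces are `0` and `E`. -/
def IsIrreducibleRep {A : Type u} [NonUnitalCStarAlgebra A] {E : Type v} [NormedAddCommGroup E]
    [InnerProductSpace ℂ E] [CompleteSpace E] (π : A →⋆ₙₐ[ℂ] (E →L[ℂ] E)) : Prop :=
  π ≠ 0 ∧ ∀ V : Submodule ℂ E, IsClosed (V : Set E) → (∀ a, ∀ v ∈ V, π a v ∈ V) → V = ⊥ ∨ V = ⊤

/-- Primitive ideals: kernels of nonzero irreducible representations. (Irreducible representations
are cyclic, so Hilbert spaces in the universe of `A` give all primitive ideals.) -/
def IsPrimitiveIdeal {A : Type u} [NonUnitalCStarAlgebra A] (I : ClosedIdeal A) : Prop :=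
  ∃ (E : Type u) (_ : NormedAddCommGroup E) (_ : InnerProductSpace ℂ E) (_ : CompleteSpace E)
    (π : A →⋆ₙₐ[ℂ] (E →L[ℂ] E)), IsIrreducibleRep π ∧ ∀ a, a ∈ I.1 ↔ π a = 0

/-- `Prim(A)`. -/
def PrimitiveIdeals (A : Type u) [NonUnitalCStarAlgebra A] : Type u :=
  {I : ClosedIdeal A // IsPrimitiveIdeal I}

/-- A primitive ideal is proper. -/
theorem IsPrimitiveIdeal.exists_notMem {A : Type u} [NonUnitalCStarAlgebra A] {I : ClosedIdeal A}
    (h : IsPrimitiveIdeal I) : ∃ a, a ∉ I.1 := by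
  obtain ⟨E, _, _, _, π, ⟨h0, -⟩, hI⟩ := h
  by_contra! hc
  exact h0 (NonUnitalStarAlgHom.ext fun a => (hI a).1 (hc a))

/-- A primitive ideal is prime. -/
theorem IsPrimitiveIdeal.prime {A : Type u} [NonUnitalCStarAlgebra A] {I : ClosedIdeal A}
    (h : IsPrimitiveIdeal I) {a b : A} (ha : a ∉ I.1) (hb : b ∉ I.1) :
    ∃ c, a * c * b ∉ I.1 := by
  obtain ⟨E, _, _, _, π, ⟨h0, hirr⟩, hI⟩ := h
  by_contra! hc
  have hz : ∀ (c : A) (v : E), π a (π c (π b v)) = 0 := fun c v => by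
    have := (hI _).1 (hc c)
    rw [map_mul, map_mul] at this
    exact congrArg (fun T : E →L[ℂ] E => T v) this
  obtain ⟨v, hv⟩ : ∃ v, π b v ≠ 0 := by
    by_contra! hv
    exact hb ((hI b).2 (ContinuousLinearMap.ext hv))
  set w := π b v with hw
  let L : A →ₗ[ℂ] E :=
    { toFun := fun c => π c w
      map_add' := fun x y => by simp
      map_smul' := fun r x => by simp }
  have hmap : ∀ x : A, ∀ y ∈ (LinearMap.range L).topologicalClosure,
      π x y ∈ (LinearMap.range L).topologicalClosure := by
    intro x y hy
    refine map_mem_closure (π x).continuous hy ?_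
    rintro _ ⟨c, rfl⟩
    exact ⟨x * c, by simp [L]⟩
  rcases hirr (LinearMap.range L).topologicalClosure
    (Submodule.isClosed_topologicalClosure _) hmap with hV | hV
  · have hcw : ∀ c, π c w = 0 := fun c => by
      have : π c w ∈ (LinearMap.range L).topologicalClosure :=
        Submodule.le_topologicalClosure _ ⟨c, rfl⟩
      rwa [hV, Submodule.mem_bot] at this
    rcases hirr (ℂ ∙ w) (Submodule.closed_of_finiteDimensional _) (by
      intro x y hy
      obtain ⟨r, rfl⟩ := Submodule.mem_span_singleton.1 hy
      simp [hcw]) with hW | hW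
    · exact hv (Submodule.span_singleton_eq_bot.1 hW)
    · refine h0 (NonUnitalStarAlgHom.ext fun c => ContinuousLinearMap.ext fun y => ?_)
      have hy : y ∈ (ℂ ∙ w) := by rw [hW]; trivial
      obtain ⟨r, rfl⟩ := Submodule.mem_span_singleton.1 hy
      simp [hcw]
  · refine ha ((hI a).2 (ContinuousLinearMap.ext fun y => ?_))
    have hy : y ∈ (LinearMap.range L).topologicalClosure := by rw [hV]; trivial
    have hcl : IsClosed {z : E | π a z = 0} := isClosed_eq (π a).continuous continuous_const
    refine closure_minimal ?_ hcl hy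
    rintro _ ⟨c, rfl⟩
    exact hz c v

/-- The Jacobson (hull-kernel) topology: `Z ⊆ Prim(A)` is closed iff it contains every primitive
ideal `J ⊇ ⋂_{I ∈ Z} I`. -/
instance (A : Type u) [NonUnitalCStarAlgebra A] : TopologicalSpace (PrimitiveIdeals A) :=
  TopologicalSpace.ofClosed
    {Z | ∀ J : PrimitiveIdeals A, (∀ a, (∀ I ∈ Z, a ∈ I.1.1) → a ∈ J.1.1) → J ∈ Z}
    (fun J hJ => by
      obtain ⟨a, ha⟩ := J.2.exists_notMem
      exact (ha (hJ a (by simp))).elim)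
    (fun S hS J hJ => Set.mem_sInter.2 fun Z hZ =>
      hS hZ J fun a ha => hJ a fun I hI => ha I (Set.mem_sInter.1 hI Z hZ))
    (fun Z₁ h₁ Z₂ h₂ J hJ => by
      by_contra hc
      rw [Set.mem_union, not_or] at hc
      have e₁ := mt (h₁ J) hc.1
      have e₂ := mt (h₂ J) hc.2
      push Not at e₁ e₂
      obtain ⟨a, ha, haJ⟩ := e₁
      obtain ⟨b, hb, hbJ⟩ := e₂
      obtain ⟨c, hcJ⟩ := J.2.prime haJ hbJ
      refine hcJ (hJ _ ?_)
      rintro I (hI | hI)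
      · exact I.1.1.mul_mem_right _ _ (I.1.1.mul_mem_right _ _ (ha I hI))
      · exact I.1.1.mul_mem_left _ _ (hb I hI))

/-- The closure of `U` in the Jacobson topology is `{J | J ⊇ ⋂_{I ∈ U} I}`. -/
theorem PrimitiveIdeals.closure_eq {A : Type u} [NonUnitalCStarAlgebra A]
    (U : Set (PrimitiveIdeals A)) :
    closure U = {J | ∀ a, (∀ I ∈ U, a ∈ I.1.1) → a ∈ J.1.1} := by
  have key : ∀ Z : Set (PrimitiveIdeals A), IsClosed Z ↔
      ∀ J : PrimitiveIdeals A, (∀ a, (∀ I ∈ Z, a ∈ I.1.1) → a ∈ J.1.1) → J ∈ Z :=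
    fun Z => by
      rw [← isOpen_compl_iff]
      change Zᶜᶜ ∈ _ ↔ _
      rw [compl_compl]
      rfl
  apply Set.Subset.antisymm
  · refine closure_minimal (fun I hI a ha => ha I hI) ((key _).2 fun J hJ a ha => ?_)
    exact hJ a fun I hI => hI a ha
  · intro J hJ
    exact (key _).1 isClosed_closure J fun a ha => hJ a fun I hI => ha I (subset_closure hI)

/-! ### Actions -/

/-- A continuous action of the group `G` on the topological space `X`. -/
structure ContinuousAction (G : Type u) [Group G] [TopologicalSpace G]
    (X : Type v) [TopologicalSpace X] where
  act : G → X → X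
  one_act : ∀ x, act 1 x = x
  mul_act : ∀ g h x, act (g * h) x = act g (act h x)
  continuous_act : Continuous fun p : G × X => act p.1 p.2

/-- An action `α : G ↷ A` on a C⋆-algebra: a point-norm continuous action by ⋆-automorphisms. -/
structure CStarAction (G : Type u) [Group G] [TopologicalSpace G]
    (A : Type v) [NonUnitalCStarAlgebra A] where
  aut : G →* (A ≃⋆ₐ[ℂ] A)
  continuous_aut : ∀ a, Continuous fun g => aut g a

/-- Conjugacy of C⋆-actions: an equivariant ⋆-isomorphism. -/
def CStarAction.IsConjugate {G : Type*} [Group G] [TopologicalSpace G] {A D : Type*}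
    [NonUnitalCStarAlgebra A] [NonUnitalCStarAlgebra D]
    (α : CStarAction G A) (δ : CStarAction G D) : Prop :=
  ∃ e : A ≃⋆ₐ[ℂ] D, ∀ g a, e (α.aut g a) = δ.aut g (e a)

/-- The image `e[I]` of a closed ideal under a ⋆-automorphism. -/
def ClosedIdeal.image {A : Type u} [NonUnitalCStarAlgebra A] (e : A ≃⋆ₐ[ℂ] A)
    (I : ClosedIdeal A) : ClosedIdeal A :=
  ClosedIdeal.ofSet (e '' (I.1 : Set A))
    (by
      have hiso : Isometry e := NonUnitalStarAlgHom.isometry e e.injective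
      exact hiso.isClosedEmbedding.isClosedMap _ I.2)
    ⟨0, I.1.zero_mem, map_zero e⟩
    (by
      rintro _ _ ⟨x, hx, rfl⟩ ⟨y, hy, rfl⟩
      exact ⟨x + y, I.1.add_mem hx hy, map_add e x y⟩)
    (by
      rintro _ ⟨x, hx, rfl⟩
      exact ⟨-x, I.1.neg_mem hx, map_neg e x⟩)
    (by
      rintro x _ ⟨y, hy, rfl⟩
      exact ⟨e.symm x * y, I.1.mul_mem_left _ _ hy, by simp⟩)
    (by
      rintro _ y ⟨x, hx, rfl⟩
      exact ⟨x * e.symm y, I.1.mul_mem_right _ _ hx, by simp⟩)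

/-- The induced action `α♯` on closed ideals, `α♯_g(I) = α_g[I]`. -/
def CStarAction.sharp {G : Type*} [Group G] [TopologicalSpace G] {A : Type*}
    [NonUnitalCStarAlgebra A] (α : CStarAction G A) (g : G) (I : ClosedIdeal A) : ClosedIdeal A :=
  I.image (α.aut g)

/-! ### Spatial tensor products with the compact operators -/

/-- The Hilbert space tensor product `H ⊗̂ E`. -/
def HilbertTensor (H E : Type*) [NormedAddCommGroup H] [InnerProductSpace ℂ H]
    [NormedAddCommGroup E] [InnerProductSpace ℂ E] : Type _ :=
  UniformSpace.Completion (H ⊗[ℂ] E)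

section HilbertTensor

variable (H E : Type*) [NormedAddCommGroup H] [InnerProductSpace ℂ H]
    [NormedAddCommGroup E] [InnerProductSpace ℂ E]

instance : NormedAddCommGroup (HilbertTensor H E) :=
  inferInstanceAs (NormedAddCommGroup (UniformSpace.Completion (H ⊗[ℂ] E)))

instance : InnerProductSpace ℂ (HilbertTensor H E) :=
  inferInstanceAs (InnerProductSpace ℂ (UniformSpace.Completion (H ⊗[ℂ] E)))

instance : CompleteSpace (HilbertTensor H E) :=
  inferInstanceAs (CompleteSpace (UniformSpace.Completion (H ⊗[ℂ] E)))

end HilbertTensor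

/-- The bounded operator `S ⊗ T` on `H ⊗̂ E`. -/
def opTensor {H E : Type*} [NormedAddCommGroup H] [InnerProductSpace ℂ H]
    [NormedAddCommGroup E] [InnerProductSpace ℂ E] (S : H →L[ℂ] H) (T : E →L[ℂ] E) :
    HilbertTensor H E →L[ℂ] HilbertTensor H E :=
  (TensorProduct.mapL S T).completion

/-- The spatial tensor product `𝓚(H) ⊗ A`, formed with respect to a representation `π` of `A` on
`E` (to be faithful; `𝓚(H)` is represented identically on `H`): the C⋆-algebra of operators on
`H ⊗̂ E` generated by the elementary tensors `k ⊗ π(a)` with `k` compact and `a ∈ A`. The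
elementary tensors are closed under products and adjoints, so it is their closed linear span. -/
def CompactTensor (H : Type*) [NormedAddCommGroup H] [InnerProductSpace ℂ H] [CompleteSpace H]
    {A : Type*} [NonUnitalCStarAlgebra A]
    {E : Type*} [NormedAddCommGroup E] [InnerProductSpace ℂ E] [CompleteSpace E]
    (π : A →⋆ₙₐ[ℂ] (E →L[ℂ] E)) :
    NonUnitalStarSubalgebra ℂ (HilbertTensor H E →L[ℂ] HilbertTensor H E) :=
  (NonUnitalStarAlgebra.adjoin ℂ
    {T | ∃ k : H →L[ℂ] H, IsCompactOperator k ∧ ∃ a : A, T = opTensor k (π a)}).topologicalClosure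

instance {H : Type*} [NormedAddCommGroup H] [InnerProductSpace ℂ H] [CompleteSpace H]
    {A : Type*} [NonUnitalCStarAlgebra A]
    {E : Type*} [NormedAddCommGroup E] [InnerProductSpace ℂ E] [CompleteSpace E]
    (π : A →⋆ₙₐ[ℂ] (E →L[ℂ] E)) :
    IsClosed (CompactTensor H π : Set (HilbertTensor H E →L[ℂ] HilbertTensor H E)) :=
  NonUnitalStarSubalgebra.isClosed_topologicalClosure _

/-- The elementary tensor `k ⊗ a ∈ 𝓚(H) ⊗ A`. -/
def CompactTensor.elem {H : Type*} [NormedAddCommGroup H] [InnerProductSpace ℂ H]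
    [CompleteSpace H] {A : Type*} [NonUnitalCStarAlgebra A]
    {E : Type*} [NormedAddCommGroup E] [InnerProductSpace ℂ E] [CompleteSpace E]
    (π : A →⋆ₙₐ[ℂ] (E →L[ℂ] E)) (k : H →L[ℂ] H) (hk : IsCompactOperator k) (a : A) :
    CompactTensor H π :=
  ⟨opTensor k (π a), NonUnitalStarSubalgebra.le_topologicalClosure _
    (NonUnitalStarAlgebra.subset_adjoin ℂ _ ⟨k, hk, a, rfl⟩)⟩

/-- `B` is stable: `𝓚 ⊗ B ≅ B`, where `𝓚 = 𝓚(ℓ²(ℕ))`. The spatial tensor product is formed with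
some faithful representation of `B`; up to isomorphism it does not depend on which one. -/
def IsStableCStar (B : Type u) [NonUnitalCStarAlgebra B] : Prop :=
  ∃ (E : Type u) (_ : NormedAddCommGroup E) (_ : InnerProductSpace ℂ E) (_ : CompleteSpace E)
    (π : B →⋆ₙₐ[ℂ] (E →L[ℂ] E)), Function.Injective π ∧
    Nonempty (CompactTensor (lp (fun _ : ℕ => ℂ) 2) π ≃⋆ₐ[ℂ] B)

/-- The action `δ` on `𝓚(H) ⊗ A` is `Ad(w) ⊗ α`: it maps `k ⊗ a` to `(w_g k w_g⋆) ⊗ α_g(a)`. This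
determines `δ`, since elementary tensors span a dense subspace. -/
def IsAdTensorAction {G : Type*} [Group G] [TopologicalSpace G]
    {H : Type*} [NormedAddCommGroup H] [InnerProductSpace ℂ H] [CompleteSpace H]
    {A : Type*} [NonUnitalCStarAlgebra A]
    {E : Type*} [NormedAddCommGroup E] [InnerProductSpace ℂ E] [CompleteSpace E]
    (π : A →⋆ₙₐ[ℂ] (E →L[ℂ] E)) (w : G → (H →L[ℂ] H)) (α : CStarAction G A)
    (δ : CStarAction G (CompactTensor H π)) : Prop :=
  ∀ (g : G) (k : H →L[ℂ] H) (hk : IsCompactOperator k) (a : A),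
    δ.aut g (CompactTensor.elem π k hk a) =
      CompactTensor.elem π (w g ∘L k ∘L ContinuousLinearMap.adjoint (w g))
        ((hk.comp_clm _).clm_comp _) (α.aut g a)

/-! ### The regular representation -/

section Regular

variable {G : Type u} [Group G] [TopologicalSpace G] [IsTopologicalGroup G]
  [SecondCountableTopology G] [MeasurableSpace G] [BorelSpace G]
  (μ : Measure G) [μ.IsHaarMeasure]

/-- The left regular representation on `L²(G, μ)`: `λ_g(ξ)(h) = ξ(g⁻¹ h)`. -/
def leftRegular (g : G) : Lp ℂ 2 μ →L[ℂ] Lp ℂ 2 μ :=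
  (Lp.compMeasurePreservingₗᵢ ℂ (fun h : G => g⁻¹ * h)
    (measurePreserving_mul_left μ g⁻¹)).toContinuousLinearMap

/-- `𝓗_G^∞ = ℓ²(ℕ) ⊗̂ L²(G, μ)`. -/
abbrev RegularHilbert : Type _ := HilbertTensor (lp (fun _ : ℕ => ℂ) 2) (Lp ℂ 2 μ)

/-- The infinite repeat `λ^∞ = 1 ⊗ λ` of the left regular representation. -/
def leftRegularInfty (g : G) : RegularHilbert μ →L[ℂ] RegularHilbert μ :=
  opTensor (ContinuousLinearMap.id ℂ _) (leftRegular μ g)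

/-- `α` is conjugate to the action `Ad(λ^∞) ⊗ α` on `𝓚(𝓗_G^∞) ⊗ A`. -/
def CStarAction.AbsorbsRegular {A : Type v} [NonUnitalCStarAlgebra A]
    (α : CStarAction G A) : Prop :=
  ∃ (E : Type v) (_ : NormedAddCommGroup E) (_ : InnerProductSpace ℂ E) (_ : CompleteSpace E)
    (π : A →⋆ₙₐ[ℂ] (E →L[ℂ] E)), Function.Injective π ∧
    ∃ δ : CStarAction G (CompactTensor (RegularHilbert μ) π),
      IsAdTensorAction π (leftRegularInfty μ) α δ ∧ α.IsConjugate δ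

end Regular

/-! ### Multipliers -/

/-- `M(A, J) = {x ∈ M(A) | xA ⊆ J}`. -/
def multiplierIdeal {A : Type*} [NonUnitalCStarAlgebra A] (J : ClosedIdeal A) : Set 𝓜(ℂ, A) :=
  {x | ∀ a, x.fst a ∈ J.1}

/-- The canonical extension of a ⋆-automorphism `e` of `A` to `M(A)`, determined by
`e(x) a = e(x e⁻¹(a))` and `a e(x) = e(e⁻¹(a) x)`. -/
def multiplierMap {A : Type*} [NonUnitalCStarAlgebra A] (e : A ≃⋆ₐ[ℂ] A) (x : 𝓜(ℂ, A)) :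
    𝓜(ℂ, A) :=
  let conj (T : A →L[ℂ] A) : A →L[ℂ] A :=
    { toFun := fun a => e (T (e.symm a))
      map_add' := fun a b => by simp
      map_smul' := fun r a => by simp
      cont := (NonUnitalStarAlgHom.isometry e e.injective).continuous.comp
        (T.continuous.comp (NonUnitalStarAlgHom.isometry e.symm e.symm.injective).continuous) }
  { fst := conj x.fst
    snd := conj x.snd
    central := fun a b => by
      change e (x.snd (e.symm a)) * b = a * e (x.fst (e.symm b))
      have h := congrArg e (x.central (e.symm a) (e.symm b))
      simpa using h }

/-- `φ : A → M(A)` is nondegenerate: `φ(A)A` spans a dense subspace of `A`. -/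
def IsNondegenerateHom {A : Type*} [NonUnitalCStarAlgebra A] (φ : A →⋆ₙₐ[ℂ] 𝓜(ℂ, A)) : Prop :=
  Dense (Submodule.span ℂ {y : A | ∃ a b, y = (φ a).fst b} : Set A)

/-- `φ : A → M(A)` is `α`-to-`α`-equivariant: `φ(α_g(a)) = α_g(φ(a))`. -/
def IsEquivariantHom {G : Type*} [Group G] [TopologicalSpace G] {A : Type*}
    [NonUnitalCStarAlgebra A] (α : CStarAction G A) (φ : A →⋆ₙₐ[ℂ] 𝓜(ℂ, A)) : Prop :=
  ∀ g a, φ (α.aut g a) = multiplierMap (α.aut g) (φ a)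

/-! ### Ideals of `C₀(G) ⊗ B`

The C⋆-algebra `C₀(G) ⊗ B` is `C₀(G, B)`, with `f ⊗ b` being the function `g ↦ f(g) b`. -/

section Ideals

variable {G : Type u} [TopologicalSpace G] {B : Type v} [NonUnitalCStarAlgebra B]

/-- Evaluation at a point is continuous. -/
theorem continuous_evalZeroAtInfty (h : G) : Continuous fun f : C₀(G, B) => f h :=
  (BoundedContinuousFunction.lipschitz_eval_const h).continuous.comp
    ZeroAtInftyContinuousMap.isometry_toBCF.continuous

/-- The ideal `C₀(G) ⊗ I` of `C₀(G) ⊗ B`: all functions with values in `I`. -/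
def tensorIdeal (G : Type u) [TopologicalSpace G] (I : ClosedIdeal B) :
    ClosedIdeal C₀(G, B) :=
  ClosedIdeal.ofSet {f | ∀ h, f h ∈ I.1}
    (by
      rw [Set.ofPred_forall]
      exact isClosed_iInter fun h => I.2.preimage (continuous_evalZeroAtInfty h))
    (fun _ => I.1.zero_mem)
    (fun hf hf' h => I.1.add_mem (hf h) (hf' h))
    (fun hf h => I.1.neg_mem (hf h))
    (fun hf h => I.1.mul_mem_left _ _ (hf h))
    (fun hf h => I.1.mul_mem_right _ _ (hf h))

/-- The ideal `C₀(G) ⊗ I + C₀(G ∖ {h}) ⊗ B` of `C₀(G) ⊗ B`: all functions whose value at `h` lies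
in `I`. For primitive `I` this is the primitive ideal corresponding to
`(h, I) ∈ G × Prim(B) ≅ Prim(C₀(G) ⊗ B)`. -/
def pointIdeal (h : G) (I : ClosedIdeal B) : ClosedIdeal C₀(G, B) :=
  ClosedIdeal.ofSet {f | f h ∈ I.1}
    (I.2.preimage (continuous_evalZeroAtInfty h))
    I.1.zero_mem (fun hf hf' => I.1.add_mem hf hf') (fun hf => I.1.neg_mem hf)
    (fun hf => I.1.mul_mem_left _ _ hf) (fun hf => I.1.mul_mem_right _ _ hf)

/-- `α♯ = τ × γ` as actions on `Prim(C₀(G) ⊗ B) ≅ G × Prim(B)`. -/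
def CStarAction.SharpEqProd [Group G] (α : CStarAction G C₀(G, B)) (τ : ContinuousAction G G)
    (γ : ContinuousAction G (PrimitiveIdeals B)) : Prop :=
  ∀ (g h : G) (P : PrimitiveIdeals B),
    α.sharp g (pointIdeal h P.1) = pointIdeal (τ.act g h) (γ.act g P).1

end Ideals

end

/-! Absorption of the regular representation is turned into room for multipliers. Put H = ℓ²(ℕ) ⊗
L²(G). By hypothesis A is 𝓚(H) ⊗ A with α acting as Ad(λ^∞) ⊗ α. Stripping off the unitaries leaves
an action β of G on A, which corresponds to 1 ⊗ α; since the unitaries are multipliers, β_g(x) lies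
in every closed ideal that contains α_g(x) (`IsCompactRep.exists_untwist`). Moreover H ≅ L²(G × ℕ) ⊗
H, and λ^∞ becomes translation on G tensored with the identity (`exists_regularDecomposition`).
Hence A is 𝓚(L²(G × ℕ)) ⊗ A with α acting as Ad(translation) ⊗ β, each closed ideal J being 𝓚(L²(G ×
ℕ)) ⊗ J (`CStarAction.AbsorbsRegular.exists_model`). In this picture a bounded strongly continuous
function G × ℕ → M(A) is a multiplier of A.

Let (t_n) run through a dense sequence of G, each term recurring infinitely often, and let φ(f) be
multiplication by the function (g, n) ↦ β_g(1 ⊗ (α_{g⁻¹} f)(t_n)). This field intertwines α, β and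
translation, so φ is equivariant. A contractive approximate unit is sent to functions tending
pointwise strictly to 1, and dominated convergence gives nondegeneracy.

The field is recovered from φ(f) by compressing to unit vectors of L²(G × ℕ) that live near a point
(`IsFieldRep.norm_compress_sub_le`); at (1, n) its value is 1 ⊗ f(t_n). Compressions of an element
of A along an orthonormal sequence tend to 0, as they do for compact operators, whereas the value 1
⊗ f(t_n) recurs on infinitely many sheets. So φ(f) ∈ A forces f to vanish on a dense set: this gives
injectivity and φ(A) ∩ A = 0 together.

For ideals, φ(f)A ⊆ J forces (1 ⊗ f(x))A ⊆ J for every x. If this holds for all f in J, a partition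
of unity shows that J consists of all functions with values in a fixed ideal I
(`exists_eq_tensorIdeal`). Conversely let f take values in I. Because α♯ is a product, the value of
α_g(h) at τ_g(t) lies in a primitive P exactly when the value of h at t lies in γ_{g⁻¹}(P), and the
latter ideal does not depend on t. So spreading one value of α_{g⁻¹} f over all of G and moving back
by α_g stays inside C₀(G) ⊗ P for all P ⊇ I (`CStarAction.SharpEqProd.constMultiplier_mem`), hence
inside C₀(G) ⊗ I, since I is the intersection of the primitive ideals above it; that fact is proved
here from pure states and the GNS construction. Equality in the last condition holds because (1 ⊗
f(x))A ⊆ C₀(G) ⊗ I already gives f(x) ∈ I. -/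

noncomputable section

set_option linter.unusedSectionVars false

/-! ### Primitive ideals separate points from closed ideals -/

section PureStates

open scoped ComplexOrder InnerProductSpace

variable {A : Type u} [CStarAlgebra A] [PartialOrder A] [StarOrderedRing A]

/-- A closed two-sided ideal contains the elements obtained from its self-adjoint elements by
functional calculus. -/
theorem cfcₙ_mem_of_isClosed_ideal {A : Type u} [CStarAlgebra A] (N : Submodule ℂ A) (hN : IsClosed (N : Set A))
    (hr : ∀ n ∈ N, ∀ a, n * a ∈ N) (f : ℝ → ℝ) {a : A}
    (hsa : IsSelfAdjoint a) (ha : a ∈ N) : cfcₙ f a ∈ N := by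
  -- `N` is only a right ideal here, so membership of the adjoint is carried along in the induction.
  have key : ∀ x ∈ NonUnitalStarAlgebra.adjoin ℝ {a}, x ∈ N ∧ star x ∈ N := by
    intro x hx
    induction hx using NonUnitalStarAlgebra.adjoin_induction with
    | mem x hx => rw [Set.mem_singleton_iff.1 hx, hsa.star_eq]; exact ⟨ha, ha⟩
    | add x y _ _ hx hy => rw [star_add]; exact ⟨N.add_mem hx.1 hy.1, N.add_mem hx.2 hy.2⟩
    | zero => simp
    | mul x y _ _ hx hy => rw [star_mul]; exact ⟨hr _ hx.1 _, hr _ hy.2 _⟩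
    | smul r x _ hx =>
      rw [star_smul, ← Complex.coe_smul, ← Complex.coe_smul]
      exact ⟨N.smul_mem _ hx.1, N.smul_mem _ hx.2⟩
    | star x _ hx => rw [star_star]; exact ⟨hx.2, hx.1⟩
  have h : cfcₙ f a ∈ closure (NonUnitalStarAlgebra.adjoin ℝ {a} : Set A) :=
    cfcₙ_mem_elemental (p := IsSelfAdjoint) f a
  exact closure_minimal (fun x hx => (key x hx).1) hN h

/-- If `b⋆b` is dominated by a small scalar modulo a closed ideal, then `b` is close to the
ideal. -/
theorem exists_mem_ideal_norm_sub_sq_le (N : Submodule ℂ A) (hN : IsClosed (N : Set A))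
    (hl : ∀ n ∈ N, ∀ a, a * n ∈ N) (hr : ∀ n ∈ N, ∀ a, n * a ∈ N) {t : ℝ} (ht : 0 < t) {i b : A}
    (hi : IsSelfAdjoint i) (hiN : i ∈ N) (hb : star b * b ≤ algebraMap ℝ A t + i) :
    ∃ n ∈ N, ‖b - n‖ ^ 2 ≤ 2 * t := by
  -- This ramp satisfies (1 - f(s))² (t + s) ≤ 2t for every real s: the left side vanishes for s ≥ t
  -- and is at most t + s elsewhere. As f(0) = 0, the element f(i) stays in `N`.
  obtain ⟨f, hf⟩ : ∃ f : ℝ → ℝ, f = fun s => min 1 (max 0 (s / t)) := ⟨_, rfl⟩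
  have hfc : Continuous f := by rw [hf]; fun_prop
  have hf0 : f 0 = 0 := by simp [hf]
  set w : A := cfc f i with hw
  have hwN : w ∈ N := by
    have := cfcₙ_mem_of_isClosed_ideal N hN hr f hi hiN
    rwa [cfcₙ_eq_cfc hfc.continuousOn hf0] at this
  have hwsa : star w = w := (cfc_predicate f i : IsSelfAdjoint w)
  refine ⟨b * w, hl _ hwN _, ?_⟩
  have e1 : b - b * w = b * (1 - w) := by rw [mul_sub, mul_one]
  rw [e1, sq, ← CStarRing.norm_star_mul_self]
  have e2 : star (b * (1 - w)) * (b * (1 - w)) = star (1 - w) * (star b * b) * (1 - w) := by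
    rw [star_mul]; noncomm_ring
  rw [e2]
  have h1 := star_left_conjugate_le_conjugate hb (1 - w)
  have e3 : star (1 - w) * (algebraMap ℝ A t + i) * (1 - w)
      = cfc (fun s : ℝ => (1 - f s) * (t + s) * (1 - f s)) i := by
    have h2 : (1 - w) = cfc (fun s : ℝ => 1 - f s) i := by
      rw [cfc_sub (fun _ => (1 : ℝ)) f i, cfc_const_one ℝ i]
    have h3 : algebraMap ℝ A t + i = cfc (fun s : ℝ => t + s) i := by
      rw [cfc_const_add t (fun s => s) i, cfc_id' ℝ i]
    have h4 : star (1 - w) = 1 - w := by rw [star_sub, star_one, hwsa]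
    rw [h4, h2, h3, ← cfc_mul _ _ i, ← cfc_mul _ _ i]
  rw [e3] at h1
  have h5 : cfc (fun s : ℝ => (1 - f s) * (t + s) * (1 - f s)) i ≤ algebraMap ℝ A (2 * t) := by
    refine cfc_le_algebraMap _ _ i fun s _ => ?_
    rcases le_total s 0 with hs | hs
    · have : f s = 0 := by
        simp only [hf]
        rw [max_eq_left (div_nonpos_of_nonpos_of_nonneg hs ht.le)]; simp
      rw [this]; linarith
    · rcases le_total t s with hts | hts
      · have : f s = 1 := by
          simp only [hf]
          rw [max_eq_right (by positivity), min_eq_left ((one_le_div ht).2 hts)]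
        rw [this]; simp; positivity
      · have h0 : 0 ≤ f s := by simp [hf]
        have h1 : f s ≤ 1 := by simp [hf]
        have : (1 - f s) * (1 - f s) ≤ 1 := by nlinarith
        nlinarith
  have h6 := h1.trans h5
  refine (CStarAlgebra.norm_le_iff_le_algebraMap _ (by positivity) ?_).2 h6
  exact star_left_conjugate_nonneg (star_mul_self_nonneg b) _

/-- The states of `A` that vanish on the self-adjoint part of `N`. -/
def statesVanishingOn (N : Submodule ℂ A) : Set (WeakDual ℂ A) :=
  {φ | (∀ a, 0 ≤ a → 0 ≤ φ a) ∧ (∀ n ∈ N, IsSelfAdjoint n → φ n = 0) ∧ φ 1 = 1}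

/-- Hahn–Banach separation of -b⋆b from the closure of a real convex cone. Were -b⋆b in that
closure, b⋆b would be at most an arbitrarily small scalar plus an element of `N`, putting b in `N`.
-/
theorem exists_mem_statesVanishingOn (N : Submodule ℂ A) (hN : IsClosed (N : Set A))
    (hl : ∀ n ∈ N, ∀ a, a * n ∈ N) (hr : ∀ n ∈ N, ∀ a, n * a ∈ N) {b : A} (hb : b ∉ N) :
    ∃ φ ∈ statesVanishingOn N, 0 < (φ (star b * b)).re := by
  -- The skew-adjoint summand forces the real part of the separating functional to vanish on skew
  -- elements, so that the functional is real on self-adjoint ones.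
  let s : Set A := {x | ∃ p n k : A, 0 ≤ p ∧ n ∈ N ∧ IsSelfAdjoint n ∧ star k = -k ∧ x = p + n + k}
  have hsc : Convex ℝ s := by
    rintro _ ⟨p, n, k, hp, hn, hns, hk, rfl⟩ _ ⟨p', n', k', hp', hn', hns', hk', rfl⟩ r r' h h' -
    refine ⟨r • p + r' • p', r • n + r' • n', r • k + r' • k',
      add_nonneg (smul_nonneg h hp) (smul_nonneg h' hp'), ?_, ?_, ?_, ?_⟩
    · rw [← Complex.coe_smul, ← Complex.coe_smul]
      exact N.add_mem (N.smul_mem _ hn) (N.smul_mem _ hn')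
    · exact (IsSelfAdjoint.smul (.all r) hns).add (IsSelfAdjoint.smul (.all r') hns')
    · rw [star_add, star_smul, star_smul, hk, hk']; simp; abel
    · simp only [smul_add]; abel
  have hx : -(star b * b) ∉ closure s := by
    intro hx
    refine hb (hN.closure_subset (Metric.mem_closure_iff.2 fun ε hε => ?_))
    -- With t = ε²/4 the preceding lemma yields ‖b - m‖² ≤ ε²/2 < ε².
    obtain ⟨y, ⟨p, n, k, hp, hn, hns, hk, rfl⟩, hy⟩ :=
      Metric.mem_closure_iff.1 hx (ε ^ 2 / 4) (by positivity)
    rw [dist_eq_norm] at hy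
    set r : A := -(star b * b) - (p + n + k) with hr'
    have hre : star b * b = -p + -n - (realPart r : A) := by
      rw [realPart_apply_coe, hr']
      simp only [star_sub, star_neg, star_mul, star_star, star_add, hk, hns.star_eq,
        (IsSelfAdjoint.of_nonneg hp).star_eq]
      have e : -(star b * b) - (p + n + k) + (-(star b * b) - (p + n + -k))
          = (2 : ℝ) • (-(star b * b) - p - n) := by rw [two_smul]; abel
      rw [e, smul_smul]
      norm_num
      abel
    have hle : star b * b ≤ algebraMap ℝ A (ε ^ 2 / 4) + -n := by
      rw [hre]
      have h1 : -(realPart r : A) ≤ algebraMap ℝ A (ε ^ 2 / 4) := by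
        have h2 : IsSelfAdjoint (-(realPart r : A)) := (realPart r).2.neg
        refine h2.le_algebraMap_norm_self.trans (algebraMap_mono A ?_)
        rw [norm_neg]
        exact (realPart.norm_le r).trans hy.le
      calc -p + -n - (realPart r : A) = -p + (-(realPart r : A) + -n) := by abel
        _ ≤ 0 + (algebraMap ℝ A (ε ^ 2 / 4) + -n) := by
          gcongr
          simpa using hp
        _ = _ := zero_add _
    obtain ⟨m, hm, hbm⟩ := exists_mem_ideal_norm_sub_sq_le N hN hl hr (by positivity) hns.neg
      (N.neg_mem hn) hle
    refine ⟨m, hm, ?_⟩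
    rw [dist_eq_norm]
    refine lt_of_pow_lt_pow_left₀ 2 hε.le (hbm.trans_lt ?_)
    nlinarith [sq_pos_of_pos hε]
  obtain ⟨f, u, hfs, hfu⟩ := RCLike.geometric_hahn_banach_closed_point (𝕜 := ℂ) hsc.closure
    isClosed_closure hx
  have hfs' : ∀ a ∈ s, (f a).re < u := fun a ha => hfs a (subset_closure ha)
  have hu : 0 < u := by
    simpa using hfs' 0 ⟨0, 0, 0, le_rfl, N.zero_mem, .zero _, by simp, by simp⟩
  have hcone : ∀ a ∈ s, (f a).re ≤ 0 := by
    intro a ha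
    by_contra! hc
    obtain ⟨p, n, k, hp, hn, hns, hk, rfl⟩ := ha
    set r : ℝ := u / (f (p + n + k)).re with hr'
    have hr0 : 0 ≤ r := by positivity
    have := hfs' (r • (p + n + k)) ⟨r • p, r • n, r • k, smul_nonneg hr0 hp, by
      rw [← Complex.coe_smul]; exact N.smul_mem _ hn, IsSelfAdjoint.smul (.all r) hns, by
      rw [star_smul, hk]; simp, by simp only [smul_add]⟩
    rw [← Complex.coe_smul, map_smul, smul_eq_mul, Complex.re_ofReal_mul, hr',
      div_mul_cancel₀ _ hc.ne'] at this
    exact lt_irrefl _ this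
  have hpos : ∀ p : A, 0 ≤ p → (f p).re ≤ 0 := fun p hp =>
    hcone p ⟨p, 0, 0, hp, N.zero_mem, .zero _, by simp, by simp⟩
  have hskew : ∀ k : A, star k = -k → (f k).re = 0 := fun k hk => by
    have h1 := hcone k ⟨0, 0, k, le_rfl, N.zero_mem, .zero _, hk, by simp⟩
    have h2 := hcone (-k) ⟨0, 0, -k, le_rfl, N.zero_mem, .zero _, by simp [hk], by simp⟩
    rw [map_neg, Complex.neg_re] at h2
    linarith
  have him : ∀ a : A, IsSelfAdjoint a → (f a).im = 0 := fun a ha => by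
    have := hskew (Complex.I • a) (by rw [star_smul, ha.star_eq]; simp)
    simpa using this
  have hNre : ∀ n ∈ N, IsSelfAdjoint n → (f n).re = 0 := fun n hn hns => by
    have h1 := hcone n ⟨0, n, 0, le_rfl, hn, hns, by simp, by simp⟩
    have h2 := hcone (-n) ⟨0, -n, 0, le_rfl, N.neg_mem hn, hns.neg, by simp, by simp⟩
    rw [map_neg, Complex.neg_re] at h2
    linarith
  have hb0 : (f (star b * b)).re < 0 := by
    have : u < (f (-(star b * b))).re := hfu
    rw [map_neg, Complex.neg_re] at this
    linarith
  have h1 : (f 1).re < 0 := by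
    have h2 : star b * b ≤ algebraMap ℝ A ‖star b * b‖ :=
      (IsSelfAdjoint.star_mul_self b).le_algebraMap_norm_self
    have h3 := hpos _ (sub_nonneg.2 h2)
    rw [map_sub, Algebra.algebraMap_eq_smul_one, ← Complex.coe_smul, map_smul, smul_eq_mul,
      Complex.sub_re, Complex.re_ofReal_mul] at h3
    by_contra! hc
    have := mul_nonneg (norm_nonneg (star b * b)) hc
    linarith
  -- The functional is nonpositive on positive elements and negative at 1, so dividing by its value
  -- at 1 corrects the sign and the normalization at once.
  set c : ℝ := ((f 1).re)⁻¹ with hc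
  have hc0 : c < 0 := inv_lt_zero.2 h1
  refine ⟨StrongDual.toWeakDual ((c : ℂ) • f), ⟨fun a ha => ?_, fun n hn hns => ?_, ?_⟩, ?_⟩
  · change 0 ≤ (c : ℂ) * f a
    rw [Complex.nonneg_iff, Complex.re_ofReal_mul, Complex.im_ofReal_mul, him a (.of_nonneg ha)]
    exact ⟨mul_nonneg_of_nonpos_of_nonpos hc0.le (hpos a ha), by simp⟩
  · change (c : ℂ) * f n = 0
    rw [Complex.ext (hNre n hn hns) (him n hns) (w := 0), mul_zero]
  · change (c : ℂ) * f 1 = 1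
    rw [Complex.ext (z := f 1) (w := ((f 1).re : ℝ)) (by simp) (by simp [him 1 (.one A)]), hc,
      ← Complex.ofReal_mul, inv_mul_cancel₀ h1.ne, Complex.ofReal_one]
  · change 0 < ((c : ℂ) * f (star b * b)).re
    rw [Complex.re_ofReal_mul]
    exact mul_pos_of_neg_of_neg hc0 hb0

/-- Banach–Alaoglu. The radius 4 comes from writing an element as a combination of four positive
elements of no larger norm; a state is contractive on each of them. -/
theorem isCompact_statesVanishingOn (N : Submodule ℂ A) : IsCompact (statesVanishingOn N) := by
  refine (WeakDual.isCompact_closedBall (𝕜 := ℂ) (E := A) 0 4).of_isClosed_subset ?_ ?_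
  · have hev : ∀ a : A, Continuous fun φ : WeakDual ℂ A => φ a := WeakDual.eval_continuous
    have : statesVanishingOn N = (⋂ (a : A) (_ : 0 ≤ a), {φ : WeakDual ℂ A | 0 ≤ φ a}) ∩
        ((⋂ (n : A) (_ : n ∈ N) (_ : IsSelfAdjoint n), {φ : WeakDual ℂ A | φ n = 0}) ∩
          {φ | φ 1 = 1}) := by
      ext φ
      simp [statesVanishingOn]
    rw [this]
    refine IsClosed.inter (isClosed_iInter fun a => isClosed_iInter fun _ => ?_)
      (IsClosed.inter (isClosed_iInter fun n => isClosed_iInter fun _ => isClosed_iInter fun _ => ?_)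
        (isClosed_eq (hev 1) continuous_const))
    · exact isClosed_le continuous_const (hev a)
    · exact isClosed_eq (hev n) continuous_const
  · rintro φ ⟨hpos, -, h1⟩
    rw [Set.mem_preimage, mem_closedBall_zero_iff]
    refine ContinuousLinearMap.opNorm_le_bound _ (by norm_num) fun x => ?_
    obtain ⟨y, hy0, hyn, hxy⟩ := CStarAlgebra.exists_sum_four_nonneg x
    have hb : ∀ p : A, 0 ≤ p → ‖φ p‖ ≤ ‖p‖ := fun p hp => by
      have h2 : p ≤ algebraMap ℝ A ‖p‖ := (IsSelfAdjoint.of_nonneg hp).le_algebraMap_norm_self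
      have h3 := hpos _ (sub_nonneg.2 h2)
      rw [map_sub, Algebra.algebraMap_eq_smul_one, ← Complex.coe_smul, map_smul, h1, smul_eq_mul,
        mul_one, sub_nonneg] at h3
      have h4 := CStarAlgebra.norm_le_norm_of_nonneg_of_le (hpos p hp) h3
      simpa using h4
    change ‖φ x‖ ≤ _
    conv_lhs => rw [hxy]
    rw [map_sum]
    refine (norm_sum_le _ _).trans ?_
    have : ∀ i ∈ (Finset.univ : Finset (Fin 4)), ‖φ (Complex.I ^ (i : ℕ) • y i)‖ ≤ ‖x‖ := fun i _ => by
      rw [map_smul, norm_smul, norm_pow, Complex.norm_I, one_pow, one_mul]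
      exact (hb _ (hy0 i)).trans (hyn i)
    simpa using Finset.sum_le_sum this

/-- A cyclic representation with a pure vector state is irreducible. -/
theorem eq_bot_or_eq_top_of_mem_extremePoints {N : Submodule ℂ A} {φ : WeakDual ℂ A}
    (hφ : φ ∈ (statesVanishingOn N).extremePoints ℝ) {H : Type v} [NormedAddCommGroup H]
    [InnerProductSpace ℂ H] [CompleteSpace H] (π : A →⋆ₐ[ℂ] (H →L[ℂ] H)) (ξ : H)
    (hξ : DenseRange fun a => π a ξ) (hφξ : ∀ a, φ a = ⟪ξ, π a ξ⟫_ℂ) (hπN : ∀ n ∈ N, π n = 0)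
    (V : Submodule ℂ H) (hV : IsClosed (V : Set H)) (hinv : ∀ a, ∀ v ∈ V, π a v ∈ V) :
    V = ⊥ ∨ V = ⊤ := by
  have : CompleteSpace V := hV.completeSpace_coe
  set P := V.starProjection with hP
  have hadj : ∀ (a : A) (v w : H), ⟪v, π a w⟫_ℂ = ⟪π (star a) v, w⟫_ℂ := fun a v w => by
    rw [map_star, ContinuousLinearMap.star_eq_adjoint, ContinuousLinearMap.adjoint_inner_left]
  have hcomm : ∀ (a : A) (v : H), P (π a v) = π a (P v) := fun a v => by
    refine Submodule.eq_starProjection_of_mem_orthogonal (hinv a _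
      (V.starProjection_apply_mem v)) ?_
    rw [← map_sub, Submodule.mem_orthogonal]
    intro w hw
    rw [hadj]
    exact (Submodule.mem_orthogonal _ _).1 (V.sub_starProjection_mem_orthogonal v) _
      (hinv _ _ hw)
  have hPP : ∀ v, P (P v) = P v := fun v =>
    V.starProjection_eq_self_iff.2 (V.starProjection_apply_mem v)
  have hPsa : ∀ v w, ⟪v, P w⟫_ℂ = ⟪P v, w⟫_ℂ := fun v w =>
    (V.inner_starProjection_left_eq_right v w).symm
  have hξ1 : ⟪ξ, ξ⟫_ℂ = 1 := by
    have := hφ.1.2.2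
    rwa [hφξ, map_one] at this
  set s : ℝ := ‖P ξ‖ ^ 2 with hs
  have hsi : ⟪ξ, P ξ⟫_ℂ = s := by
    rw [← hPP, hPsa, inner_self_eq_norm_sq_to_K, hs]; simp
  have hs' : ⟪ξ, ξ - P ξ⟫_ℂ = (1 - s : ℝ) := by
    rw [inner_sub_right, hξ1, hsi]; simp
  have hQ : ⟪ξ, ξ - P ξ⟫_ℂ = ‖ξ - P ξ‖ ^ 2 := by
    have h : P (ξ - P ξ) = 0 := by rw [map_sub, hPP, sub_self]
    have h2 : ⟪P ξ, ξ - P ξ⟫_ℂ = 0 := by rw [← hPsa, h, inner_zero_right]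
    calc ⟪ξ, ξ - P ξ⟫_ℂ = ⟪ξ - P ξ, ξ - P ξ⟫_ℂ := by
          rw [inner_sub_left ξ (P ξ), h2, sub_zero]
      _ = _ := inner_self_eq_norm_sq_to_K _
  have hs1 : 1 - s = ‖ξ - P ξ‖ ^ 2 := by
    have := hs'.symm.trans hQ
    exact_mod_cast this
  by_cases h0 : s = 0
  -- P commutes with the representation, so it is determined by Pξ: it is 0 if Pξ = 0 and, below,
  -- the identity if Pξ = ξ.
  · left
    have hPξ : P ξ = 0 := by rw [hs] at h0; simpa using h0
    have hP0 : ∀ v, P v = 0 := fun v => by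
      have : (fun v => P v) = fun _ => 0 := by
        refine hξ.equalizer P.continuous continuous_const ?_
        funext a
        simp [hcomm, hPξ]
      exact congrFun this v
    rw [eq_bot_iff]
    intro v hv
    rw [Submodule.mem_bot, ← hP0 v]
    exact (V.starProjection_eq_self_iff.2 hv).symm
  by_cases h1 : s = 1
  · right
    have hPξ : P ξ = ξ := by
      rw [h1, sub_self] at hs1
      have : ξ - P ξ = 0 := by simpa using hs1.symm
      exact (sub_eq_zero.1 this).symm
    rw [eq_top_iff]
    rintro v -
    have : (fun v => P v) = fun v => v := by
      refine hξ.equalizer P.continuous continuous_id ?_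
      funext a
      simp [hcomm, hPξ]
    rw [← V.starProjection_eq_self_iff]
    exact congrFun this v
  exfalso
  have hspos : 0 < s := lt_of_le_of_ne (by positivity) (Ne.symm h0)
  have hslt : 0 < 1 - s := lt_of_le_of_ne (by rw [hs1]; positivity) (by
    intro h; exact h1 (by linarith))
  have hvec : ∀ η : H, ∃ q : StrongDual ℂ A, ∀ a, q a = ⟪ξ, π a η⟫_ℂ := fun η =>
    ⟨⟨{ toFun := fun a => ⟪ξ, π a η⟫_ℂ
        map_add' := fun x y => by rw [map_add, add_apply, inner_add_right]
        map_smul' := fun r x => by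
          rw [map_smul, smul_apply, inner_smul_right]; rfl },
      by
        have : Continuous π := map_continuous π
        change Continuous fun a => ⟪ξ, π a η⟫_ℂ
        fun_prop⟩, fun a => rfl⟩
  have hstate : ∀ (η : H) (r : ℝ), 0 < r → ⟪ξ, η⟫_ℂ = r → (∀ a, ⟪ξ, π a η⟫_ℂ = ⟪η, π a η⟫_ℂ) →
      ∃ ψ ∈ statesVanishingOn N, ∀ a, ψ a = (r⁻¹ : ℝ) * ⟪ξ, π a η⟫_ℂ := by
    intro η r hr hη hηη
    obtain ⟨q, hq⟩ := hvec η
    have hval : ∀ a, (StrongDual.toWeakDual (((r⁻¹ : ℝ) : ℂ) • q)) a = (r⁻¹ : ℝ) * ⟪ξ, π a η⟫_ℂ :=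
      fun a => by rw [← hq a]; rfl
    refine ⟨StrongDual.toWeakDual (((r⁻¹ : ℝ) : ℂ) • q), ⟨fun a ha => ?_, fun n hn _ => ?_, ?_⟩, hval⟩
    · rw [hval, hηη]
      obtain ⟨c, rfl⟩ := CStarAlgebra.nonneg_iff_eq_star_mul_self.1 ha
      rw [map_mul, mul_apply_eq_comp, hadj, star_star, inner_self_eq_norm_sq_to_K]
      have : (0 : ℂ) ≤ ((r⁻¹ * ‖π c η‖ ^ 2 : ℝ) : ℂ) := by
        rw [Complex.zero_le_real]; positivity
      simpa using this
    · rw [hval, hπN n hn]; simp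
    · rw [hval, map_one, one_apply_eq_self, hη, ← Complex.ofReal_mul,
        inv_mul_cancel₀ hr.ne', Complex.ofReal_one]
  obtain ⟨ψ₁, hψ₁, h₁⟩ := hstate (P ξ) s hspos hsi fun a => by
    rw [← hcomm, ← hPsa, hcomm, hcomm, hPP]
  obtain ⟨ψ₂, hψ₂, h₂⟩ := hstate (ξ - P ξ) (1 - s) hslt hs' fun a => by
    have : ⟪P ξ, π a (ξ - P ξ)⟫_ℂ = 0 := by
      rw [← hPsa, hcomm, map_sub, hPP, sub_self, map_zero, inner_zero_right]
    rw [inner_sub_left ξ (P ξ), this, sub_zero]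
  -- If 0 < s < 1, cutting ξ by P and 1 - P writes φ as a proper convex combination of two states;
  -- extremality then makes Pξ = sξ, which contradicts P² = P.
  have hseg : φ ∈ openSegment ℝ ψ₁ ψ₂ := by
    refine ⟨s, 1 - s, hspos, hslt, by ring, ?_⟩
    refine DFunLike.ext _ _ fun a => ?_
    change s • ψ₁ a + (1 - s) • ψ₂ a = φ a
    rw [h₁, h₂, hφξ, map_sub, inner_sub_right]
    simp only [Complex.real_smul]
    rw [← mul_assoc, ← mul_assoc, ← Complex.ofReal_mul, ← Complex.ofReal_mul,
      mul_inv_cancel₀ hspos.ne', mul_inv_cancel₀ hslt.ne']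
    simp
  have heq := (mem_extremePoints.1 hφ).2 ψ₁ hψ₁ ψ₂ hψ₂ hseg
  have hq : ∀ a, ⟪ξ, π a (P ξ)⟫_ℂ = s * ⟪ξ, π a ξ⟫_ℂ := fun a => by
    rw [← hφξ a, ← heq.1, h₁, ← mul_assoc, ← Complex.ofReal_mul, mul_inv_cancel₀ hspos.ne']
    simp
  have hPξ : P ξ = (s : ℂ) • ξ := by
    refine ext_inner_left ℂ fun v => ?_
    have : (fun v => ⟪v, P ξ⟫_ℂ) = fun v => ⟪v, (s : ℂ) • ξ⟫_ℂ := by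
      refine hξ.equalizer (by fun_prop) (by fun_prop) ?_
      funext c
      have := hq (star c)
      rw [hadj, hadj, star_star] at this
      simp only [Function.comp_apply, this, inner_smul_right]
    exact congrFun this v
  have h2 := hPP ξ
  rw [hPξ, map_smul, hPξ, smul_smul] at h2
  have h3 := congrArg (fun v => ⟪ξ, v⟫_ℂ) h2
  simp only [inner_smul_right, hξ1, mul_one] at h3
  have h4 : s * s = s := by exact_mod_cast h3
  exact h1 (by field_simp at h4; exact h4)

/-- Points outside a closed two-sided ideal are detected by an irreducible representation that
kills the ideal. -/
theorem exists_irreducible_rep_of_notMem (N : Submodule ℂ A) (hN : IsClosed (N : Set A))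
    (hl : ∀ n ∈ N, ∀ a, a * n ∈ N) (hr : ∀ n ∈ N, ∀ a, n * a ∈ N) {b : A} (hb : b ∉ N) :
    ∃ (H : Type u) (_ : NormedAddCommGroup H) (_ : InnerProductSpace ℂ H) (_ : CompleteSpace H)
      (π : A →⋆ₐ[ℂ] (H →L[ℂ] H)), (∀ n ∈ N, π n = 0) ∧ π b ≠ 0 ∧
      ∀ V : Submodule ℂ H, IsClosed (V : Set H) → (∀ a, ∀ v ∈ V, π a v ∈ V) → V = ⊥ ∨ V = ⊤ := by
  obtain ⟨φ₀, hφ₀, hφ₀b⟩ := exists_mem_statesVanishingOn N hN hl hr hb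
  have hK := isCompact_statesVanishingOn N
  have hlc : LocallyConvexSpace ℝ (WeakDual ℂ A) :=
    Topology.IsInducing.locallyConvexSpace (f := 
      { toFun := fun φ : WeakDual ℂ A => fun a => φ a
        map_add' := fun _ _ => rfl
        map_smul' := fun _ _ => rfl }) ⟨rfl⟩
  have hcont : Continuous fun φ : WeakDual ℂ A => (φ (star b * b)).re :=
    Complex.continuous_re.comp (WeakDual.eval_continuous _)
  obtain ⟨φ₁, hφ₁, hmax⟩ := hK.exists_isMaxOn ⟨_, hφ₀⟩ hcont.continuousOn
  let l : StrongDual ℝ (WeakDual ℂ A) :=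
    ⟨{ toFun := fun φ => (φ (star b * b)).re
       map_add' := fun _ _ => rfl
       map_smul' := fun r φ => by
        change (r • φ (star b * b)).re = _
        simp }, hcont⟩
  -- The maximizers of φ ↦ φ(b⋆b) form a compact face. An extreme point of that face is extreme
  -- among all the states and still has φ(b⋆b) > 0, so its GNS representation does not kill b.
  have hexp : IsExposed ℝ (statesVanishingOn N) (l.toExposed (statesVanishingOn N)) :=
    ContinuousLinearMap.toExposed.isExposed
  obtain ⟨φ, hφ⟩ := (hexp.isCompact hK).extremePoints_nonempty ⟨φ₁, hφ₁, fun y hy => hmax hy⟩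
  have hφb : 0 < (φ (star b * b)).re := hφ₀b.trans_le (hφ.1.2 φ₀ hφ₀)
  have hφe := hexp.isExtreme.extremePoints_subset_extremePoints hφ
  obtain ⟨hpos, hφN, hφ1⟩ := hφe.1
  let f : A →ₚ[ℂ] ℂ := PositiveLinearMap.mk₀ (φ : A →L[ℂ] ℂ).toLinearMap hpos
  have hf : ∀ a, f a = φ a := fun a => rfl
  have hd : DenseRange fun a => f.gnsStarAlgHom a (f.toPreGNS 1 : f.GNS) := by
    have : (fun a => f.gnsStarAlgHom a (f.toPreGNS 1 : f.GNS)) =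
        ((↑) : f.PreGNS → f.GNS) ∘ f.toPreGNS := by
      funext a
      simp
    rw [this]
    exact UniformSpace.Completion.denseRange_coe.comp f.toPreGNS.surjective.denseRange
      (UniformSpace.Completion.continuous_coe _)
  have hin : ∀ a c : A, ⟪((f.toPreGNS a : f.PreGNS) : f.GNS), ((f.toPreGNS c : f.PreGNS) : f.GNS)⟫_ℂ
      = φ (star a * c) := fun a c => by
    rw [UniformSpace.Completion.inner_coe]; rfl
  have happ : ∀ a c : A, f.gnsStarAlgHom a (f.toPreGNS c : f.GNS) = f.toPreGNS (a * c) :=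
    fun a c => by simp
  have hkill : ∀ n ∈ N, f.gnsStarAlgHom n = 0 := fun n hn => by
    refine ContinuousLinearMap.ext fun v => ?_
    have : (fun v => f.gnsStarAlgHom n v) = fun _ => 0 := by
      refine UniformSpace.Completion.denseRange_coe.equalizer
        (f.gnsStarAlgHom n).continuous continuous_const ?_
      funext c
      obtain ⟨c, rfl⟩ := f.toPreGNS.surjective c
      simp only [Function.comp_apply]
      rw [happ, ← inner_self_eq_zero (𝕜 := ℂ), hin]
      refine hφN _ (hl _ (hr _ hn _) _) (IsSelfAdjoint.star_mul_self _)
    exact congrFun this v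
  refine ⟨f.GNS, inferInstance, inferInstance, inferInstance, f.gnsStarAlgHom, hkill, fun h0 => ?_,
    fun V hV hinv => eq_bot_or_eq_top_of_mem_extremePoints hφe f.gnsStarAlgHom
      (f.toPreGNS 1 : f.GNS) hd (fun a => ?_) hkill V hV hinv⟩
  · have : φ (star b * b) = 0 := by
      rw [← hin b b]
      have h := happ b 1
      rw [mul_one] at h
      rw [← h, h0]
      simp
    rw [this] at hφb
    simp at hφb
  · rw [happ, hin]; simp

end PureStates

/-- A `TwoSidedIdeal` is only a ring ideal; scalars enter because r • x is the limit of (r • w) * x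
along an approximate unit. -/
theorem ClosedIdeal.smul_mem {B : Type u} [NonUnitalCStarAlgebra B] (I : ClosedIdeal B) (r : ℂ)
    {x : B} (hx : x ∈ I.1) : r • x ∈ I.1 := by
  let _ := CStarAlgebra.spectralOrder B
  have := CStarAlgebra.spectralOrderedRing B
  have hl := (CStarAlgebra.increasingApproximateUnit B).toIsApproximateUnit
  have hne := hl.neBot
  have h : Filter.Tendsto (fun w => (r • w) * x) (CStarAlgebra.approximateUnit B) (nhds (r • x)) := by
    simp only [smul_mul_assoc]
    exact (hl.tendsto_mul_right x).const_smul r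
  exact I.2.mem_of_tendsto h (Filter.Eventually.of_forall fun w => I.1.mul_mem_left _ _ hx)

/-- A closed two-sided ideal is the intersection of the primitive ideals that contain it. -/
theorem ClosedIdeal.exists_primitive_of_notMem {B : Type u} [NonUnitalCStarAlgebra B]
    (I : ClosedIdeal B) {b : B} (hb : b ∉ I.1) :
    ∃ P : PrimitiveIdeals B, (∀ a ∈ I.1, a ∈ P.1.1) ∧ b ∉ P.1.1 := by
  let _ := CStarAlgebra.spectralOrder (Unitization ℂ B)
  have := CStarAlgebra.spectralOrderedRing (Unitization ℂ B)
  have hsmul : ∀ (r : ℂ) (x : B), x ∈ I.1 → r • x ∈ I.1 := fun r x hx => I.smul_mem r hx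
  let N : Submodule ℂ (Unitization ℂ B) :=
    { carrier := (fun x : B => (x : Unitization ℂ B)) '' (I.1 : Set B)
      add_mem' := by
        rintro _ _ ⟨x, hx, rfl⟩ ⟨y, hy, rfl⟩
        exact ⟨x + y, I.1.add_mem hx hy, Unitization.inr_add ℂ x y⟩
      zero_mem' := ⟨0, I.1.zero_mem, Unitization.inr_zero ℂ⟩
      smul_mem' := by
        rintro r _ ⟨x, hx, rfl⟩
        exact ⟨r • x, hsmul r x hx, Unitization.inr_smul ℂ r x⟩ }
  have hN : IsClosed (N : Set (Unitization ℂ B)) :=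
    (Unitization.isometry_inr (𝕜 := ℂ) (A := B)).isClosedEmbedding.isClosedMap _ I.2
  have hl : ∀ n ∈ N, ∀ a, a * n ∈ N := by
    rintro _ ⟨x, hx, rfl⟩ a
    induction a using Unitization.ind with
    | _ r a =>
      refine ⟨r • x + a * x, I.1.add_mem (hsmul r x hx) (I.1.mul_mem_left _ _ hx), ?_⟩
      simp [add_mul, Unitization.inl_mul_inr]
  have hr : ∀ n ∈ N, ∀ a, n * a ∈ N := by
    rintro _ ⟨x, hx, rfl⟩ a
    induction a using Unitization.ind with
    | _ r a =>
      refine ⟨r • x + x * a, I.1.add_mem (hsmul r x hx) (I.1.mul_mem_right _ _ hx), ?_⟩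
      simp [mul_add, Unitization.inr_mul_inl]
  have hbN : (b : Unitization ℂ B) ∉ N := by
    rintro ⟨x, hx, hxb⟩
    exact hb (by rwa [← Unitization.inr_injective hxb])
  obtain ⟨H, _, _, _, π, hπN, hπb, hirr⟩ := exists_irreducible_rep_of_notMem N hN hl hr hbN
  let ρ : B →⋆ₙₐ[ℂ] (H →L[ℂ] H) :=
    (π : Unitization ℂ B →⋆ₙₐ[ℂ] (H →L[ℂ] H)).comp (Unitization.inrNonUnitalStarAlgHom ℂ B)
  have hρ : ∀ x, ρ x = π (x : Unitization ℂ B) := fun x => rfl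
  let K : ClosedIdeal B := ClosedIdeal.ofSet {x | ρ x = 0}
    (isClosed_eq ((map_continuous π).comp (Unitization.isometry_inr (𝕜 := ℂ) (A := B)).continuous)
      continuous_const) (map_zero ρ)
    (fun {x y} hx hy => by
      change ρ (x + y) = 0
      rw [map_add, hx, hy, add_zero])
    (fun {x} hx => by
      change ρ (-x) = 0
      rw [map_neg, hx, neg_zero])
    (fun {x y} hy => by
      change ρ (x * y) = 0
      rw [map_mul, hy, mul_zero])
    (fun {x y} hx => by
      change ρ (x * y) = 0
      rw [map_mul, hx, zero_mul])
  have hK : ∀ x, x ∈ K.1 ↔ ρ x = 0 := fun x => ClosedIdeal.mem_ofSet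
  refine ⟨⟨K, H, inferInstance, inferInstance, inferInstance, ρ, ⟨fun h0 => hπb ?_, ?_⟩, hK⟩,
    fun a ha => (hK a).2 (hπN _ ⟨a, ha, rfl⟩), fun hbK => hπb ((hK b).1 hbK)⟩
  · rw [← hρ, h0]; rfl
  · intro V hV hinv
    refine hirr V hV fun a v hv => ?_
    induction a using Unitization.ind with
    | _ r a =>
      rw [map_add, add_apply]
      refine V.add_mem ?_ (hinv a v hv)
      have : (Unitization.inl r : Unitization ℂ B) = algebraMap ℂ _ r := rfl
      rw [this, Algebra.algebraMap_eq_smul_one, map_smul, map_one]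
      exact V.smul_mem r hv

/-! ### The algebra `C₀(G, B)` -/

section ZeroAtInfty

open Filter Topology

theorem ClosedIdeal.ext {A : Type u} [NonUnitalCStarAlgebra A] {I J : ClosedIdeal A}
    (h : ∀ x, x ∈ I.1 ↔ x ∈ J.1) : I = J :=
  Subtype.ext (TwoSidedIdeal.ext h)

theorem ClosedIdeal.mem_image {A : Type u} [NonUnitalCStarAlgebra A] {e : A ≃⋆ₐ[ℂ] A}
    {I : ClosedIdeal A} {x : A} : x ∈ (I.image e).1 ↔ ∃ y ∈ I.1, e y = x := by
  unfold ClosedIdeal.image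
  exact ClosedIdeal.mem_ofSet

/-- A C⋆-algebra has a contractive two-sided approximate unit. -/
theorem exists_approximateUnit (A : Type u) [NonUnitalCStarAlgebra A] :
    ∃ l : Filter A, l.NeBot ∧ (∀ᶠ w in l, ‖w‖ ≤ 1) ∧
      (∀ a, Tendsto (fun w => w * a) l (𝓝 a)) ∧ ∀ a, Tendsto (fun w => a * w) l (𝓝 a) := by
  let _ := CStarAlgebra.spectralOrder A
  have := CStarAlgebra.spectralOrderedRing A
  have hl := CStarAlgebra.increasingApproximateUnit A
  exact ⟨_, hl.toIsApproximateUnit.neBot, hl.eventually_norm, hl.tendsto_mul_right,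
    hl.tendsto_mul_left⟩

/-- A separable C⋆-algebra has a sequential contractive left approximate unit. -/
theorem exists_seq_approximateUnit (A : Type u) [NonUnitalCStarAlgebra A]
    [TopologicalSpace.SeparableSpace A] :
    ∃ w : ℕ → A, (∀ n, ‖w n‖ ≤ 1) ∧ ∀ a, Tendsto (fun n => w n * a) atTop (𝓝 a) := by
  obtain ⟨l, hne, hn, hl, -⟩ := exists_approximateUnit A
  have hex : ∀ n : ℕ, ∃ w : A, ‖w‖ ≤ 1 ∧ ∀ k ≤ n,
      ‖w * TopologicalSpace.denseSeq A k - TopologicalSpace.denseSeq A k‖ < 1 / (n + 1) := by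
    intro n
    have h1 : ∀ᶠ w in l, ∀ k ∈ Finset.range (n + 1),
        ‖w * TopologicalSpace.denseSeq A k - TopologicalSpace.denseSeq A k‖ < 1 / (n + 1 : ℝ) := by
      rw [Filter.eventually_all_finset]
      intro k _
      have := Metric.tendsto_nhds.1 (hl (TopologicalSpace.denseSeq A k)) (1 / (n + 1 : ℝ))
        (by positivity)
      simpa [dist_eq_norm] using this
    obtain ⟨w, hw1, hw2⟩ := (hn.and h1).exists
    exact ⟨w, hw1, fun k hk => hw2 k (Finset.mem_range.2 (Nat.lt_succ_of_le hk))⟩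
  choose w hw1 hw2 using hex
  refine ⟨w, hw1, fun a => Metric.tendsto_atTop.2 fun ε hε => ?_⟩
  obtain ⟨_, ⟨k, rfl⟩, hk⟩ := Metric.mem_closure_iff.1
    (TopologicalSpace.denseRange_denseSeq A a) (ε / 3) (by positivity)
  obtain ⟨m, hm⟩ := exists_nat_one_div_lt (show 0 < ε / 3 by positivity)
  refine ⟨max k m, fun n hn' => ?_⟩
  set d := TopologicalSpace.denseSeq A k with hd
  have h1 : ‖w n * d - d‖ < ε / 3 := by
    refine (hw2 n k ((le_max_left _ _).trans hn')).trans_le (le_trans ?_ hm.le)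
    have : (m : ℝ) ≤ n := by exact_mod_cast (le_max_right _ _).trans hn'
    gcongr
  rw [dist_eq_norm] at hk ⊢
  have h2 : ‖w n * (a - d)‖ < ε / 3 :=
    (norm_mul_le _ _).trans_lt (lt_of_le_of_lt (mul_le_of_le_one_left (norm_nonneg _) (hw1 n)) hk)
  have e : w n * a - a = w n * (a - d) + (w n * d - d) - (a - d) := by rw [mul_sub]; abel
  rw [e]
  calc _ ≤ ‖w n * (a - d)‖ + ‖w n * d - d‖ + ‖a - d‖ :=
        (norm_sub_le _ _).trans (by gcongr; exact norm_add_le _ _)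
    _ < ε := by linarith

variable {G : Type u} [TopologicalSpace G] {B : Type v} [NonUnitalCStarAlgebra B]

theorem mem_tensorIdeal {I : ClosedIdeal B} {f : C₀(G, B)} :
    f ∈ (tensorIdeal G I).1 ↔ ∀ h, f h ∈ I.1 := by
  unfold tensorIdeal
  exact ClosedIdeal.mem_ofSet

theorem mem_pointIdeal {h : G} {I : ClosedIdeal B} {f : C₀(G, B)} :
    f ∈ (pointIdeal h I).1 ↔ f h ∈ I.1 := by
  unfold pointIdeal
  exact ClosedIdeal.mem_ofSet

theorem ZeroAtInftyContinuousMap.norm_apply_le (f : C₀(G, B)) (h : G) : ‖f h‖ ≤ ‖f‖ :=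
  f.toBCF.norm_coe_le_norm h

theorem ZeroAtInftyContinuousMap.norm_le_of_forall {f : C₀(G, B)} {c : ℝ} (hc : 0 ≤ c)
    (hf : ∀ h, ‖f h‖ ≤ c) : ‖f‖ ≤ c :=
  (BoundedContinuousFunction.norm_le hc).2 hf

/-- Evaluation at a point. -/
def evalHom (t : G) : C₀(G, B) →⋆ₙₐ[ℂ] B where
  toFun f := f t
  map_smul' _ _ := rfl
  map_zero' := rfl
  map_add' _ _ := rfl
  map_mul' _ _ := rfl
  map_star' _ := rfl

/-- The constant functions with values in `B`, as multipliers of `C₀(G, B)`. -/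
def constMultiplier (G : Type u) [TopologicalSpace G] {B : Type v} [NonUnitalCStarAlgebra B] :
    B →⋆ₙₐ[ℂ] 𝓜(ℂ, C₀(G, B)) where
  toFun b :=
    { fst := LinearMap.mkContinuous
        { toFun := fun a => ⟨⟨fun h => b * a h, by fun_prop⟩, by
            simpa using a.zero_at_infty'.const_mul b⟩
          map_add' := fun x y => by ext h; exact mul_add _ _ _
          map_smul' := fun r x => by ext h; exact mul_smul_comm _ _ _ } ‖b‖ fun a =>
        ZeroAtInftyContinuousMap.norm_le_of_forall (by positivity) fun h =>
          (norm_mul_le _ _).trans (by gcongr; exact a.norm_apply_le h)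
      snd := LinearMap.mkContinuous
        { toFun := fun a => ⟨⟨fun h => a h * b, by fun_prop⟩, by
            simpa using a.zero_at_infty'.mul_const b⟩
          map_add' := fun x y => by ext h; exact add_mul _ _ _
          map_smul' := fun r x => by ext h; exact smul_mul_assoc _ _ _ } ‖b‖ fun a =>
        ZeroAtInftyContinuousMap.norm_le_of_forall (by positivity) fun h =>
          (norm_mul_le _ _).trans (by
            rw [mul_comm]; gcongr; exact a.norm_apply_le h)
      central := fun x y => by ext h; exact mul_assoc _ _ _ }
  map_smul' r b := by
    ext x h
    · exact smul_mul_assoc _ _ _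
    · exact mul_smul_comm _ _ _
  map_zero' := by
    ext x h
    · exact zero_mul _
    · exact mul_zero _
  map_add' b c := by
    ext x h
    · exact add_mul _ _ _
    · exact mul_add _ _ _
  map_mul' b c := by
    ext x h
    · exact mul_assoc _ _ _
    · exact (mul_assoc _ _ _).symm
  map_star' b := by
    ext x h
    · change star b * x h = star (star (x h) * b)
      rw [star_mul, star_star]
    · change x h * star b = star (b * star (x h))
      rw [star_mul, star_star]

@[simp]
theorem constMultiplier_fst_apply (b : B) (a : C₀(G, B)) (h : G) :
    (constMultiplier G b).fst a h = b * a h := rfl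

/-- Multiplication of a function vanishing at infinity by a bounded scalar function. -/
def boundedSMul (χ : C(G, ℝ)) (hχ : ∀ h, ‖χ h‖ ≤ 1) (f : C₀(G, B)) : C₀(G, B) :=
  ⟨⟨fun h => χ h • f h, by fun_prop⟩, by
    have h0 := tendsto_zero_iff_norm_tendsto_zero.1 f.zero_at_infty'
    refine squeeze_zero_norm (fun h => ?_) h0
    rw [norm_smul]
    exact mul_le_of_le_one_left (norm_nonneg _) (hχ h)⟩

@[simp]
theorem boundedSMul_apply (χ : C(G, ℝ)) (hχ : ∀ h, ‖χ h‖ ≤ 1) (f : C₀(G, B)) (h : G) :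
    boundedSMul χ hχ f h = χ h • f h := rfl

/-- The product χf is the norm limit of (χw)f along an approximate unit w of C₀(G, B), and χw is
again in the algebra. -/
theorem boundedSMul_mem (J : ClosedIdeal C₀(G, B)) (χ : C(G, ℝ)) (hχ : ∀ h, ‖χ h‖ ≤ 1)
    {f : C₀(G, B)} (hf : f ∈ J.1) : boundedSMul χ hχ f ∈ J.1 := by
  obtain ⟨l, hne, -, hl, -⟩ := exists_approximateUnit C₀(G, B)
  refine J.2.mem_of_tendsto (f := fun w => boundedSMul χ hχ w * f) (b := l) ?_
    (Eventually.of_forall fun w => J.1.mul_mem_left _ _ hf)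
  rw [tendsto_iff_norm_sub_tendsto_zero]
  refine squeeze_zero (fun _ => norm_nonneg _) (fun w => ?_)
    (tendsto_iff_norm_sub_tendsto_zero.1 (hl f))
  refine ZeroAtInftyContinuousMap.norm_le_of_forall (norm_nonneg _) fun h => ?_
  have : (boundedSMul χ hχ w * f - boundedSMul χ hχ f) h = χ h • ((w * f - f) h) := by
    simp [smul_sub, smul_mul_assoc]
  rw [this, norm_smul]
  exact (mul_le_of_le_one_left (norm_nonneg _) (hχ h)).trans
    (ZeroAtInftyContinuousMap.norm_apply_le _ h)

/-- The elementary tensor `χ ⊗ b`. -/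
def elemTensor (χ : C(G, ℝ)) (hχ : HasCompactSupport χ) (b : B) : C₀(G, B) :=
  ⟨⟨fun h => χ h • b, by fun_prop⟩, by
    have : HasCompactSupport fun h => χ h • b := hχ.smul_right
    exact this.is_zero_at_infty⟩

@[simp]
theorem elemTensor_apply (χ : C(G, ℝ)) (hχ : HasCompactSupport χ) (b : B) (h : G) :
    elemTensor χ hχ b h = χ h • b := rfl

variable [T2Space G] [LocallyCompactSpace G]

theorem exists_zeroAtInfty_apply_eq (t : G) (b : B) : ∃ f : C₀(G, B), f t = b := by
  obtain ⟨χ, h1, -, hc, -⟩ := exists_continuous_one_zero_of_isCompact (isCompact_singleton (x := t))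
    (isClosed_empty) (Set.disjoint_empty _)
  refine ⟨elemTensor χ hc b, ?_⟩
  have : χ t = 1 := h1 rfl
  simp [this]

/-- The values of `f` at a point lie in `I` as soon as the multiplier `f(t)` maps into `C₀(G) ⊗ I`. -/
theorem mem_of_forall_constMultiplier_mem (I : ClosedIdeal B) {b : B} (t : G)
    (h : ∀ a, (constMultiplier G b).fst a ∈ (tensorIdeal G I).1) : b ∈ I.1 := by
  obtain ⟨l, hne, -, -, hl⟩ := exists_approximateUnit B
  refine I.2.mem_of_tendsto (hl b) (Eventually.of_forall fun w => ?_)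
  obtain ⟨a, rfl⟩ := exists_zeroAtInfty_apply_eq (B := B) t w
  exact mem_tensorIdeal.1 (h a) t

/-- A function that is pointwise a limit of elements of a closed ideal belongs to the ideal. -/
theorem mem_of_forall_approx [SecondCountableTopology G] (J : ClosedIdeal C₀(G, B)) {f : C₀(G, B)}
    (hf : ∀ t, ∀ ε > 0, ∃ j ∈ J.1, ‖f t - j t‖ < ε) : f ∈ J.1 := by
  refine J.2.closure_subset (Metric.mem_closure_iff.2 fun ε hε => ?_)
  have hK : IsCompact {h : G | ε / 4 ≤ ‖f h‖} := by
    have h0 := (tendsto_zero_iff_norm_tendsto_zero.1 f.zero_at_infty').eventually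
      (gt_mem_nhds (show 0 < ε / 4 by positivity))
    obtain ⟨K, hK, hKf⟩ := mem_cocompact.1 h0
    refine hK.of_isClosed_subset (isClosed_le continuous_const (map_continuous f).norm) fun h hh => ?_
    by_contra hc
    exact absurd (show ‖f h‖ < ε / 4 from hKf hc) (not_lt.2 hh)
  set K := {h : G | ε / 4 ≤ ‖f h‖} with hKdef
  choose j hj hjf using fun t => hf t (ε / 4) (by positivity)
  have hopen : ∀ t, IsOpen {h : G | ‖f h - j t h‖ < ε / 4} := fun t =>
    isOpen_lt ((map_continuous f).sub (map_continuous (j t))).norm continuous_const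
  obtain ⟨s, hs⟩ := hK.elim_finite_subcover (fun t => {h : G | ‖f h - j t h‖ < ε / 4}) hopen
    fun t _ => Set.mem_iUnion.2 ⟨t, hjf t⟩
  have hs' : K ⊆ ⋃ i : s, {h : G | ‖f h - j i h‖ < ε / 4} := by
    intro h hh
    obtain ⟨i, hi, hih⟩ := Set.mem_iUnion₂.1 (hs hh)
    exact Set.mem_iUnion.2 ⟨⟨i, hi⟩, hih⟩
  obtain ⟨p, hp⟩ := PartitionOfUnity.exists_isSubordinate hK.isClosed
    (fun i : s => {h : G | ‖f h - j i h‖ < ε / 4}) (fun i => hopen i) hs'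
  have hp1 : ∀ i h, ‖p i h‖ ≤ 1 := fun i h => by
    rw [Real.norm_of_nonneg (p.nonneg i h)]; exact p.le_one i h
  refine ⟨∑ i : s, boundedSMul (p i) (hp1 i) (j i), sum_mem fun i _ => boundedSMul_mem J _ _ (hj i), ?_⟩
  rw [dist_eq_norm]
  refine lt_of_le_of_lt (b := ε / 2)
    (ZeroAtInftyContinuousMap.norm_le_of_forall (by positivity) fun h => ?_) (by linarith)
  have hsum : ∑ i, p i h ≤ 1 := by
    rw [← finsum_eq_sum_of_fintype]; exact p.sum_le_one h
  have hsum0 : 0 ≤ ∑ i, p i h := Finset.sum_nonneg fun i _ => p.nonneg i h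
  -- The first term is zero on `K`, where the partition sums to 1, and is small off `K`, where f is
  -- small. Each summand of the second is small on the support of its weight.
  have e : (f - ∑ i : s, boundedSMul (p i) (hp1 i) (j i)) h
      = (1 - ∑ i, p i h) • f h + ∑ i, p i h • (f h - j i h) := by
    have e1 : (∑ i : s, boundedSMul (p i) (hp1 i) (j i)) h = ∑ i, p i h • j i h := by
      change evalHom h _ = _
      rw [map_sum]; rfl
    rw [ZeroAtInftyContinuousMap.sub_apply, e1]
    simp only [smul_sub, Finset.sum_sub_distrib, sub_smul, one_smul, ← Finset.sum_smul]
    abel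
  rw [e]
  have h1 : ‖(1 - ∑ i, p i h) • f h‖ ≤ ε / 4 := by
    rw [norm_smul, Real.norm_of_nonneg (by linarith)]
    by_cases hh : h ∈ K
    · have : ∑ i, p i h = 1 := by
        rw [← finsum_eq_sum_of_fintype]; exact p.sum_eq_one hh
      rw [this]; simp; positivity
    · have : ‖f h‖ < ε / 4 := not_le.1 hh
      exact (mul_le_of_le_one_left (norm_nonneg _) (by linarith)).trans this.le
  have h2 : ‖∑ i, p i h • (f h - j i h)‖ ≤ ε / 4 := by
    calc _ ≤ ∑ i, p i h * (ε / 4) := by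
          refine norm_sum_le_of_le _ fun i _ => ?_
          rw [norm_smul, Real.norm_of_nonneg (p.nonneg i h)]
          by_cases hi : p i h = 0
          · simp [hi]
          · have : h ∈ tsupport (p i) := subset_tsupport _ hi
            exact mul_le_mul_of_nonneg_left (le_of_lt (hp i this)) (p.nonneg i h)
      _ = (∑ i, p i h) * (ε / 4) := (Finset.sum_mul _ _ _).symm
      _ ≤ ε / 4 := mul_le_of_le_one_left (by positivity) hsum
  exact (norm_add_le _ _).trans (by linarith)

/-- A closed ideal of `C₀(G) ⊗ B` that is invariant under moving values is of the form
`C₀(G) ⊗ I`. -/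
theorem exists_eq_tensorIdeal [SecondCountableTopology G] (J : ClosedIdeal C₀(G, B))
    (hJ : ∀ f ∈ J.1, ∀ t a, (constMultiplier G (f t)).fst a ∈ J.1) :
    ∃ I : ClosedIdeal B, J = tensorIdeal G I := by
  have hcont : ∀ a a' : C₀(G, B), Continuous fun b => a' * (constMultiplier G b).fst a := by
    intro a a'
    have h1 : Continuous fun b => (constMultiplier G b : 𝓜(ℂ, C₀(G, B))).fst a := by
      refine LipschitzWith.continuous (K := ‖a‖₊) (LipschitzWith.of_dist_le_mul fun b c => ?_)
      rw [dist_eq_norm, dist_eq_norm]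
      refine ZeroAtInftyContinuousMap.norm_le_of_forall (by positivity) fun h => ?_
      have : ((constMultiplier G b).fst a - (constMultiplier G c).fst a) h = (b - c) * a h := by
        simp [sub_mul]
      rw [this, mul_comm (‖a‖₊ : ℝ)]
      exact (norm_mul_le _ _).trans (by gcongr; exact a.norm_apply_le h)
    exact continuous_const.mul h1
  -- Multiplying on both sides makes the left ideal property available: the centralizer identity
  -- moves a left factor of b onto a'.
  let I : ClosedIdeal B := ClosedIdeal.ofSet
    {b | ∀ a a' : C₀(G, B), a' * (constMultiplier G b).fst a ∈ J.1}
    (by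
      simp only [Set.ofPred_forall]
      exact isClosed_iInter fun a => isClosed_iInter fun a' => J.2.preimage (hcont a a'))
    (fun a a' => by
      rw [map_zero]
      change a' * 0 ∈ J.1
      rw [mul_zero]; exact J.1.zero_mem)
    (fun {x y} hx hy a a' => by
      rw [map_add]
      change a' * ((constMultiplier G x).fst a + (constMultiplier G y).fst a) ∈ J.1
      rw [mul_add]; exact J.1.add_mem (hx a a') (hy a a'))
    (fun {x} hx a a' => by
      rw [map_neg]
      change a' * -((constMultiplier G x).fst a) ∈ J.1
      rw [mul_neg]; exact J.1.neg_mem (hx a a'))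
    (fun {x y} hy a a' => by
      rw [map_mul]
      change a' * (constMultiplier G x).fst ((constMultiplier G y).fst a) ∈ J.1
      rw [← (constMultiplier G x).central]
      exact hy _ _)
    (fun {x y} hx a a' => by
      rw [map_mul]
      exact hx ((constMultiplier G y).fst a) a')
  have hI : ∀ b, b ∈ I.1 ↔ ∀ a a' : C₀(G, B), a' * (constMultiplier G b).fst a ∈ J.1 :=
    fun b => ClosedIdeal.mem_ofSet
  refine ⟨I, ClosedIdeal.ext fun f => ⟨fun hf => mem_tensorIdeal.2 fun t => (hI _).2
    fun a a' => J.1.mul_mem_left _ _ (hJ f hf t a), fun hf => mem_of_forall_approx J fun t ε hε => ?_⟩⟩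
  have hft := (hI _).1 (mem_tensorIdeal.1 hf t)
  obtain ⟨l, hne, hn, hl, hr⟩ := exists_approximateUnit B
  -- Functions a' and a with values w and w' at t give an element of J whose value there is w f(t)
  -- w', close to f(t).
  obtain ⟨w, hw, hw1⟩ := ((Metric.tendsto_nhds.1 (hl (f t)) (ε / 2) (by positivity)).and hn).exists
  obtain ⟨w', hw'⟩ := (Metric.tendsto_nhds.1 (hr (f t)) (ε / 2) (by positivity)).exists
  obtain ⟨a', ha'⟩ := exists_zeroAtInfty_apply_eq (B := B) t w
  obtain ⟨a, ha⟩ := exists_zeroAtInfty_apply_eq (B := B) t w'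
  refine ⟨_, hft a a', ?_⟩
  rw [ZeroAtInftyContinuousMap.mul_apply, constMultiplier_fst_apply, ha, ha']
  rw [dist_eq_norm, norm_sub_rev] at hw hw'
  have e : f t - w * (f t * w') = (f t - w * f t) + w * (f t - f t * w') := by
    rw [mul_sub]; abel
  rw [e]
  calc _ ≤ ‖f t - w * f t‖ + ‖w‖ * ‖f t - f t * w'‖ :=
        (norm_add_le _ _).trans (by gcongr; exact norm_mul_le _ _)
    _ ≤ ‖f t - w * f t‖ + ‖f t - f t * w'‖ := by
        gcongr; exact mul_le_of_le_one_left (norm_nonneg _) hw1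
    _ < ε := by linarith

/-- `C₀(G) ⊗ B` has a sequential contractive approximate unit if `B` is separable. -/
theorem exists_seq_approximateUnit_zeroAtInfty [SecondCountableTopology G]
    [TopologicalSpace.SeparableSpace B] :
    ∃ w : ℕ → C₀(G, B), (∀ n, ‖w n‖ ≤ 1) ∧ ∀ f, Tendsto (fun n => w n * f) atTop (𝓝 f) := by
  obtain ⟨b, hb1, hb⟩ := exists_seq_approximateUnit B
  let K := CompactExhaustion.choice G
  have hχ : ∀ n, ∃ χ : C(G, ℝ), Set.EqOn χ 1 (K n) ∧ HasCompactSupport χ ∧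
      ∀ x, χ x ∈ Set.Icc (0 : ℝ) 1 := fun n => by
    obtain ⟨χ, h1, -, h2, h3⟩ := exists_continuous_one_zero_of_isCompact (K.isCompact n)
      isClosed_empty (Set.disjoint_empty _)
    exact ⟨χ, h1, h2, h3⟩
  choose χ hχ1 hχc hχI using hχ
  have hχn : ∀ n h, ‖χ n h‖ ≤ 1 := fun n h => by
    rw [Real.norm_of_nonneg (hχI n h).1]; exact (hχI n h).2
  refine ⟨fun n => elemTensor (χ n) (hχc n) (b n), fun n =>
    ZeroAtInftyContinuousMap.norm_le_of_forall zero_le_one fun h => ?_, fun f => ?_⟩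
  · rw [elemTensor_apply, norm_smul]
    exact mul_le_one₀ (hχn n h) (norm_nonneg _) (hb1 n)
  refine Metric.tendsto_atTop.2 fun ε hε => ?_
  have h0 := (tendsto_zero_iff_norm_tendsto_zero.1 f.zero_at_infty').eventually
    (gt_mem_nhds (show 0 < ε / 4 by positivity))
  obtain ⟨L, hL, hLf⟩ := mem_cocompact.1 h0
  obtain ⟨n₀, hn₀⟩ := K.exists_superset_of_isCompact hL
  obtain ⟨s, hs, hsf, hsc⟩ := (hL.image (map_continuous f)).finite_cover_balls
    (show 0 < ε / 8 by positivity)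
  have hev : ∀ᶠ n in atTop, ∀ c ∈ s, ‖b n * c - c‖ < ε / 8 := by
    rw [Set.Finite.eventually_all hsf]
    intro c _
    have := Metric.tendsto_nhds.1 (hb c) (ε / 8) (by positivity)
    simpa [dist_eq_norm] using this
  obtain ⟨n₁, hn₁⟩ := eventually_atTop.1 hev
  refine ⟨max n₀ n₁, fun n hn => ?_⟩
  rw [dist_eq_norm]
  refine lt_of_le_of_lt (b := ε / 2)
    (ZeroAtInftyContinuousMap.norm_le_of_forall (by positivity) fun h => ?_) (by linarith)
  rw [ZeroAtInftyContinuousMap.sub_apply, ZeroAtInftyContinuousMap.mul_apply, elemTensor_apply]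
  by_cases hh : h ∈ L
  · have hK : χ n h = 1 := hχ1 n (K.subset ((le_max_left _ _).trans hn) (hn₀ hh))
    rw [hK, one_smul]
    obtain ⟨c, hc, hfc⟩ := Set.mem_iUnion₂.1 (hsc ⟨h, hh, rfl⟩)
    rw [Metric.mem_ball, dist_eq_norm] at hfc
    have h1 := hn₁ n ((le_max_right _ _).trans hn) c hc
    have e : b n * f h - f h = b n * (f h - c) + (b n * c - c) - (f h - c) := by rw [mul_sub]; abel
    have h2 : ‖b n * (f h - c)‖ ≤ ‖f h - c‖ :=
      (norm_mul_le _ _).trans (mul_le_of_le_one_left (norm_nonneg _) (hb1 n))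
    rw [e]
    calc _ ≤ ‖b n * (f h - c)‖ + ‖b n * c - c‖ + ‖f h - c‖ :=
          (norm_sub_le _ _).trans (by gcongr; exact norm_add_le _ _)
      _ ≤ ε / 2 := by linarith
  · have h1 : ‖f h‖ < ε / 4 := hLf hh
    have h2 : ‖(χ n h • b n) * f h‖ ≤ ‖f h‖ := by
      refine (norm_mul_le _ _).trans (mul_le_of_le_one_left (norm_nonneg _) ?_)
      rw [norm_smul]
      exact mul_le_one₀ (hχn n h) (norm_nonneg _) (hb1 n)
    exact (norm_sub_le _ _).trans (by linarith)

omit [T2Space G] [LocallyCompactSpace G] in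
/-- If `α♯` is a product action, then the preimage of `C₀(G) ⊗ I` under `α_g` is invariant under
moving values. -/
theorem CStarAction.SharpEqProd.constMultiplier_mem [Group G] {α : CStarAction G C₀(G, B)}
    {τ : ContinuousAction G G} {γ : ContinuousAction G (PrimitiveIdeals B)}
    (hprod : α.SharpEqProd τ γ) (I : ClosedIdeal B) (g : G) {f : C₀(G, B)}
    (hf : α.aut g f ∈ (tensorIdeal G I).1) (t : G) (a : C₀(G, B)) :
    α.aut g ((constMultiplier G (f t)).fst a) ∈ (tensorIdeal G I).1 := by
  refine mem_tensorIdeal.2 fun h => ?_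
  by_contra hc
  obtain ⟨P, hIP, hP⟩ := I.exists_primitive_of_notMem hc
  -- The product form of α♯, read pointwise: testing α_g(c) at τ_g(t) against γ_g(Q) is the same as
  -- testing c at t against Q.
  have hmem : ∀ (t : G) (Q : PrimitiveIdeals B) (c : C₀(G, B)),
      α.aut g c ∈ (pointIdeal (τ.act g t) (γ.act g Q).1).1 ↔ c t ∈ Q.1.1 := by
    intro t Q c
    rw [← hprod g t Q]
    refine (ClosedIdeal.mem_image (e := α.aut g) (I := pointIdeal t Q.1)).trans
      ⟨?_, fun hc => ⟨c, mem_pointIdeal.2 hc, rfl⟩⟩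
    rintro ⟨y, hy, hyc⟩
    rw [← (α.aut g).injective hyc]
    exact mem_pointIdeal.1 hy
  have hτ : τ.act g (τ.act g⁻¹ h) = h := by rw [← τ.mul_act, mul_inv_cancel, τ.one_act]
  have hγ : γ.act g (γ.act g⁻¹ P) = P := by rw [← γ.mul_act, mul_inv_cancel, γ.one_act]
  refine hP ?_
  have h2 := hmem t (γ.act g⁻¹ P) f
  rw [hγ] at h2
  -- The ideal γ_{g⁻¹}(P) does not involve t, so this membership may be used at the other point
  -- τ_{g⁻¹}(h).
  have hft : f t ∈ (γ.act g⁻¹ P).1.1 :=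
    h2.1 (mem_pointIdeal.2 (hIP _ (mem_tensorIdeal.1 hf _)))
  have h3 := hmem (τ.act g⁻¹ h) (γ.act g⁻¹ P) ((constMultiplier G (f t)).fst a)
  rw [hγ, hτ] at h3
  exact mem_pointIdeal.1 (h3.2 (by
    rw [constMultiplier_fst_apply]
    exact (γ.act g⁻¹ P).1.1.mul_mem_right _ _ hft))

end ZeroAtInfty

/-! ### Closed linear spans -/

section ClosedSpan

/-- The closed linear span of a set. -/
abbrev closedSpan {X : Type*} [NormedAddCommGroup X] [NormedSpace ℂ X] (R : Set X) :
    Submodule ℂ X :=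
  (Submodule.span ℂ R).topologicalClosure

variable {X Y : Type*} [NormedAddCommGroup X] [NormedSpace ℂ X]
  [NormedAddCommGroup Y] [NormedSpace ℂ Y]

theorem subset_closedSpan {R : Set X} : R ⊆ closedSpan R := fun _ hx =>
  Submodule.le_topologicalClosure _ (Submodule.subset_span hx)

theorem isClosed_closedSpan (R : Set X) : IsClosed (closedSpan R : Set X) :=
  Submodule.isClosed_topologicalClosure _

theorem closedSpan_induction {R : Set X} {p : X → Prop} (closed : IsClosed {x | p x})
    (mem : ∀ x ∈ R, p x) (zero : p 0) (add : ∀ x y, p x → p y → p (x + y))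
    (smul : ∀ (r : ℂ) x, p x → p (r • x)) {x : X} (hx : x ∈ closedSpan R) : p x := by
  refine closure_minimal (s := (Submodule.span ℂ R : Set X)) ?_ closed hx
  intro y hy
  exact Submodule.span_induction mem zero (fun x y _ _ => add x y) (fun r x _ => smul r x) hy

theorem map_mem_of_mem_closedSpan {R : Set X} {W : Submodule ℂ Y} (hW : IsClosed (W : Set Y))
    (T : X →L[ℂ] Y) (h : ∀ x ∈ R, T x ∈ W) {x : X} (hx : x ∈ closedSpan R) : T x ∈ W :=
  closedSpan_induction (p := fun x => T x ∈ W) (hW.preimage T.continuous) h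
    (by simp) (fun x y h1 h2 => by rw [map_add]; exact W.add_mem h1 h2)
    (fun r x h1 => by rw [map_smul]; exact W.smul_mem r h1) hx

theorem map_mem_closedSpan {R : Set X} {R' : Set Y} (T : X →L[ℂ] Y)
    (h : ∀ x ∈ R, T x ∈ closedSpan R') {x : X} (hx : x ∈ closedSpan R) : T x ∈ closedSpan R' :=
  map_mem_of_mem_closedSpan (isClosed_closedSpan R') T h hx

theorem closedSpan_le {R : Set X} {W : Submodule ℂ X} (hW : IsClosed (W : Set X))
    (h : R ⊆ W) : closedSpan R ≤ W :=
  Submodule.topologicalClosure_minimal _ (Submodule.span_le.2 h) hW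

theorem ContinuousLinearMap.eq_on_closedSpan {R : Set X} {S T : X →L[ℂ] Y}
    (h : ∀ x ∈ R, S x = T x) {x : X} (hx : x ∈ closedSpan R) : S x = T x :=
  closedSpan_induction (p := fun x => S x = T x) (isClosed_eq S.continuous T.continuous) h
    (by simp) (fun x y h1 h2 => by simp [h1, h2]) (fun r x h1 => by simp [h1]) hx

end ClosedSpan

/-! ### Creation operators and Hilbert space tensor products -/

section HilbertTensor

open scoped InnerProductSpace
open ContinuousLinearMap (adjoint)
open InnerProductSpace (rankOne)

variable {H E : Type*} [NormedAddCommGroup H] [InnerProductSpace ℂ H]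
  [NormedAddCommGroup E] [InnerProductSpace ℂ E]

/-- The inclusion of the algebraic tensor product. -/
def HilbertTensor.incl (H E : Type*) [NormedAddCommGroup H] [InnerProductSpace ℂ H]
    [NormedAddCommGroup E] [InnerProductSpace ℂ E] : H ⊗[ℂ] E →ₗᵢ[ℂ] HilbertTensor H E :=
  UniformSpace.Completion.toComplₗᵢ

/-- The operators `v ↦ h ⊗ v`. -/
def create : H →L[ℂ] E →L[ℂ] HilbertTensor H E :=
  (ContinuousLinearMap.compL ℂ E (H ⊗[ℂ] E) (HilbertTensor H E)
    (HilbertTensor.incl H E).toContinuousLinearMap) ∘L TensorProduct.mkL ℂ H E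

theorem create_apply (h : H) (v : E) : create h v = HilbertTensor.incl H E (h ⊗ₜ v) := rfl

theorem inner_create (h h' : H) (v v' : E) :
    ⟪create h v, create h' v'⟫_ℂ = ⟪h, h'⟫_ℂ * ⟪v, v'⟫_ℂ := by
  rw [create_apply, create_apply, LinearIsometry.inner_map_map, TensorProduct.inner_tmul]

theorem HilbertTensor.denseRange_incl : DenseRange (HilbertTensor.incl H E) :=
  UniformSpace.Completion.denseRange_coe

theorem HilbertTensor.mem_closedSpan (x : HilbertTensor H E) :
    x ∈ closedSpan {y | ∃ (h : H) (v : E), y = create h v} := by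
  refine HilbertTensor.denseRange_incl.induction_on x (isClosed_closedSpan _) fun t => ?_
  refine Submodule.le_topologicalClosure _ ?_
  induction t using TensorProduct.induction_on with
  | zero => rw [map_zero]; exact Submodule.zero_mem _
  | tmul h v => exact Submodule.subset_span ⟨h, v, rfl⟩
  | add x y hx hy => rw [map_add]; exact Submodule.add_mem _ hx hy

theorem HilbertTensor.hom_ext {X : Type*} [NormedAddCommGroup X] [NormedSpace ℂ X]
    {S T : HilbertTensor H E →L[ℂ] X} (h : ∀ x v, S (create x v) = T (create x v)) : S = T := by
  refine ContinuousLinearMap.ext fun x =>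
    ContinuousLinearMap.eq_on_closedSpan ?_ (HilbertTensor.mem_closedSpan x)
  rintro _ ⟨x, v, rfl⟩
  exact h x v

theorem LinearIsometry.exists_extend_of_denseRange {W Z X : Type*} [NormedAddCommGroup W]
    [NormedSpace ℂ W] [NormedAddCommGroup Z] [NormedSpace ℂ Z] [NormedAddCommGroup X]
    [NormedSpace ℂ X] [CompleteSpace X] (i : W →ₗᵢ[ℂ] Z) (hi : DenseRange i) (f : W →ₗᵢ[ℂ] X) :
    ∃ g : Z →ₗᵢ[ℂ] X, ∀ t, g (i t) = f t := by
  have hext : ∀ t, f.toContinuousLinearMap.extend i.toContinuousLinearMap (i t) = f t := fun t =>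
    ContinuousLinearMap.extend_eq _ hi i.isometry.isUniformInducing t
  refine ⟨⟨(f.toContinuousLinearMap.extend i.toContinuousLinearMap).toLinearMap, fun x => ?_⟩, hext⟩
  refine hi.induction_on (p := fun x => ‖f.toContinuousLinearMap.extend
    i.toContinuousLinearMap x‖ = ‖x‖) x
    (isClosed_eq (ContinuousLinearMap.continuous _).norm continuous_norm) fun t => ?_
  rw [hext, f.norm_map, LinearIsometry.norm_map]

/-- The universal property of the Hilbert space tensor product. -/
theorem HilbertTensor.exists_lift {X : Type*} [NormedAddCommGroup X] [InnerProductSpace ℂ X]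
    [CompleteSpace X] (b : H →ₗ[ℂ] E →ₗ[ℂ] X)
    (hb : ∀ h v h' v', ⟪b h v, b h' v'⟫_ℂ = ⟪h, h'⟫_ℂ * ⟪v, v'⟫_ℂ) :
    ∃ f : HilbertTensor H E →ₗᵢ[ℂ] X, ∀ h v, f (create h v) = b h v := by
  have hin : ∀ x y : H ⊗[ℂ] E,
      ⟪TensorProduct.lift b x, TensorProduct.lift b y⟫_ℂ = ⟪x, y⟫_ℂ := by
    intro x y
    induction x using TensorProduct.induction_on with
    | zero => simp
    | add x x' hx hx' => rw [map_add, inner_add_left, inner_add_left, hx, hx']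
    | tmul h v =>
      induction y using TensorProduct.induction_on with
      | zero => simp
      | add y y' hy hy' => rw [map_add, inner_add_right, inner_add_right, hy, hy']
      | tmul h' v' => rw [TensorProduct.lift.tmul, TensorProduct.lift.tmul, hb,
          TensorProduct.inner_tmul]
  obtain ⟨g, hg⟩ := LinearIsometry.exists_extend_of_denseRange (HilbertTensor.incl H E)
    HilbertTensor.denseRange_incl ((TensorProduct.lift b).isometryOfInner hin)
  exact ⟨g, fun h v => (hg (h ⊗ₜ v)).trans (TensorProduct.lift.tmul _ _)⟩

theorem opTensor_incl (S : H →L[ℂ] H) (T : E →L[ℂ] E) (t : H ⊗[ℂ] E) :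
    opTensor S T (HilbertTensor.incl H E t) =
      HilbertTensor.incl H E (TensorProduct.mapL S T t) :=
  ContinuousLinearMap.completion_apply_coe _ _

@[simp]
theorem opTensor_create (S : H →L[ℂ] H) (T : E →L[ℂ] E) (h : H) (v : E) :
    opTensor S T (create h v) = create (S h) (T v) :=
  opTensor_incl S T (h ⊗ₜ v)

theorem norm_opTensor_le (S : H →L[ℂ] H) (T : E →L[ℂ] E) : ‖opTensor S T‖ ≤ ‖S‖ * ‖T‖ := by
  refine ContinuousLinearMap.opNorm_le_bound _ (by positivity) fun x => ?_
  refine HilbertTensor.denseRange_incl.induction_on x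
    (isClosed_le (ContinuousLinearMap.continuous _).norm (by fun_prop)) fun t => ?_
  rw [opTensor_incl, LinearIsometry.norm_map, LinearIsometry.norm_map]
  exact ((TensorProduct.mapL S T).le_opNorm t).trans
    (mul_le_mul_of_nonneg_right (TensorProduct.norm_mapL_le S T) (norm_nonneg _))

theorem opTensor_comp (S S' : H →L[ℂ] H) (T T' : E →L[ℂ] E) :
    opTensor S T ∘L opTensor S' T' = opTensor (S ∘L S') (T ∘L T') :=
  HilbertTensor.hom_ext fun x v => by simp

theorem opTensor_one : opTensor (1 : H →L[ℂ] H) (1 : E →L[ℂ] E) = 1 :=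
  HilbertTensor.hom_ext fun x v => by simp

/-- `S ↦ S ⊗ T` as a continuous linear map. -/
def opTensorLeft (T : E →L[ℂ] E) :
    (H →L[ℂ] H) →L[ℂ] (HilbertTensor H E →L[ℂ] HilbertTensor H E) :=
  LinearMap.mkContinuous
    { toFun := fun S => opTensor S T
      map_add' := fun S S' => HilbertTensor.hom_ext fun x v => by simp
      map_smul' := fun r S => HilbertTensor.hom_ext fun x v => by simp }
    ‖T‖ fun S => (norm_opTensor_le S T).trans_eq (mul_comm _ _)

theorem isCompactOperator_rankOne (x y : H) : IsCompactOperator (rankOne ℂ x y) := by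
  have h : IsCompactOperator (ContinuousLinearMap.toSpanSingleton ℂ x) :=
    ⟨ContinuousLinearMap.toSpanSingleton ℂ x '' Metric.closedBall 0 1,
      (isCompact_closedBall _ _).image (ContinuousLinearMap.continuous _),
      Filter.mem_of_superset (Metric.closedBall_mem_nhds 0 one_pos) (Set.subset_preimage_image _ _)⟩
  exact h.comp_clm (innerSL ℂ y)

variable [CompleteSpace E]

theorem adjoint_create_create (h h' : H) (v : E) :
    adjoint (create h) (create h' v) = ⟪h, h'⟫_ℂ • v := by
  refine ext_inner_left ℂ fun w => ?_
  rw [ContinuousLinearMap.adjoint_inner_right, inner_create, inner_smul_right]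

theorem opTensor_rankOne (h h' : H) (T : E →L[ℂ] E) :
    opTensor (rankOne ℂ h h') T = create h ∘L T ∘L adjoint (create h') :=
  HilbertTensor.hom_ext fun x v => by
    simp [adjoint_create_create]

variable [CompleteSpace H]

theorem adjoint_opTensor (S : H →L[ℂ] H) (T : E →L[ℂ] E) :
    adjoint (opTensor S T) = opTensor (adjoint S) (adjoint T) := by
  refine HilbertTensor.hom_ext fun x v => ext_inner_left ℂ fun w => ?_
  rw [ContinuousLinearMap.adjoint_inner_right, opTensor_create]
  refine closedSpan_induction (p := fun w => ⟪opTensor S T w, create x v⟫_ℂ =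
    ⟪w, create (adjoint S x) (adjoint T v)⟫_ℂ) (isClosed_eq (by fun_prop) (by fun_prop)) ?_
    (by simp) (fun a b ha hb => ?_) (fun r a ha => ?_) (HilbertTensor.mem_closedSpan w)
  · rintro _ ⟨x', v', rfl⟩
    rw [opTensor_create, inner_create, inner_create, ContinuousLinearMap.adjoint_inner_right,
      ContinuousLinearMap.adjoint_inner_right]
  · rw [map_add, inner_add_left, inner_add_left, ha, hb]
  · rw [map_smul, inner_smul_left, inner_smul_left, ha]

/-- Projecting onto the span of a finite net of the image of the unit ball changes k by little, and
the projected operator is a finite sum of rank-one operators. -/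
theorem IsCompactOperator.mem_closedSpan_rankOne {k : H →L[ℂ] H} (hk : IsCompactOperator k) :
    k ∈ closedSpan {T | ∃ x y : H, T = rankOne ℂ x y} := by
  refine Metric.mem_closure_iff.2 fun ε hε => ?_
  obtain ⟨K, hK, hsub⟩ := hk.image_closedBall_subset_compact (1 : ℝ)
  obtain ⟨t, -, ht, hcov⟩ := hK.totallyBounded.exists_subset (Metric.dist_mem_uniformity
    (half_pos hε))
  set V := Submodule.span ℂ t
  have : FiniteDimensional ℂ V := FiniteDimensional.span_of_finite ℂ ht
  refine ⟨V.starProjection ∘L k, ?_, ?_⟩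
  · rw [OrthonormalBasis.starProjection_eq_sum_rankOne (stdOrthonormalBasis ℂ V),
      ContinuousLinearMap.finsetSum_comp]
    refine Submodule.sum_mem _ fun i _ => Submodule.subset_span
      ⟨(stdOrthonormalBasis ℂ V i : H), adjoint k (stdOrthonormalBasis ℂ V i : H), ?_⟩
    ext z
    simp [ContinuousLinearMap.adjoint_inner_left]
  · rw [dist_eq_norm]
    refine lt_of_le_of_lt (ContinuousLinearMap.opNorm_le_of_unit_norm (C := ε / 2) (by positivity)
      fun x hx => ?_) (half_lt_self hε)
    have hx' : k x ∈ K := hsub ⟨x, by simp [hx], rfl⟩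
    obtain ⟨z, hz, hd⟩ := Set.mem_iUnion₂.1 (hcov hx')
    change ‖k x - V.starProjection (k x)‖ ≤ ε / 2
    rw [Submodule.starProjection_minimal]
    refine (ciInf_le ⟨0, ?_⟩ (⟨z, Submodule.subset_span hz⟩ : V)).trans ?_
    · rintro _ ⟨w, rfl⟩
      exact norm_nonneg _
    · rw [← dist_eq_norm]
      exact le_of_lt hd

end HilbertTensor

/-! ### Elementary operators in 𝓚(H) ⊗ π(A) -/

section CompactTensor

open scoped InnerProductSpace
open ContinuousLinearMap (adjoint)
open InnerProductSpace (rankOne)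

variable {H E A : Type*} [NormedAddCommGroup H] [InnerProductSpace ℂ H]
  [NormedAddCommGroup E] [InnerProductSpace ℂ E] [CompleteSpace E] [NonUnitalCStarAlgebra A]

/-- A ⋆-homomorphism of C⋆-algebras as a continuous linear map. -/
def NonUnitalStarAlgHom.toCLM {C : Type*} [NonUnitalCStarAlgebra C] (ρ : A →⋆ₙₐ[ℂ] C) :
    A →L[ℂ] C :=
  LinearMap.mkContinuous
    { toFun := ρ
      map_add' := map_add ρ
      map_smul' := map_smul ρ } 1 fun a => by
        rw [one_mul]
        exact NonUnitalStarAlgHom.norm_apply_le ρ a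

@[simp]
theorem NonUnitalStarAlgHom.toCLM_apply {C : Type*} [NonUnitalCStarAlgebra C] (ρ : A →⋆ₙₐ[ℂ] C)
    (a : A) : ρ.toCLM a = ρ a := rfl

theorem NonUnitalStarAlgHom.isClosed_map {C : Type*} [NonUnitalCStarAlgebra C] (ρ : A →⋆ₙₐ[ℂ] C)
    (hρ : Function.Injective ρ) {W : Submodule ℂ A} (hW : IsClosed (W : Set A)) :
    IsClosed (W.map ρ.toCLM.toLinearMap : Set C) := by
  rw [Submodule.map_coe]
  exact (NonUnitalStarAlgHom.isometry ρ hρ).isClosedEmbedding.isClosedMap _ hW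

/-- The underlying subspace of a closed ideal. -/
def ClosedIdeal.toSubmodule (J : ClosedIdeal A) : Submodule ℂ A where
  carrier := J.1
  add_mem' := J.1.add_mem
  zero_mem' := J.1.zero_mem
  smul_mem' r _ hx := J.smul_mem r hx

theorem ClosedIdeal.isClosed_toSubmodule (J : ClosedIdeal A) :
    IsClosed (J.toSubmodule : Set A) := J.2

/-- The operator `|h⟩⟨h'| ⊗ π(b)`. -/
def elemOp (π : A →⋆ₙₐ[ℂ] (E →L[ℂ] E)) (h : H) (b : A) (h' : H) :
    HilbertTensor H E →L[ℂ] HilbertTensor H E :=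
  create h ∘L π b ∘L adjoint (create h')

/-- The set of operators `|h⟩⟨h'| ⊗ π(b)`. -/
def elemOps (H : Type*) [NormedAddCommGroup H] [InnerProductSpace ℂ H]
    (π : A →⋆ₙₐ[ℂ] (E →L[ℂ] E)) : Set (HilbertTensor H E →L[ℂ] HilbertTensor H E) :=
  {T | ∃ h b h', T = elemOp π h b h'}

variable (π : A →⋆ₙₐ[ℂ] (E →L[ℂ] E))

theorem opTensor_rankOne_eq_elemOp (h h' : H) (b : A) :
    opTensor (rankOne ℂ h h') (π b) = elemOp π h b h' := opTensor_rankOne h h' (π b)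

theorem elemOp_comp_elemOp (h h' k k' : H) (b b' : A) :
    elemOp π h b h' ∘L elemOp π k b' k' = ⟪h', k⟫_ℂ • elemOp π h (b * b') k' := by
  ext v
  simp [elemOp, adjoint_create_create]

theorem adjoint_elemOp (h h' : H) (b : A) :
    adjoint (elemOp π h b h') = elemOp π h' (star b) h := by
  simp only [elemOp, ContinuousLinearMap.adjoint_comp, ContinuousLinearMap.adjoint_adjoint,
    map_star, ContinuousLinearMap.star_eq_adjoint]
  rfl

theorem opTensor_comp_elemOp (T : H →L[ℂ] H) (h h' : H) (b : A) :
    opTensor T 1 ∘L elemOp π h b h' = elemOp π (T h) b h' := by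
  ext v
  simp [elemOp]

variable [CompleteSpace H]

theorem elemOp_comp_opTensor (T : H →L[ℂ] H) (h h' : H) (b : A) :
    elemOp π h b h' ∘L opTensor T 1 = elemOp π h b (adjoint T h') := by
  have := congrArg adjoint (opTensor_comp_elemOp π (adjoint T) h' h (star b))
  rwa [ContinuousLinearMap.adjoint_comp, adjoint_elemOp, star_star, adjoint_opTensor,
    ContinuousLinearMap.adjoint_adjoint, adjoint_elemOp, star_star,
    ← ContinuousLinearMap.star_eq_adjoint (1 : E →L[ℂ] E), star_one] at this

/-- Right composition as a continuous linear map. -/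
abbrev compRight {X Y Z : Type*} [NormedAddCommGroup X] [NormedSpace ℂ X] [NormedAddCommGroup Y]
    [NormedSpace ℂ Y] [NormedAddCommGroup Z] [NormedSpace ℂ Z] (S : X →L[ℂ] Y) :
    (Y →L[ℂ] Z) →L[ℂ] (X →L[ℂ] Z) :=
  (ContinuousLinearMap.compL ℂ X Y Z).flip S

/-- Left composition as a continuous linear map. -/
abbrev compLeft {X Y Z : Type*} [NormedAddCommGroup X] [NormedSpace ℂ X] [NormedAddCommGroup Y]
    [NormedSpace ℂ Y] [NormedAddCommGroup Z] [NormedSpace ℂ Z] (T : Y →L[ℂ] Z) :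
    (X →L[ℂ] Y) →L[ℂ] (X →L[ℂ] Z) :=
  ContinuousLinearMap.compL ℂ X Y Z T

theorem comp_mem_closedSpan_elemOps {x y : HilbertTensor H E →L[ℂ] HilbertTensor H E}
    (hx : x ∈ closedSpan (elemOps H π)) (hy : y ∈ closedSpan (elemOps H π)) :
    x ∘L y ∈ closedSpan (elemOps H π) := by
  refine map_mem_closedSpan (compRight y) ?_ hx
  rintro _ ⟨h, b, h', rfl⟩
  refine map_mem_closedSpan (compLeft (elemOp π h b h')) ?_ hy
  rintro _ ⟨k, b', k', rfl⟩
  change elemOp π h b h' ∘L elemOp π k b' k' ∈ _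
  rw [elemOp_comp_elemOp]
  exact Submodule.smul_mem _ _ (subset_closedSpan ⟨_, _, _, rfl⟩)

theorem adjoint_mem_closedSpan_elemOps {x : HilbertTensor H E →L[ℂ] HilbertTensor H E}
    (hx : x ∈ closedSpan (elemOps H π)) : adjoint x ∈ closedSpan (elemOps H π) := by
  refine closedSpan_induction (p := fun x => adjoint x ∈ closedSpan (elemOps H π))
    ((isClosed_closedSpan _).preimage (LinearIsometryEquiv.continuous _)) ?_ ?_ ?_ ?_ hx
  · rintro _ ⟨h, b, h', rfl⟩
    rw [adjoint_elemOp]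
    exact subset_closedSpan ⟨_, _, _, rfl⟩
  · rw [map_zero]
    exact Submodule.zero_mem _
  · intro x y hx hy
    rw [map_add]
    exact Submodule.add_mem _ hx hy
  · intro r x hx
    rw [map_smulₛₗ]
    exact Submodule.smul_mem _ _ hx

/-- Products of the operators |h⟩⟨h'| ⊗ π(b) are scalar multiples of such operators and adjoints are
again such, so their closed span is already the generated C⋆-algebra. This linear description is
what allows later identities to be checked on elementary operators alone. -/
theorem mem_compactTensor_iff {x : HilbertTensor H E →L[ℂ] HilbertTensor H E} :
    x ∈ CompactTensor H π ↔ x ∈ closedSpan (elemOps H π) := by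
  constructor
  · intro hx
    refine closure_minimal ?_ (isClosed_closedSpan _) hx
    intro y hy
    induction hy using NonUnitalStarAlgebra.adjoin_induction with
    | mem y hy =>
      obtain ⟨k, hk, a, rfl⟩ := hy
      refine map_mem_closedSpan (opTensorLeft (π a)) ?_ hk.mem_closedSpan_rankOne
      rintro _ ⟨h, h', rfl⟩
      exact subset_closedSpan ⟨h, a, h', opTensor_rankOne_eq_elemOp π h h' a⟩
    | add x y _ _ hx hy => exact Submodule.add_mem _ hx hy
    | zero => exact Submodule.zero_mem _
    | mul x y _ _ hx hy => exact comp_mem_closedSpan_elemOps π hx hy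
    | smul r x _ hx => exact Submodule.smul_mem _ r hx
    | star x _ hx => exact adjoint_mem_closedSpan_elemOps π hx
  · intro hx
    have hcl : IsClosed (CompactTensor H π : Set (HilbertTensor H E →L[ℂ] HilbertTensor H E)) :=
      inferInstance
    refine closedSpan_induction (p := fun x => x ∈ CompactTensor H π) hcl ?_ (zero_mem _)
      (fun _ _ => add_mem) (fun r _ hx => SMulMemClass.smul_mem r hx) hx
    rintro _ ⟨h, b, h', rfl⟩
    rw [← opTensor_rankOne_eq_elemOp]
    exact (CompactTensor.elem π _ (isCompactOperator_rankOne h h') b).2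

end CompactTensor

/-! ### Slices and ideals of 𝓚(H) ⊗ π(A) -/

section Slices

open scoped InnerProductSpace
open ContinuousLinearMap (adjoint)

variable {H E A : Type*} [NormedAddCommGroup H] [InnerProductSpace ℂ H] [CompleteSpace H]
  [NormedAddCommGroup E] [InnerProductSpace ℂ E] [CompleteSpace E] [NonUnitalCStarAlgebra A]
  (π : A →⋆ₙₐ[ℂ] (E →L[ℂ] E))
  (ρ : A →⋆ₙₐ[ℂ] (HilbertTensor H E →L[ℂ] HilbertTensor H E))

/-- `ρ` is an isomorphism of `A` onto `𝓚(H) ⊗ π(A)`. -/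
structure IsCompactRep : Prop where
  injective_coeff : Function.Injective π
  injective : Function.Injective ρ
  mem_iff : ∀ x, x ∈ closedSpan (elemOps H π) ↔ ∃ a, ρ a = x

/-- The elementary operators `|h⟩⟨h'| ⊗ π(b)` with `b` in a slice of `J`. -/
def sliceOps (J : ClosedIdeal A) : Set (HilbertTensor H E →L[ℂ] HilbertTensor H E) :=
  {T | ∃ (h : H) (b : A) (h' : H), T = elemOp π h b h' ∧
    ∀ k k' : H, ∃ x ∈ J.1, ρ x = elemOp π k b k'}

namespace IsCompactRep

variable {π ρ} (hρ : IsCompactRep π ρ)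
include hρ

theorem exists_elemOp (h : H) (b : A) (h' : H) : ∃ a, ρ a = elemOp π h b h' :=
  (hρ.mem_iff _).1 (subset_closedSpan ⟨h, b, h', rfl⟩)

theorem apply_mem (a : A) : ρ a ∈ closedSpan (elemOps H π) := (hρ.mem_iff _).2 ⟨a, rfl⟩

/-- On elementary operators the slice is a scalar multiple of π(b); closedness of π(A) carries this
to limits. -/
theorem exists_slice (a : A) (h h' : H) :
    ∃ b, π b = adjoint (create h) ∘L ρ a ∘L create h' := by
  have hcl := NonUnitalStarAlgHom.isClosed_map π hρ.injective_coeff (W := ⊤) isClosed_univ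
  have := map_mem_of_mem_closedSpan hcl
    (compLeft (adjoint (create (E := E) h)) ∘L compRight (create (E := E) h')) ?_ (hρ.apply_mem a)
  · obtain ⟨b, -, hb⟩ := this
    exact ⟨b, hb⟩
  · rintro _ ⟨k, b, k', rfl⟩
    refine ⟨(⟪h, k⟫_ℂ * ⟪k', h'⟫_ℂ) • b, trivial, ?_⟩
    ext v
    simp [elemOp, adjoint_create_create, mul_smul]
    rw [smul_comm]

theorem mem_closedSpan (a : A) : a ∈ closedSpan {x | ∃ h b h', ρ x = elemOp π h b h'} := by
  have hcl := NonUnitalStarAlgHom.isClosed_map ρ hρ.injective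
    (isClosed_closedSpan {x | ∃ h b h', ρ x = elemOp π h b h'})
  have := closedSpan_le hcl (R := elemOps H π) ?_ (hρ.apply_mem a)
  · obtain ⟨a', ha', h⟩ := this
    rwa [← hρ.injective h]
  · rintro _ ⟨h, b, h', rfl⟩
    obtain ⟨x, hx⟩ := hρ.exists_elemOp h b h'
    exact ⟨x, subset_closedSpan ⟨h, b, h', hx⟩, hx⟩

theorem isClosed_map_ideal (J : ClosedIdeal A) :
    IsClosed (J.toSubmodule.map ρ.toCLM.toLinearMap :
      Set (HilbertTensor H E →L[ℂ] HilbertTensor H E)) :=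
  NonUnitalStarAlgHom.isClosed_map ρ hρ.injective J.isClosed_toSubmodule

/-- A left multiplier of `𝓚(H) ⊗ π(A)` preserves the image of every closed ideal. -/
theorem comp_left_mem (J : ClosedIdeal A) {T : HilbertTensor H E →L[ℂ] HilbertTensor H E}
    (hT : ∀ a, ∃ a', ρ a' = T ∘L ρ a) {x : A} (hx : x ∈ J.1) :
    ∃ x' ∈ J.1, ρ x' = T ∘L ρ x := by
  obtain ⟨l, hl, -, hl', -⟩ := exists_approximateUnit A
  have hcl := hρ.isClosed_map_ideal J
  have hlim : Filter.Tendsto (fun w => T ∘L ρ (w * x)) l (nhds (T ∘L ρ x)) :=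
    (((compLeft T) ∘L ρ.toCLM).continuous.tendsto x).comp (hl' x)
  obtain ⟨x', hx', h⟩ := hcl.mem_of_tendsto hlim (Filter.Eventually.of_forall fun w => by
    obtain ⟨a', ha'⟩ := hT w
    refine ⟨a' * x, J.1.mul_mem_left _ _ hx, ?_⟩
    change ρ (a' * x) = _
    rw [map_mul, map_mul, ha']
    rfl)
  exact ⟨x', hx', h⟩

theorem comp_right_mem (J : ClosedIdeal A) {T : HilbertTensor H E →L[ℂ] HilbertTensor H E}
    (hT : ∀ a, ∃ a', ρ a' = ρ a ∘L T) {x : A} (hx : x ∈ J.1) :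
    ∃ x' ∈ J.1, ρ x' = ρ x ∘L T := by
  obtain ⟨l, hl, -, -, hl'⟩ := exists_approximateUnit A
  have hcl := hρ.isClosed_map_ideal J
  have hlim : Filter.Tendsto (fun w => ρ (x * w) ∘L T) l (nhds (ρ x ∘L T)) :=
    (((compRight T) ∘L ρ.toCLM).continuous.tendsto x).comp (hl' x)
  obtain ⟨x', hx', h⟩ := hcl.mem_of_tendsto hlim (Filter.Eventually.of_forall fun w => by
    obtain ⟨a', ha'⟩ := hT w
    refine ⟨x * a', J.1.mul_mem_right _ _ hx, ?_⟩
    change ρ (x * a') = _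
    rw [map_mul, map_mul, ha']
    rfl)
  exact ⟨x', hx', h⟩

theorem exists_opTensor_comp (T : H →L[ℂ] H) (a : A) : ∃ a', ρ a' = opTensor T 1 ∘L ρ a := by
  refine (hρ.mem_iff _).1 (map_mem_closedSpan (compLeft (opTensor T 1)) ?_ (hρ.apply_mem a))
  rintro _ ⟨h, b, h', rfl⟩
  exact subset_closedSpan ⟨T h, b, h', opTensor_comp_elemOp π T h h' b⟩

theorem exists_comp_opTensor (T : H →L[ℂ] H) (a : A) : ∃ a', ρ a' = ρ a ∘L opTensor T 1 := by
  refine (hρ.mem_iff _).1 (map_mem_closedSpan (compRight (opTensor T 1)) ?_ (hρ.apply_mem a))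
  rintro _ ⟨h, b, h', rfl⟩
  exact subset_closedSpan ⟨h, b, _, elemOp_comp_opTensor π T h h' b⟩

theorem exists_opTensor_comp_comp (J : ClosedIdeal A) (S T : H →L[ℂ] H) {x : A} (hx : x ∈ J.1) :
    ∃ x' ∈ J.1, ρ x' = opTensor S 1 ∘L ρ x ∘L opTensor T 1 := by
  obtain ⟨y, hy, h⟩ := hρ.comp_right_mem J (hρ.exists_comp_opTensor T) hx
  obtain ⟨z, hz, h'⟩ := hρ.comp_left_mem J (hρ.exists_opTensor_comp S) hy
  exact ⟨z, hz, by rw [h', h]⟩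

/-- The image of a closed ideal `J` is spanned by the elementary operators `|h⟩⟨h'| ⊗ π(b)` with
`b` in a slice of `J`. -/
theorem apply_mem_closedSpan_slices (J : ClosedIdeal A) {a : A} (ha : a ∈ J.1) :
    ρ a ∈ closedSpan (sliceOps π ρ J) := by
  set R := sliceOps π ρ J
  -- Between two elementary operators only a slice c of ρ(a) survives, giving the coefficient b c
  -- b'. Changing the outer vectors amounts to multiplying a by other elements of A, so this
  -- coefficient remains in J for every choice of vectors.
  have key : ∀ x ∈ closedSpan (elemOps H π), ∀ y ∈ closedSpan (elemOps H π),
      x ∘L ρ a ∘L y ∈ closedSpan R := by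
    intro x hx y hy
    refine map_mem_closedSpan (compRight (ρ a ∘L y)) ?_ hx
    rintro _ ⟨h, b, h', rfl⟩
    refine map_mem_closedSpan (compLeft (elemOp π h b h' ∘L ρ a)) ?_ hy
    rintro _ ⟨k, b', k', rfl⟩
    obtain ⟨c, hc⟩ := hρ.exists_slice a h' k
    have hop : ∀ p p', elemOp π p b h' ∘L ρ a ∘L elemOp π k b' p' =
        elemOp π p (b * c * b') p' := fun p p' => by
      ext v
      have := congrArg (fun T : E →L[ℂ] E => T (π b' (adjoint (create p') v))) hc
      simp only [elemOp, map_mul, ContinuousLinearMap.comp_apply, mul_apply_eq_comp] at this ⊢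
      rw [this]
    refine subset_closedSpan ⟨h, b * c * b', k', hop h k', fun p p' => ?_⟩
    obtain ⟨s, hs⟩ := hρ.exists_elemOp p b h'
    obtain ⟨t, ht⟩ := hρ.exists_elemOp k b' p'
    refine ⟨s * (a * t), J.1.mul_mem_left _ _ (J.1.mul_mem_right _ _ ha), ?_⟩
    rw [← hop, map_mul, map_mul, hs, ht]
    rfl
  obtain ⟨l, hl, -, hl₁, hl₂⟩ := exists_approximateUnit A
  have hmem : ∀ b, ρ (a * b) ∈ closedSpan R := fun b => by
    refine (isClosed_closedSpan R).mem_of_tendsto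
      ((ρ.toCLM.continuous.tendsto _).comp (hl₁ (a * b))) (Filter.Eventually.of_forall fun w => ?_)
    change ρ (w * (a * b)) ∈ _
    rw [map_mul, map_mul]
    exact key _ (hρ.apply_mem w) _ (hρ.apply_mem b)
  exact (isClosed_closedSpan R).mem_of_tendsto
    ((ρ.toCLM.continuous.tendsto _).comp (hl₂ a)) (Filter.Eventually.of_forall fun w => hmem w)

end IsCompactRep

end Slices

/-! ### Removing the inner part of the action -/

section Untwist

open scoped InnerProductSpace
open ContinuousLinearMap (adjoint)

variable {G : Type*} [Group G] [TopologicalSpace G]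
  {H E A : Type*} [NormedAddCommGroup H] [InnerProductSpace ℂ H] [CompleteSpace H]
  [NormedAddCommGroup E] [InnerProductSpace ℂ E] [CompleteSpace E] [NonUnitalCStarAlgebra A]
  {π : A →⋆ₙₐ[ℂ] (E →L[ℂ] E)}
  {ρ : A →⋆ₙₐ[ℂ] (HilbertTensor H E →L[ℂ] HilbertTensor H E)}

/-- Under `ρ`, the action `α` becomes `Ad(w) ⊗ α`. -/
def IsAdTwisted (π : A →⋆ₙₐ[ℂ] (E →L[ℂ] E))
    (ρ : A →⋆ₙₐ[ℂ] (HilbertTensor H E →L[ℂ] HilbertTensor H E)) (w : G → (H →L[ℂ] H))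
    (α : CStarAction G A) : Prop :=
  ∀ g x h b h', ρ x = elemOp π h b h' →
    ρ (α.aut g x) = elemOp π (w g h) (α.aut g b) (w g h')

/-- Under `ρ`, the action `β` becomes `1 ⊗ α`. -/
def IsUntwisted (π : A →⋆ₙₐ[ℂ] (E →L[ℂ] E))
    (ρ : A →⋆ₙₐ[ℂ] (HilbertTensor H E →L[ℂ] HilbertTensor H E))
    (α β : CStarAction G A) : Prop :=
  ∀ g x h b h', ρ x = elemOp π h b h' → ρ (β.aut g x) = elemOp π h (α.aut g b) h'

/-- A star automorphism of a C⋆-algebra as a continuous linear map. -/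
abbrev StarAlgEquiv.toCLM {A : Type*} [NonUnitalCStarAlgebra A] (e : A ≃⋆ₐ[ℂ] A) : A →L[ℂ] A :=
  (e : A →⋆ₙₐ[ℂ] A).toCLM

theorem CStarAction.norm_aut (α : CStarAction G A) (g : G) (a : A) : ‖α.aut g a‖ = ‖a‖ :=
  (AddMonoidHomClass.isometry_iff_norm _).1
    (NonUnitalStarAlgHom.isometry (α.aut g) (α.aut g).injective) a

/-- The action β_g is α_g followed by conjugation with (w_g)⋆ ⊗ 1. These unitaries multiply ρ(A)
into itself and hence preserve images of ideals, which gives the last clause. No group law for w is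
required: on elementary operators β only moves the coefficient by α, so the group law and continuity
come from α. -/
theorem IsCompactRep.exists_untwist (hρ : IsCompactRep π ρ) {w : G → (H →L[ℂ] H)}
    (hw : ∀ g, adjoint (w g) ∘L w g = 1) (hw' : ∀ g, w g ∘L adjoint (w g) = 1)
    {α : CStarAction G A} (hα : IsAdTwisted π ρ w α) :
    ∃ β : CStarAction G A, IsUntwisted π ρ α β ∧
      ∀ (J : ClosedIdeal A) (g : G) (x : A), α.aut g x ∈ J.1 → β.aut g x ∈ J.1 := by
  have hexists : ∀ (J : ClosedIdeal A) (g : G) (x : A), x ∈ J.1 →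
      ∃ y ∈ J.1, ρ y = opTensor (adjoint (w g)) 1 ∘L ρ x ∘L opTensor (w g) 1 :=
    fun J g x hx => hρ.exists_opTensor_comp_comp J _ _ hx
  have hUV : ∀ g, opTensor (w g) (1 : E →L[ℂ] E) ∘L opTensor (adjoint (w g)) 1 = 1 := fun g => by
    rw [opTensor_comp, hw']
    exact opTensor_one
  have hVU : ∀ g, opTensor (adjoint (w g)) (1 : E →L[ℂ] E) ∘L opTensor (w g) 1 = 1 := fun g => by
    rw [opTensor_comp, hw]
    exact opTensor_one
  -- The improper ideal serves to define the conjugated element for all x.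
  let T : ClosedIdeal A := ClosedIdeal.ofSet Set.univ isClosed_univ trivial (fun _ _ => trivial)
    (fun _ => trivial) (fun _ => trivial) (fun _ => trivial)
  choose b hb using fun g x => hexists T g (α.aut g x) (ClosedIdeal.mem_ofSet.2 trivial)
  replace hb : ∀ g x, ρ (b g x) =
      opTensor (adjoint (w g)) 1 ∘L ρ (α.aut g x) ∘L opTensor (w g) 1 := fun g x => (hb g x).2
  have helem : ∀ g x h c h', ρ x = elemOp π h c h' →
      ρ (b g x) = elemOp π h (α.aut g c) h' := by
    intro g x h c h' hx
    have h1 : ∀ k, adjoint (w g) (w g k) = k := fun k => congrArg (fun S : H →L[ℂ] H => S k) (hw g)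
    rw [hb, hα g x h c h' hx, elemOp_comp_opTensor, opTensor_comp_elemOp, h1, h1]
  have hadd : ∀ g x y, b g (x + y) = b g x + b g y := fun g x y => hρ.injective (by
    rw [map_add, hb, hb, hb, map_add, map_add, ContinuousLinearMap.add_comp,
      ContinuousLinearMap.comp_add])
  have hsmul : ∀ g (r : ℂ) x, b g (r • x) = r • b g x := fun g r x => hρ.injective (by
    rw [map_smul, hb, hb, map_smul, map_smul, ContinuousLinearMap.smul_comp,
      ContinuousLinearMap.comp_smul])
  have hmul : ∀ g x y, b g (x * y) = b g x * b g y := fun g x y => hρ.injective (by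
    rw [map_mul, hb, hb, hb, map_mul, map_mul]
    ext v
    have := congrArg (fun S => S (ρ (α.aut g y) (opTensor (w g) 1 v))) (hUV g)
    simp only [ContinuousLinearMap.comp_apply, mul_apply_eq_comp, one_apply_eq_self] at this ⊢
    rw [this])
  have hstar : ∀ g x, b g (star x) = star (b g x) := fun g x => hρ.injective (by
    rw [map_star, hb, hb, map_star, map_star, ContinuousLinearMap.star_eq_adjoint,
      ContinuousLinearMap.star_eq_adjoint, ContinuousLinearMap.adjoint_comp,
      ContinuousLinearMap.adjoint_comp, adjoint_opTensor, adjoint_opTensor,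
      ContinuousLinearMap.adjoint_adjoint, ← ContinuousLinearMap.star_eq_adjoint (1 : E →L[ℂ] E),
      star_one]
    rfl)
  have hnorm : ∀ g x, ‖b g x‖ ≤ ‖x‖ := fun g x => NonUnitalStarAlgHom.norm_apply_le
    ({ toFun := b g, map_smul' := hsmul g, map_zero' := by simpa using hsmul g 0 0,
       map_add' := hadd g, map_mul' := hmul g, map_star' := hstar g } : A →⋆ₙₐ[ℂ] A) x
  let bL : G → A →L[ℂ] A := fun g => LinearMap.mkContinuous
    { toFun := b g, map_add' := hadd g, map_smul' := hsmul g } 1 fun x => by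
      rw [one_mul]
      exact hnorm g x
  have hone : ∀ x, b 1 x = x := fun x => by
    refine ContinuousLinearMap.eq_on_closedSpan (S := bL 1) (T := ContinuousLinearMap.id ℂ A) ?_
      (hρ.mem_closedSpan x)
    rintro x ⟨h, c, h', hx⟩
    refine hρ.injective ((helem 1 x h c h' hx).trans ?_)
    rw [map_one]
    exact hx.symm
  have hcomp : ∀ g g' x, b (g * g') x = b g (b g' x) := fun g g' x => by
    refine ContinuousLinearMap.eq_on_closedSpan (S := bL (g * g')) (T := bL g ∘L bL g') ?_
      (hρ.mem_closedSpan x)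
    rintro x ⟨h, c, h', hx⟩
    refine hρ.injective ((helem _ x h c h' hx).trans ?_)
    rw [map_mul]
    exact (helem g _ h _ h' (helem g' x h c h' hx)).symm
  refine ⟨⟨⟨⟨fun g =>
    { toFun := b g
      invFun := b g⁻¹
      left_inv := fun x => by rw [← hcomp, inv_mul_cancel, hone]
      right_inv := fun x => by rw [← hcomp, mul_inv_cancel, hone]
      map_mul' := hmul g
      map_add' := hadd g
      map_star' := hstar g
      map_smul' := hsmul g }, StarAlgEquiv.ext hone⟩, fun g g' => StarAlgEquiv.ext (hcomp g g')⟩,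
      fun a => ?_⟩, helem, fun J g x hx => ?_⟩
  · change Continuous fun g => b g a
    refine closedSpan_induction (p := fun a => Continuous fun g => b g a) ?_ ?_ ?_ ?_ ?_
      (hρ.mem_closedSpan a)
    · refine isClosed_of_closure_subset fun x hx => ?_
      refine continuous_iff_continuousAt.2 fun g₀ => Metric.continuousAt_iff'.2 fun ε hε => ?_
      obtain ⟨y, hy, hd⟩ := Metric.mem_closure_iff.1 hx (ε / 3) (by positivity)
      have hbd : ∀ g, dist (b g x) (b g y) < ε / 3 := fun g => by
        have : b g x - b g y = b g (x - y) := ((bL g).map_sub x y).symm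
        rw [dist_eq_norm, this]
        exact (hnorm g _).trans_lt (by rwa [← dist_eq_norm])
      filter_upwards [Metric.continuousAt_iff'.1 (hy.continuousAt (x := g₀)) (ε / 3)
        (by positivity)] with g hg
      have h1 := hbd g
      have h2 := hbd g₀
      rw [dist_comm] at h2
      have h3 := dist_triangle4 (b g x) (b g y) (b g₀ y) (b g₀ x)
      linarith
    · rintro x ⟨h, c, h', hx⟩
      have hiso := NonUnitalStarAlgHom.isometry ρ hρ.injective
      refine hiso.isEmbedding.continuous_iff.2 ?_
      have : (ρ ∘ fun g => b g x) = fun g => (compLeft (create h) ∘L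
          compRight (adjoint (create h'))) (π.toCLM (α.aut g c)) := by
        funext g
        exact helem g x h c h' hx
      rw [this]
      exact (ContinuousLinearMap.continuous _).comp (π.toCLM.continuous.comp (α.continuous_aut c))
    · have : ∀ g, b g 0 = 0 := fun g => (bL g).map_zero
      simp only [this]
      exact continuous_const
    · intro x y hx hy
      simp only [hadd]
      exact hx.add hy
    · intro r x hx
      simp only [hsmul]
      exact hx.const_smul r
  · obtain ⟨y, hy, h⟩ := hexists J g _ hx
    change b g x ∈ J.1
    rwa [← hρ.injective (h.trans (hb g x).symm)]

end Untwist

/-! ### Separable Hilbert spaces -/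

section Separable

open scoped InnerProductSpace

theorem separableSpace_of_closedSpan {X : Type*} [NormedAddCommGroup X] [NormedSpace ℂ X]
    {R : Set X} (hR : TopologicalSpace.IsSeparable R) (h : ∀ x, x ∈ closedSpan R) :
    TopologicalSpace.SeparableSpace X := by
  rw [← TopologicalSpace.isSeparable_univ_iff]
  refine TopologicalSpace.IsSeparable.mono (TopologicalSpace.IsSeparable.closure
    (TopologicalSpace.IsSeparable.span (R := ℂ) hR)) fun x _ => h x

instance : TopologicalSpace.SeparableSpace (lp (fun _ : ℕ => ℂ) 2) := by
  let b : HilbertBasis ℕ ℂ (lp (fun _ : ℕ => ℂ) 2) := HilbertBasis.ofRepr (LinearIsometryEquiv.refl ℂ _)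
  refine separableSpace_of_closedSpan (Set.countable_range b).isSeparable fun x => ?_
  rw [closedSpan, b.dense_span]
  trivial

instance {H E : Type*} [NormedAddCommGroup H] [InnerProductSpace ℂ H] [NormedAddCommGroup E]
    [InnerProductSpace ℂ E] [TopologicalSpace.SeparableSpace H]
    [TopologicalSpace.SeparableSpace E] :
    TopologicalSpace.SeparableSpace (HilbertTensor H E) := by
  refine separableSpace_of_closedSpan (R := Set.range fun p : H × E => create p.1 p.2)
    (TopologicalSpace.isSeparable_range (create.continuous₂)) fun x => ?_
  refine closedSpan_le (isClosed_closedSpan _) ?_ (HilbertTensor.mem_closedSpan x)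
  rintro _ ⟨h, v, rfl⟩
  exact subset_closedSpan ⟨(h, v), rfl⟩

/-- Orthonormal vectors lie at distance √2, so the balls of radius 1/2 around them are disjoint
nonempty open sets. -/
theorem Orthonormal.countable_of_separable {F ι : Type*} [NormedAddCommGroup F]
    [InnerProductSpace ℂ F] [TopologicalSpace.SeparableSpace F] {v : ι → F}
    (hv : Orthonormal ℂ v) : Countable ι := by
  rw [← Set.countable_univ_iff]
  refine Set.PairwiseDisjoint.countable_of_isOpen (s := fun i => Metric.ball (v i) (1 / 2)) ?_
    (fun i _ => Metric.isOpen_ball) (fun i _ => ⟨v i, Metric.mem_ball_self (by norm_num)⟩)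
  intro i _ j _ hij
  refine Metric.ball_disjoint_ball ?_
  have h := norm_sub_sq (𝕜 := ℂ) (v i) (v j)
  rw [hv.1, hv.1, hv.2 hij] at h
  simp only [map_zero] at h
  rw [dist_eq_norm]
  nlinarith [norm_nonneg (v i - v j)]

/-- A separable infinite-dimensional Hilbert space is isomorphic to `ℓ²(ℕ)`. -/
theorem nonempty_linearIsometryEquiv_lp {F : Type*} [NormedAddCommGroup F]
    [InnerProductSpace ℂ F] [CompleteSpace F] [TopologicalSpace.SeparableSpace F]
    (hF : ¬ FiniteDimensional ℂ F) : Nonempty (lp (fun _ : ℕ => ℂ) 2 ≃ₗᵢ[ℂ] F) := by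
  obtain ⟨w, b, hb⟩ := exists_hilbertBasis ℂ F
  have hc : Countable w := b.orthonormal.countable_of_separable
  have hi : Infinite w := by
    refine not_finite_iff_infinite.1 fun hfin => hF ?_
    have : Fintype w := Fintype.ofFinite w
    exact b.toOrthonormalBasis.toBasis.finiteDimensional_of_finite
  obtain ⟨hd⟩ := nonempty_denumerable w
  let f := (Denumerable.eqv w).symm
  have hv : Orthonormal ℂ (b ∘ f) := b.orthonormal.comp f f.injective
  refine ⟨(HilbertBasis.mk hv ?_).repr.symm⟩
  rw [f.surjective.range_comp, b.dense_span]

theorem not_finiteDimensional_Lp_count {F : Type*} [NormedAddCommGroup F]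
    [InnerProductSpace ℂ F] [CompleteSpace F] [Nontrivial F] :
    ¬ FiniteDimensional ℂ (Lp F 2 (Measure.count : Measure ℕ)) := by
  intro hfin
  obtain ⟨h, hh⟩ := exists_norm_eq F zero_le_one
  have hne : ∀ n : ℕ, (Measure.count : Measure ℕ) {n} ≠ ⊤ := fun n => by simp
  have hv : Orthonormal ℂ fun n : ℕ => indicatorConstLp 2 (measurableSet_singleton n) (hne n) h := by
    constructor
    · intro n
      simp [norm_indicatorConstLp, hh, Measure.real]
    · intro m n hmn
      change ⟪_, _⟫_ℂ = 0
      rw [L2.inner_indicatorConstLp_indicatorConstLp _ _ (hne m) (hne n)]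
      simp [Set.singleton_inter_eq_empty.2 (show m ∉ ({n} : Set ℕ) from hmn)]
  exact not_finite_iff_infinite.2 inferInstance hv.linearIndependent.finite

end Separable

/-- Composing the conjugacy with the inclusion of 𝓚(H) ⊗ A into the bounded operators replaces the
abstract isomorphism by a concrete representation, and Ad(w) acts on |h⟩⟨h'| by moving both vectors.
-/
theorem exists_isCompactRep_of_conjugate {G : Type*} [Group G] [TopologicalSpace G]
    {H A E : Type*} [NormedAddCommGroup H] [InnerProductSpace ℂ H]
    [CompleteSpace H] [NonUnitalCStarAlgebra A] [NormedAddCommGroup E] [InnerProductSpace ℂ E]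
    [CompleteSpace E] {π : A →⋆ₙₐ[ℂ] (E →L[ℂ] E)} (hπ : Function.Injective π)
    {w : G → (H →L[ℂ] H)} {α : CStarAction G A} {δ : CStarAction G (CompactTensor H π)}
    (hδ : IsAdTensorAction π w α δ) (he : α.IsConjugate δ) :
    ∃ ρ : A →⋆ₙₐ[ℂ] (HilbertTensor H E →L[ℂ] HilbertTensor H E),
      IsCompactRep π ρ ∧ IsAdTwisted π ρ w α := by
  obtain ⟨e, he⟩ := he
  refine ⟨(NonUnitalStarSubalgebraClass.subtype (CompactTensor H π)).comp
    (e : A →⋆ₙₐ[ℂ] CompactTensor H π), ⟨hπ, Subtype.val_injective.comp e.injective, fun x => ?_⟩,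
    fun g x h b h' hx => ?_⟩
  · rw [← mem_compactTensor_iff]
    constructor
    · intro hx
      exact ⟨e.symm ⟨x, hx⟩, congrArg Subtype.val (e.apply_symm_apply ⟨x, hx⟩)⟩
    · rintro ⟨a, rfl⟩
      exact (e a).2
  · have hex : e x = CompactTensor.elem π _ (isCompactOperator_rankOne h h') b :=
      Subtype.ext (hx.trans (opTensor_rankOne_eq_elemOp π h h' b).symm)
    have hk : w g ∘L InnerProductSpace.rankOne ℂ h h' ∘L ContinuousLinearMap.adjoint (w g) =
        InnerProductSpace.rankOne ℂ (w g h) (w g h') := by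
      rw [InnerProductSpace.rankOne_comp, InnerProductSpace.comp_rankOne,
        ContinuousLinearMap.adjoint_adjoint]
    have h1 := (he g x).trans ((congrArg (δ.aut g) hex).trans
      (hδ g _ (isCompactOperator_rankOne h h') b))
    refine (congrArg Subtype.val h1).trans ?_
    exact (congrArg (fun k => opTensor k (π (α.aut g b))) hk).trans
      (opTensor_rankOne_eq_elemOp π (w g h) (w g h') (α.aut g b))

/-! ### Translations and the regular representation -/

section Translation

variable {G : Type u} [Group G] [TopologicalSpace G] [IsTopologicalGroup G]
  [LocallyCompactSpace G] [SecondCountableTopology G] [MeasurableSpace G] [BorelSpace G]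
  (μ : Measure G) [μ.IsHaarMeasure]

/-- The product of Haar measure with counting measure on `ℕ`. -/
abbrev haarNat : Measure (G × ℕ) := μ.prod Measure.count

/-- Translation in the first variable of `G × ℕ`. -/
def translateFst (k : G) : G × ℕ → G × ℕ := fun y => (k⁻¹ * y.1, y.2)

theorem measurePreserving_translateFst (k : G) :
    MeasurePreserving (translateFst k) (haarNat μ) (haarNat μ) :=
  (measurePreserving_mul_left μ k⁻¹).prod (MeasurePreserving.id _)

/-- Translation on `L²(G × ℕ, F)`. -/
def translateLp (F : Type*) [NormedAddCommGroup F] [NormedSpace ℂ F] (k : G) :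
    Lp F 2 (haarNat μ) →ₗᵢ[ℂ] Lp F 2 (haarNat μ) :=
  Lp.compMeasurePreservingₗᵢ ℂ (translateFst k) (measurePreserving_translateFst μ k)

theorem coeFn_translateLp {F : Type*} [NormedAddCommGroup F] [NormedSpace ℂ F] (k : G)
    (u : Lp F 2 (haarNat μ)) :
    translateLp μ F k u =ᵐ[haarNat μ] fun y => u (translateFst k y) :=
  Lp.coeFn_compMeasurePreserving u (measurePreserving_translateFst μ k)

theorem coeFn_leftRegular (k : G) (ξ : Lp ℂ 2 μ) :
    leftRegular μ k ξ =ᵐ[μ] fun g => ξ (k⁻¹ * g) :=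
  Lp.coeFn_compMeasurePreserving ξ (measurePreserving_mul_left μ k⁻¹)

theorem leftRegular_comp (k k' : G) : leftRegular μ k ∘L leftRegular μ k' = leftRegular μ (k * k') := by
  ext1 ξ
  refine Lp.ext ?_
  have h1 := coeFn_leftRegular μ (k * k') ξ
  have h2 := coeFn_leftRegular μ k (leftRegular μ k' ξ)
  have h3 := (measurePreserving_mul_left μ k⁻¹).quasiMeasurePreserving.ae
    (coeFn_leftRegular μ k' ξ)
  filter_upwards [h1, h2, h3] with g h1 h2 h3
  rw [h1, ContinuousLinearMap.comp_apply, h2, h3, mul_inv_rev, mul_assoc]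

theorem leftRegular_one : leftRegular μ (1 : G) = 1 := by
  ext1 ξ
  refine Lp.ext ?_
  filter_upwards [coeFn_leftRegular μ 1 ξ] with g h
  rw [h, inv_one, one_mul]
  rfl

open ContinuousLinearMap (adjoint)

theorem adjoint_leftRegularInfty_comp (k : G) :
    adjoint (leftRegularInfty μ k) ∘L leftRegularInfty μ k = 1 := by
  have h : adjoint (leftRegular μ k) ∘L leftRegular μ k = 1 :=
    (ContinuousLinearMap.norm_map_iff_adjoint_comp_self _).1 fun ξ =>
      (Lp.compMeasurePreservingₗᵢ ℂ (fun h : G => k⁻¹ * h)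
        (measurePreserving_mul_left μ k⁻¹)).norm_map ξ
  have h' : adjoint (ContinuousLinearMap.id ℂ (lp (fun _ : ℕ => ℂ) 2)) ∘L
      ContinuousLinearMap.id ℂ _ = 1 :=
    (ContinuousLinearMap.norm_map_iff_adjoint_comp_self _).1 fun _ => rfl
  rw [leftRegularInfty, adjoint_opTensor, opTensor_comp, h, h', opTensor_one]

theorem leftRegularInfty_comp (k k' : G) :
    leftRegularInfty μ k ∘L leftRegularInfty μ k' = leftRegularInfty μ (k * k') := by
  rw [leftRegularInfty, leftRegularInfty, opTensor_comp, leftRegular_comp]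
  rfl

theorem leftRegularInfty_one : leftRegularInfty μ (1 : G) = 1 := by
  rw [leftRegularInfty, leftRegular_one]
  exact opTensor_one

theorem leftRegularInfty_comp_adjoint (k : G) :
    leftRegularInfty μ k ∘L adjoint (leftRegularInfty μ k) = 1 := by
  have h1 : leftRegularInfty μ k ∘L leftRegularInfty μ k⁻¹ = 1 := by
    rw [leftRegularInfty_comp, mul_inv_cancel, leftRegularInfty_one]
  have h2 : adjoint (leftRegularInfty μ k) = leftRegularInfty μ k⁻¹ := by
    calc adjoint (leftRegularInfty μ k)
        = adjoint (leftRegularInfty μ k) ∘L (leftRegularInfty μ k ∘L leftRegularInfty μ k⁻¹) := by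
          rw [h1]
          rfl
      _ = leftRegularInfty μ k⁻¹ := by
          rw [← ContinuousLinearMap.comp_assoc, adjoint_leftRegularInfty_comp]
          rfl
  rw [h2, h1]

theorem CStarAction.AbsorbsRegular.exists_isCompactRep {A : Type v} [NonUnitalCStarAlgebra A]
    {α : CStarAction G A} (hα : α.AbsorbsRegular μ) :
    ∃ (E : Type v) (_ : NormedAddCommGroup E) (_ : InnerProductSpace ℂ E) (_ : CompleteSpace E)
      (π : A →⋆ₙₐ[ℂ] (E →L[ℂ] E))
      (ρ : A →⋆ₙₐ[ℂ] (HilbertTensor (RegularHilbert μ) E →L[ℂ] HilbertTensor (RegularHilbert μ) E)),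
      IsCompactRep π ρ ∧ IsAdTwisted π ρ (leftRegularInfty μ) α := by
  obtain ⟨E, i1, i2, i3, π, hπ, δ, hδ, he⟩ := hα
  obtain ⟨ρ, hρ, hρα⟩ := exists_isCompactRep_of_conjugate hπ hδ he
  exact ⟨E, i1, i2, i3, π, ρ, hρ, hρα⟩

end Translation

/-! ### Decomposing H as L²(G × ℕ, H) -/

section Decomposition

open scoped InnerProductSpace

variable {G : Type u} [Group G] [TopologicalSpace G] [IsTopologicalGroup G]
  [LocallyCompactSpace G] [SecondCountableTopology G] [MeasurableSpace G] [BorelSpace G]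
  (μ : Measure G) [μ.IsHaarMeasure]
  {H : Type*} [NormedAddCommGroup H] [InnerProductSpace ℂ H]

theorem memLp_smul_prod (s : Lp H 2 (Measure.count : Measure ℕ)) (ξ : Lp ℂ 2 μ) :
    MemLp (fun y : G × ℕ => ξ y.1 • s y.2) 2 (haarNat μ) := by
  have hm : AEStronglyMeasurable (fun y : G × ℕ => ξ y.1 • s y.2) (haarNat μ) :=
    (Lp.aestronglyMeasurable ξ).comp_fst.smul (Lp.aestronglyMeasurable s).comp_snd
  refine (memLp_two_iff_integrable_sq_norm hm).2 ?_
  have h1 := (memLp_two_iff_integrable_sq_norm (Lp.aestronglyMeasurable ξ)).1 (Lp.memLp ξ)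
  have h2 := (memLp_two_iff_integrable_sq_norm (Lp.aestronglyMeasurable s)).1 (Lp.memLp s)
  refine (h1.mul_prod h2).congr (Filter.Eventually.of_forall fun y => ?_)
  simp only [norm_smul, mul_pow]

/-- The function `(g, n) ↦ ξ(g) s(n)`. -/
def prodLp (s : Lp H 2 (Measure.count : Measure ℕ)) (ξ : Lp ℂ 2 μ) : Lp H 2 (haarNat μ) :=
  (memLp_smul_prod μ s ξ).toLp _

theorem coeFn_prodLp (s : Lp H 2 (Measure.count : Measure ℕ)) (ξ : Lp ℂ 2 μ) :
    prodLp μ s ξ =ᵐ[haarNat μ] fun y => ξ y.1 • s y.2 :=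
  MemLp.coeFn_toLp _

theorem ae_fst {p : G → Prop} (h : ∀ᵐ g ∂μ, p g) : ∀ᵐ y ∂(haarNat μ), p y.1 :=
  Measure.quasiMeasurePreserving_fst.ae h

theorem ae_snd {p : ℕ → Prop} (h : ∀ᵐ n ∂(Measure.count : Measure ℕ), p n) :
    ∀ᵐ y ∂(haarNat μ), p y.2 :=
  Measure.quasiMeasurePreserving_snd.ae h

/-- `prodLp` as a bilinear map. -/
def prodLpₗ : Lp H 2 (Measure.count : Measure ℕ) →ₗ[ℂ] Lp ℂ 2 μ →ₗ[ℂ] Lp H 2 (haarNat μ) :=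
  LinearMap.mk₂ ℂ (prodLp μ)
    (fun s s' ξ => by
      refine Lp.ext ?_
      filter_upwards [coeFn_prodLp μ (s + s') ξ, coeFn_prodLp μ s ξ, coeFn_prodLp μ s' ξ,
        Lp.coeFn_add (prodLp μ s ξ) (prodLp μ s' ξ), ae_snd μ (Lp.coeFn_add s s')]
        with y h1 h2 h3 h4 h5
      rw [h1, h4, Pi.add_apply, h2, h3, h5, Pi.add_apply, smul_add])
    (fun r s ξ => by
      refine Lp.ext ?_
      filter_upwards [coeFn_prodLp μ (r • s) ξ, coeFn_prodLp μ s ξ,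
        Lp.coeFn_smul r (prodLp μ s ξ), ae_snd μ (Lp.coeFn_smul r s)]
        with y h1 h2 h3 h4
      rw [h1, h3, Pi.smul_apply, h2, h4, Pi.smul_apply, smul_comm])
    (fun s ξ ξ' => by
      refine Lp.ext ?_
      filter_upwards [coeFn_prodLp μ s (ξ + ξ'), coeFn_prodLp μ s ξ, coeFn_prodLp μ s ξ',
        Lp.coeFn_add (prodLp μ s ξ) (prodLp μ s ξ'), ae_fst μ (Lp.coeFn_add ξ ξ')]
        with y h1 h2 h3 h4 h5
      rw [h1, h4, Pi.add_apply, h2, h3, h5, Pi.add_apply, add_smul])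
    (fun r s ξ => by
      refine Lp.ext ?_
      filter_upwards [coeFn_prodLp μ s (r • ξ), coeFn_prodLp μ s ξ,
        Lp.coeFn_smul r (prodLp μ s ξ), ae_fst μ (Lp.coeFn_smul r ξ)]
        with y h1 h2 h3 h4
      rw [h1, h3, Pi.smul_apply, h2, h4, Pi.smul_apply, smul_assoc])

theorem inner_prodLp (s s' : Lp H 2 (Measure.count : Measure ℕ)) (ξ ξ' : Lp ℂ 2 μ) :
    ⟪prodLp μ s ξ, prodLp μ s' ξ'⟫_ℂ = ⟪s, s'⟫_ℂ * ⟪ξ, ξ'⟫_ℂ := by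
  rw [L2.inner_def, L2.inner_def, L2.inner_def, mul_comm, ← integral_prod_mul]
  refine integral_congr_ae ?_
  filter_upwards [coeFn_prodLp μ s ξ, coeFn_prodLp μ s' ξ'] with y h1 h2
  rw [h1, h2, inner_smul_left, inner_smul_right]
  simp only [RCLike.inner_apply]
  ring

theorem indicatorConstLp_prod_singleton (n : ℕ) {s : Set G} (hs : MeasurableSet s) (hμs : μ s ≠ ⊤)
    (hs' : MeasurableSet (s ×ˢ ({n} : Set ℕ))) (hμs' : haarNat μ (s ×ˢ ({n} : Set ℕ)) ≠ ⊤) (c : H) :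
    indicatorConstLp 2 hs' hμs' c = prodLp μ
      (indicatorConstLp 2 (measurableSet_singleton n) (by simp) c) (indicatorConstLp 2 hs hμs 1) := by
  refine Lp.ext ?_
  filter_upwards [coeFn_prodLp μ
    (indicatorConstLp 2 (measurableSet_singleton n) (by simp) c) (indicatorConstLp 2 hs hμs 1),
    indicatorConstLp_coeFn (p := 2) (hs := hs') (hμs := hμs') (c := c),
    ae_fst μ (indicatorConstLp_coeFn (p := 2) (hs := hs) (hμs := hμs) (c := (1 : ℂ))),
    ae_snd μ (indicatorConstLp_coeFn (p := 2) (hs := measurableSet_singleton n) (μ := Measure.count)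
      (hμs := by simp) (c := c))] with y h1 h2 h3 h4
  rw [h1, h2, h3, h4]
  classical
  simp only [Set.indicator_apply, Set.mem_prod]
  by_cases h : y.1 ∈ s <;> by_cases h' : y.2 ∈ ({n} : Set ℕ) <;> simp [h, h']

/-- Density of the product functions. The part of a finite-measure set Q over one integer is a
rectangle; finite unions of these parts exhaust Q in measure, and indicators of such Q generate L².
-/
theorem mem_of_forall_prodLp_mem (W : Submodule ℂ (Lp H 2 (haarNat μ)))
    (hW : IsClosed (W : Set (Lp H 2 (haarNat μ)))) (h : ∀ s ξ, prodLp μ s ξ ∈ W)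
    (u : Lp H 2 (haarNat μ)) : u ∈ W := by
  refine Lp.induction (by simp) (fun u => u ∈ W) ?_ (fun f g hf hg _ h1 h2 => W.add_mem h1 h2)
    hW u
  intro c Q hQ hμQ
  rw [Lp.simpleFunc.coe_indicatorConst]
  have hQn : ∀ n : ℕ, MeasurableSet (Q ∩ Prod.snd ⁻¹' {n}) := fun n =>
    hQ.inter (measurable_snd (measurableSet_singleton n))
  have hQN : ∀ N : ℕ, MeasurableSet (Q ∩ Prod.snd ⁻¹' Set.Iio N) := fun N =>
    hQ.inter (measurable_snd measurableSet_Iio)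
  have hfin : ∀ T : Set (G × ℕ), haarNat μ (Q ∩ T) ≠ ⊤ := fun T =>
    ((measure_mono Set.inter_subset_left).trans_lt hμQ).ne
  have hone : ∀ n : ℕ, indicatorConstLp 2 (hQn n) (hfin _) c ∈ W := by
    intro n
    have heq : Q ∩ Prod.snd ⁻¹' {n} = ((fun g : G => (g, n)) ⁻¹' Q) ×ˢ ({n} : Set ℕ) := by
      ext ⟨g, m⟩
      simp only [Set.mem_inter_iff, Set.mem_preimage, Set.mem_singleton_iff, Set.mem_prod]
      constructor
      · rintro ⟨h1, rfl⟩
        exact ⟨h1, rfl⟩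
      · rintro ⟨h1, rfl⟩
        exact ⟨h1, rfl⟩
    have hm : MeasurableSet ((fun g : G => (g, n)) ⁻¹' Q) := measurable_prodMk_right hQ
    have hfin' := hfin (Prod.snd ⁻¹' {n})
    have hfin'' : μ ((fun g : G => (g, n)) ⁻¹' Q) ≠ ⊤ := by
      rw [heq, Measure.prod_prod] at hfin'
      simpa using hfin'
    have := indicatorConstLp_prod_singleton μ n hm hfin'' (heq ▸ hQn n) (heq ▸ hfin') c
    have hcongr : indicatorConstLp 2 (hQn n) (hfin _) c =
        indicatorConstLp 2 (heq ▸ hQn n) (heq ▸ hfin') c := by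
      congr 1
    rw [hcongr, this]
    exact h _ _
  have hN : ∀ N : ℕ, indicatorConstLp 2 (hQN N) (hfin _) c ∈ W := by
    intro N
    induction N with
    | zero =>
      have : indicatorConstLp 2 (hQN 0) (hfin _) c = (0 : Lp H 2 (haarNat μ)) := by
        rw [← indicatorConstLp_empty (c := c)]
        congr 1
        ext y
        simp
      rw [this]
      exact W.zero_mem
    | succ N ih =>
      have hdis : Disjoint (Q ∩ Prod.snd ⁻¹' Set.Iio N) (Q ∩ Prod.snd ⁻¹' {N}) := by
        rw [Set.disjoint_left]
        rintro y ⟨-, h1⟩ ⟨-, h2⟩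
        simp only [Set.mem_preimage, Set.mem_Iio, Set.mem_singleton_iff] at h1 h2
        omega
      have : indicatorConstLp 2 (hQN (N + 1)) (hfin _) c =
          indicatorConstLp 2 (hQN N) (hfin _) c + indicatorConstLp 2 (hQn N) (hfin _) c := by
        rw [← indicatorConstLp_disjoint_union (hQN N) (hQn N) (hfin _) (hfin _) hdis]
        congr 1
        ext y
        simp only [Set.mem_inter_iff, Set.mem_preimage, Set.mem_Iio, Set.mem_union,
          Set.mem_singleton_iff, Nat.lt_succ_iff_lt_or_eq]
        tauto
      rw [this]
      exact W.add_mem ih (hone N)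
  refine hW.mem_of_tendsto (tendsto_indicatorConstLp_set (l := Filter.atTop) (ht := hQN)
    (hμt := fun N => hfin _) (by simp) ?_) (Filter.Eventually.of_forall hN)
  have hanti : Antitone fun N : ℕ => Q ∩ Prod.snd ⁻¹' Set.Ici N := fun a b hab =>
    Set.inter_subset_inter_right _ (Set.preimage_mono (Set.Ici_subset_Ici.2 hab))
  have hlim := tendsto_measure_iInter_atTop (μ := haarNat μ)
    (s := fun N : ℕ => Q ∩ Prod.snd ⁻¹' Set.Ici N)
    (fun N => (hQ.inter (measurable_snd measurableSet_Ici)).nullMeasurableSet) hanti ⟨0, hfin _⟩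
  have hempty : ⋂ N : ℕ, Q ∩ Prod.snd ⁻¹' Set.Ici N = ∅ := by
    refine Set.eq_empty_of_forall_notMem fun y hy => ?_
    have := (Set.mem_iInter.1 hy (y.2 + 1)).2
    simp at this
  rw [hempty, measure_empty] at hlim
  refine hlim.congr fun N => congrArg _ ?_
  ext y
  simp only [Set.mem_symmDiff, Set.mem_inter_iff, Set.mem_preimage, Set.mem_Ici, Set.mem_Iio]
  by_cases h1 : y ∈ Q <;> simp [h1]

theorem translateLp_prodLp (k : G) (s : Lp H 2 (Measure.count : Measure ℕ)) (ξ : Lp ℂ 2 μ) :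
    translateLp μ H k (prodLp μ s ξ) = prodLp μ s (leftRegular μ k ξ) := by
  refine Lp.ext ?_
  filter_upwards [coeFn_translateLp μ k (prodLp μ s ξ), coeFn_prodLp μ s (leftRegular μ k ξ),
    (measurePreserving_translateFst μ k).quasiMeasurePreserving.ae (coeFn_prodLp μ s ξ),
    ae_fst μ (coeFn_leftRegular μ k ξ)] with y h1 h2 h3 h4
  rw [h1, h2, h3, h4]
  rfl

/-- `ℓ²(ℕ) ⊗ L²(G) ≅ L²(G × ℕ, H)` equivariantly, for every separable Hilbert space `H ≠ 0`. -/
theorem exists_regularDecomposition [CompleteSpace H] [TopologicalSpace.SeparableSpace H]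
    [Nontrivial H] :
    ∃ S : RegularHilbert μ ≃ₗᵢ[ℂ] Lp H 2 (haarNat μ),
      ∀ k x, S (leftRegularInfty μ k x) = translateLp μ H k (S x) := by
  have hfact : Fact ((2 : ENNReal) ≠ ⊤) := ⟨by simp⟩
  -- Both ℓ²(ℕ) and L²(ℕ, H) are separable and infinite-dimensional, so the first factor, on which G
  -- acts trivially, may be replaced by L²(ℕ, H).
  obtain ⟨s⟩ := nonempty_linearIsometryEquiv_lp
    (not_finiteDimensional_Lp_count (F := H))
  obtain ⟨f, hf⟩ := HilbertTensor.exists_lift ((prodLpₗ μ (H := H)).comp s.toLinearEquiv.toLinearMap)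
    (fun x ξ x' ξ' => (inner_prodLp μ (s x) (s x') ξ ξ').trans (by rw [s.inner_map_map]))
  replace hf : ∀ x ξ, f (create x ξ) = prodLp μ (s x) ξ := hf
  have hsurj : Function.Surjective f := by
    intro u
    have hcl : IsClosed (f.toLinearMap.range : Set (Lp H 2 (haarNat μ))) :=
      f.isometry.isClosedEmbedding.isClosed_range
    obtain ⟨x, hx⟩ := mem_of_forall_prodLp_mem μ _ hcl
      (fun t ξ => ⟨create (s.symm t) ξ, (hf _ _).trans (by rw [s.apply_symm_apply])⟩) u
    exact ⟨x, hx⟩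
  refine ⟨LinearIsometryEquiv.ofSurjective f hsurj, fun k x => ?_⟩
  have : f.toContinuousLinearMap ∘L leftRegularInfty μ k =
      (translateLp μ H k).toContinuousLinearMap ∘L f.toContinuousLinearMap :=
    HilbertTensor.hom_ext fun x ξ => by
      change f (opTensor _ _ _) = translateLp μ H k (f _)
      rw [opTensor_create, hf, hf, translateLp_prodLp]
      rfl
  exact congrArg (fun T => T x) this

end Decomposition

/-! ### Column operators K → L²(Y, K) -/

section Columns

open scoped InnerProductSpace
open ContinuousLinearMap (adjoint)

variable {Y : Type*} [MeasurableSpace Y] (ν : Measure Y)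
  {K : Type*} [NormedAddCommGroup K] [InnerProductSpace ℂ K]

/-- The operator `ζ ↦ u(·) ζ` of a square integrable operator-valued function `u`. -/
def column : Lp (K →L[ℂ] K) 2 ν →L[ℂ] (K →L[ℂ] Lp K 2 ν) :=
  ((ContinuousLinearMap.apply ℂ K (E := K)).compLpL₂ 2 ν).flip

variable {ν}

theorem coeFn_column (u : Lp (K →L[ℂ] K) 2 ν) (ζ : K) :
    column ν u ζ =ᵐ[ν] fun y => u y ζ :=
  ContinuousLinearMap.coeFn_compLp _ u

theorem norm_column_le (u : Lp (K →L[ℂ] K) 2 ν) : ‖column ν u‖ ≤ ‖u‖ := by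
  refine ContinuousLinearMap.opNorm_le_bound _ (norm_nonneg _) fun ζ => ?_
  change ‖(ContinuousLinearMap.apply ℂ K ζ).compLp u‖ ≤ _
  refine (ContinuousLinearMap.norm_compLp_le _ u).trans ?_
  rw [mul_comm]
  refine mul_le_mul_of_nonneg_left ?_ (norm_nonneg _)
  refine ContinuousLinearMap.opNorm_le_bound _ (norm_nonneg _) fun T => ?_
  rw [mul_comm]
  exact T.le_opNorm ζ

theorem column_ext {T T' : K →L[ℂ] Lp K 2 ν} (h : ∀ ζ, T ζ =ᵐ[ν] T' ζ) : T = T' :=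
  ContinuousLinearMap.ext fun ζ => Lp.ext (h ζ)

variable (ν K) in
/-- The operator `ζ ↦ ξ(·) ζ` of a square integrable function `ξ`. -/
def scalarColumn : Lp ℂ 2 ν →L[ℂ] (K →L[ℂ] Lp K 2 ν) :=
  column ν ∘L (ContinuousLinearMap.toSpanSingleton ℂ (1 : K →L[ℂ] K)).compLpL 2 ν

theorem coeFn_scalarColumn (ξ : Lp ℂ 2 ν) (ζ : K) :
    scalarColumn ν K ξ ζ =ᵐ[ν] fun y => ξ y • ζ := by
  have h1 := coeFn_column
    ((ContinuousLinearMap.toSpanSingleton ℂ (1 : K →L[ℂ] K)).compLp ξ) ζ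
  have h2 := ContinuousLinearMap.coeFn_compLp
    (ContinuousLinearMap.toSpanSingleton ℂ (1 : K →L[ℂ] K)) ξ
  filter_upwards [h1, h2] with y h1 h2
  refine h1.trans ?_
  rw [h2]
  simp

theorem toSpanSingleton_compLp_indicatorConstLp {F : Type*} [NormedAddCommGroup F]
    [NormedSpace ℂ F] {s : Set Y} (hs : MeasurableSet s) (hμs : ν s ≠ ⊤) (c : F) :
    (ContinuousLinearMap.toSpanSingleton ℂ c).compLp (indicatorConstLp 2 hs hμs (1 : ℂ)) =
      indicatorConstLp 2 hs hμs c := by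
  refine Lp.ext ?_
  filter_upwards [indicatorConstLp_coeFn (p := 2) (hs := hs) (hμs := hμs) (c := c),
    indicatorConstLp_coeFn (p := 2) (hs := hs) (hμs := hμs) (c := (1 : ℂ)),
    (ContinuousLinearMap.toSpanSingleton ℂ c).coeFn_compLp
      (indicatorConstLp 2 hs hμs (1 : ℂ))] with y h1 h2 h3
  rw [h1, h3, h2]
  by_cases hy : y ∈ s <;> simp [hy]

theorem scalarColumn_comp_eq_column {F : Type*} [NormedAddCommGroup F] [NormedSpace ℂ F]
    (L : F →L[ℂ] (K →L[ℂ] K)) (ξ : Lp ℂ 2 ν) (a : F) :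
    scalarColumn ν K ξ ∘L L a =
      column ν (L.compLp ((ContinuousLinearMap.toSpanSingleton ℂ a).compLp ξ)) := by
  refine column_ext fun ζ => ?_
  filter_upwards [coeFn_scalarColumn ξ (L a ζ), coeFn_column
    (L.compLp ((ContinuousLinearMap.toSpanSingleton ℂ a).compLp ξ)) ζ,
    L.coeFn_compLp ((ContinuousLinearMap.toSpanSingleton ℂ a).compLp ξ),
    ContinuousLinearMap.coeFn_compLp (ContinuousLinearMap.toSpanSingleton ℂ a) ξ]
    with y h1 h2 h3 h4
  rw [h2, h3, h4]
  refine h1.trans ?_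
  simp

/-- Simple functions are dense in L², and the column of an indicator times a constant a is a scalar
column composed with L(a). -/
theorem column_compLp_mem_closedSpan {F : Type*} [NormedAddCommGroup F] [NormedSpace ℂ F]
    (L : F →L[ℂ] (K →L[ℂ] K)) (u : Lp F 2 ν) :
    column ν (L.compLp u) ∈ closedSpan {T | ∃ ξ a, T = scalarColumn ν K ξ ∘L L a} := by
  refine Lp.induction (by simp) (fun u => column ν (L.compLp u) ∈
    closedSpan {T | ∃ ξ a, T = scalarColumn ν K ξ ∘L L a}) ?_ ?_ ?_ u
  · intro c s hs hμs
    rw [Lp.simpleFunc.coe_indicatorConst]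
    refine subset_closedSpan ⟨indicatorConstLp 2 hs hμs.ne 1, c, ?_⟩
    rw [scalarColumn_comp_eq_column]
    congr 2
    exact (toSpanSingleton_compLp_indicatorConstLp hs hμs.ne c).symm
  · intro f g hf hg _ h1 h2
    have := Submodule.add_mem _ h1 h2
    change column ν (L.compLpL 2 ν (hf.toLp f)) + column ν (L.compLpL 2 ν (hg.toLp g)) ∈ _ at this
    rwa [← map_add, ← (L.compLpL 2 ν).map_add (hf.toLp f) (hg.toLp g)] at this
  · exact (isClosed_closedSpan _).preimage
      ((column ν).continuous.comp (L.compLpL 2 ν).continuous)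

variable [CompleteSpace K]

/-- Under L²(Y, K) ≅ L²(Y) ⊗ K the column C_ξ is ζ ↦ ξ ⊗ ζ, so these are the creation operator
relations. -/
theorem adjoint_scalarColumn_comp (ξ ξ' : Lp ℂ 2 ν) :
    adjoint (scalarColumn ν K ξ) ∘L scalarColumn ν K ξ' = ⟪ξ, ξ'⟫_ℂ • (1 : K →L[ℂ] K) := by
  refine ContinuousLinearMap.ext fun ζ => ext_inner_left ℂ fun ζ' => ?_
  rw [ContinuousLinearMap.comp_apply, ContinuousLinearMap.adjoint_inner_right, L2.inner_def,
    smul_apply, one_apply_eq_self, inner_smul_right, L2.inner_def, ← integral_mul_const]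
  refine integral_congr_ae ?_
  filter_upwards [coeFn_scalarColumn ξ ζ', coeFn_scalarColumn ξ' ζ] with y h1 h2
  rw [h1, h2, inner_smul_left, inner_smul_right]
  simp only [RCLike.inner_apply]
  ring

theorem norm_scalarColumn_le (ξ : Lp ℂ 2 ν) : ‖scalarColumn ν K ξ‖ ≤ ‖ξ‖ := by
  have h := ContinuousLinearMap.norm_adjoint_comp_self (scalarColumn ν K ξ)
  rw [adjoint_scalarColumn_comp, inner_self_eq_norm_sq_to_K] at h
  have h1 : ‖scalarColumn ν K ξ‖ * ‖scalarColumn ν K ξ‖ ≤ ‖ξ‖ * ‖ξ‖ := by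
    rw [← h, norm_smul]
    refine (mul_le_mul_of_nonneg_left ContinuousLinearMap.norm_id_le (norm_nonneg _)).trans ?_
    simp [pow_two]
  nlinarith [norm_nonneg (scalarColumn ν K ξ), norm_nonneg ξ]

end Columns

/-! ### Multiplication by operator-valued functions -/

section MultiplicationOperators

open scoped InnerProductSpace
open ContinuousLinearMap (adjoint)

variable {Y : Type*} [MeasurableSpace Y] [TopologicalSpace Y] [BorelSpace Y]
  [SecondCountableTopology Y] [TopologicalSpace.MetrizableSpace Y] (ν : Measure Y)
  {K : Type*} [NormedAddCommGroup K] [InnerProductSpace ℂ K] [CompleteSpace K]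

/-- `M` acts on `L²(Y, K)` as multiplication by the operator-valued function `F`. -/
def IsMulOp (F : Y → K →L[ℂ] K) (M : Lp K 2 ν →L[ℂ] Lp K 2 ν) : Prop :=
  ∀ u, M u =ᵐ[ν] fun y => F y (u y)

/-- A uniform bound upgrades strong continuity to joint continuity of (y, ζ) ↦ F(y)ζ, which makes y
↦ F(y)u(y) measurable although F need not be norm measurable. -/
theorem memLp_apply {F : Y → K →L[ℂ] K} (hF : ∀ ζ, Continuous fun y => F y ζ) {C : ℝ}
    (hC : ∀ y, ‖F y‖ ≤ C) (u : Lp K 2 ν) : MemLp (fun y => F y (u y)) 2 ν := by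
  have hC' : ∀ y ζ, ‖F y ζ‖ ≤ C * ‖ζ‖ := fun y ζ =>
    ((F y).le_opNorm ζ).trans (mul_le_mul_of_nonneg_right (hC y) (norm_nonneg _))
  have hcont : Continuous fun p : Y × K => F p.1 p.2 := by
    refine continuous_iff_continuousAt.2 fun p => ?_
    refine tendsto_iff_norm_sub_tendsto_zero.2 ?_
    have h1 : Filter.Tendsto (fun q : Y × K => C * ‖q.2 - p.2‖ + ‖F q.1 p.2 - F p.1 p.2‖)
        (nhds p) (nhds (C * ‖p.2 - p.2‖ + ‖F p.1 p.2 - F p.1 p.2‖)) := by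
      have h2 : Continuous fun q : Y × K => F q.1 p.2 := (hF p.2).comp continuous_fst
      exact Continuous.tendsto (by fun_prop) p
    simp only [sub_self, norm_zero, mul_zero, add_zero] at h1
    refine squeeze_zero (fun _ => norm_nonneg _) (fun q => ?_) h1
    have h3 : F q.1 q.2 - F p.1 p.2 = F q.1 (q.2 - p.2) + (F q.1 p.2 - F p.1 p.2) := by
      rw [map_sub]
      abel
    rw [h3]
    exact (norm_add_le _ _).trans (add_le_add_left (hC' _ _) _)
  have hm : AEStronglyMeasurable (fun y => F y (u y)) ν :=
    hcont.comp_aestronglyMeasurable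
      (aestronglyMeasurable_id.prodMk (Lp.aestronglyMeasurable u))
  exact MemLp.of_le_mul (Lp.memLp u) hm (Filter.Eventually.of_forall fun y => hC' y _)

theorem exists_isMulOp {F : Y → K →L[ℂ] K} (hF : ∀ ζ, Continuous fun y => F y ζ) {C : ℝ}
    (hC : ∀ y, ‖F y‖ ≤ C) : ∃ M, IsMulOp ν F M := by
  refine ⟨LinearMap.mkContinuous
    { toFun := fun u => (memLp_apply ν hF hC u).toLp _
      map_add' := fun u v => ?_
      map_smul' := fun r u => ?_ } C fun u => ?_, fun u => MemLp.coeFn_toLp (memLp_apply ν hF hC u)⟩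
  · refine Lp.ext ?_
    filter_upwards [MemLp.coeFn_toLp (memLp_apply ν hF hC (u + v)),
      MemLp.coeFn_toLp (memLp_apply ν hF hC u), MemLp.coeFn_toLp (memLp_apply ν hF hC v),
      Lp.coeFn_add ((memLp_apply ν hF hC u).toLp _) ((memLp_apply ν hF hC v).toLp _),
      Lp.coeFn_add u v] with y h1 h2 h3 h4 h5
    rw [h1, h4, Pi.add_apply, h2, h3, h5, Pi.add_apply, map_add]
  · refine Lp.ext ?_
    filter_upwards [MemLp.coeFn_toLp (memLp_apply ν hF hC (r • u)),
      MemLp.coeFn_toLp (memLp_apply ν hF hC u),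
      Lp.coeFn_smul r ((memLp_apply ν hF hC u).toLp _), Lp.coeFn_smul r u] with y h1 h2 h3 h4
    rw [h1, RingHom.id_apply, h3, Pi.smul_apply, h2, h4, Pi.smul_apply, map_smul]
  · refine Lp.norm_le_mul_norm_of_ae_le_mul ?_
    filter_upwards [MemLp.coeFn_toLp (memLp_apply ν hF hC u)] with y h
    refine (congrArg norm h).trans_le ?_
    exact ((F y).le_opNorm _).trans (mul_le_mul_of_nonneg_right (hC y) (norm_nonneg _))

variable {ν}

theorem IsMulOp.eq {F : Y → K →L[ℂ] K} {M M' : Lp K 2 ν →L[ℂ] Lp K 2 ν} (h : IsMulOp ν F M)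
    (h' : IsMulOp ν F M') : M = M' :=
  ContinuousLinearMap.ext fun u => Lp.ext ((h u).trans (h' u).symm)

theorem IsMulOp.mul {F F' : Y → K →L[ℂ] K} {M M' : Lp K 2 ν →L[ℂ] Lp K 2 ν}
    (h : IsMulOp ν F M) (h' : IsMulOp ν F' M') : IsMulOp ν (fun y => F y * F' y) (M * M') :=
  fun u => by
    filter_upwards [h (M' u), h' u] with y h1 h2
    exact h1.trans (congrArg (F y) h2)

theorem IsMulOp.adjoint {F : Y → K →L[ℂ] K} {M M' : Lp K 2 ν →L[ℂ] Lp K 2 ν}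
    (h : IsMulOp ν F M) (h' : IsMulOp ν (fun y => star (F y)) M') : M' = star M := by
  refine ContinuousLinearMap.ext fun u => ext_inner_left ℂ fun v => ?_
  rw [ContinuousLinearMap.star_eq_adjoint, ContinuousLinearMap.adjoint_inner_right, L2.inner_def,
    L2.inner_def]
  refine integral_congr_ae ?_
  filter_upwards [h v, h' u] with y h1 h2
  rw [h1, h2, ContinuousLinearMap.star_eq_adjoint, ContinuousLinearMap.adjoint_inner_right]

theorem IsMulOp.comp_column {F : Y → K →L[ℂ] K} {M : Lp K 2 ν →L[ℂ] Lp K 2 ν}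
    (h : IsMulOp ν F M) {u u' : Lp (K →L[ℂ] K) 2 ν} (hu : ∀ᵐ y ∂ν, u' y = F y * u y) :
    M ∘L column ν u = column ν u' := by
  refine column_ext fun ζ => ?_
  filter_upwards [h (column ν u ζ), coeFn_column u ζ, coeFn_column u' ζ, hu] with y h1 h2 h3 h4
  rw [h3, h4]
  refine h1.trans ?_
  rw [h2]
  rfl

/-- A strongly continuous field of representations integrates to a representation by
multiplication operators. -/
theorem exists_mulRep {A : Type*} [NonUnitalCStarAlgebra A] (F : Y → (A →⋆ₙₐ[ℂ] (K →L[ℂ] K)))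
    (hF : ∀ f ζ, Continuous fun y => F y f ζ) :
    ∃ Ψ : A →⋆ₙₐ[ℂ] (Lp K 2 ν →L[ℂ] Lp K 2 ν), ∀ f, IsMulOp ν (fun y => F y f) (Ψ f) := by
  choose M hM using fun f => exists_isMulOp ν (hF f)
    (fun y => NonUnitalStarAlgHom.norm_apply_le (F y) f)
  refine ⟨{ toFun := M, map_smul' := fun r f => ?_, map_zero' := ?_, map_add' := fun f f' => ?_,
            map_mul' := fun f f' => ?_, map_star' := fun f => ?_ }, hM⟩
  · refine (hM (r • f)).eq fun u => ?_
    filter_upwards [hM f u, Lp.coeFn_smul r (M f u)] with y h1 h2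
    refine h2.trans ?_
    rw [Pi.smul_apply, h1, map_smul]
    rfl
  · refine (hM 0).eq fun u => ?_
    filter_upwards [Lp.coeFn_zero K 2 ν] with y h1
    refine h1.trans ?_
    rw [map_zero]
    rfl
  · refine (hM (f + f')).eq fun u => ?_
    filter_upwards [hM f u, hM f' u, Lp.coeFn_add (M f u) (M f' u)] with y h1 h2 h3
    refine h3.trans ?_
    rw [Pi.add_apply, h1, h2, map_add]
    rfl
  · refine (hM (f * f')).eq ?_
    simp only [map_mul]
    exact (hM f).mul (hM f')
  · have := hM (star f)
    simp only [map_star] at this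
    exact (hM f).adjoint this

end MultiplicationOperators

/-! ### Double centralizers -/

section Multipliers

variable {A : Type*} [NonUnitalCStarAlgebra A]

theorem eq_of_forall_mul_left_eq {x y : A} (h : ∀ c, c * x = c * y) : x = y := by
  rw [← sub_eq_zero, ← CStarRing.star_mul_self_eq_zero_iff, mul_sub, h, sub_self]

theorem eq_of_forall_mul_right_eq {x y : A} (h : ∀ c, x * c = y * c) : x = y := by
  rw [← sub_eq_zero, ← CStarRing.mul_star_self_eq_zero_iff, sub_mul, h, sub_self]

theorem DoubleCentralizer.fst_mul (m : 𝓜(ℂ, A)) (a b : A) : m.fst (a * b) = m.fst a * b :=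
  eq_of_forall_mul_left_eq fun c => by
    rw [← m.central, ← mul_assoc, m.central, mul_assoc]

/-- The centralizer identity determines the right action from the left one, since elements of A are
separated by right multiplication. -/
theorem DoubleCentralizer.ext_fst {m m' : 𝓜(ℂ, A)} (h : ∀ a, m.fst a = m'.fst a) : m = m' := by
  refine DoubleCentralizer.ext ℂ A m m' (Prod.ext (ContinuousLinearMap.ext h)
    (ContinuousLinearMap.ext fun b => eq_of_forall_mul_right_eq fun c => ?_))
  rw [m.central, m'.central, h]

end Multipliers

/-! ### Extending a representation to the multiplier algebra -/

section MultiplierRep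

open scoped InnerProductSpace
open ContinuousLinearMap (adjoint)
open Filter Topology

variable {A : Type*} [NonUnitalCStarAlgebra A]
  {K : Type*} [NormedAddCommGroup K] [InnerProductSpace ℂ K] [CompleteSpace K]
  (ρ : A →⋆ₙₐ[ℂ] (K →L[ℂ] K))

/-- The space is the orthogonal sum of the closed span of ρ(A)K and the vectors killed by ρ(A). This
handles degenerate representations, for which ρ(A)K alone would not suffice. -/
theorem NonUnitalStarAlgHom.induction_on_space {p : K → Prop} (closed : IsClosed {v | p v})
    (mem : ∀ a v, p (ρ a v)) (ker : ∀ v, (∀ a, ρ a v = 0) → p v)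
    (add : ∀ v w, p v → p w → p (v + w)) (smul : ∀ (r : ℂ) v, p v → p (r • v)) (v : K) : p v := by
  set V := closedSpan {w | ∃ a v, w = ρ a v}
  have : CompleteSpace V := (isClosed_closedSpan _).completeSpace_coe
  have hker : ∀ w ∈ Vᗮ, ∀ a, ρ a w = 0 := fun w hw a => by
    refine ext_inner_left ℂ fun z => ?_
    rw [inner_zero_right, ← ContinuousLinearMap.adjoint_inner_left,
      ← ContinuousLinearMap.star_eq_adjoint, ← map_star]
    exact hw _ (subset_closedSpan ⟨star a, z, rfl⟩)
  rw [← V.starProjection_add_starProjection_orthogonal v]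
  refine add _ _ ?_ (ker _ (hker _ (Submodule.starProjection_apply_mem _ _)))
  refine closedSpan_induction closed ?_ (ker 0 fun a => map_zero _) add smul
    (Submodule.starProjection_apply_mem V v)
  rintro _ ⟨a, w, rfl⟩
  exact mem a w

/-- Uniform boundedness makes being Cauchy stable under limits in v, and K is complete. -/
theorem isClosed_setOf_exists_tendsto {ι : Type*} {l : Filter ι} [l.NeBot] (T : ι → K →L[ℂ] K)
    {C : ℝ} (hT : ∀ᶠ i in l, ‖T i‖ ≤ C) : IsClosed {v | ∃ z, Tendsto (fun i => T i v) l (𝓝 z)} := by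
  refine isClosed_of_closure_subset fun v hv => ?_
  refine cauchy_map_iff_exists_tendsto.1 (Metric.cauchy_iff.2 ⟨inferInstance, fun ε hε => ?_⟩)
  have hC : 0 ≤ C := (norm_nonneg _).trans (hT.exists.choose_spec)
  obtain ⟨w, ⟨z, hz⟩, hd⟩ := Metric.mem_closure_iff.1 hv (ε / 4 / (C + 1)) (by positivity)
  refine ⟨(fun i => T i v) '' {i | ‖T i‖ ≤ C ∧ dist (T i w) z < ε / 4},
    image_mem_map (hT.and (hz.eventually (Metric.ball_mem_nhds z (by positivity)))), ?_⟩
  have hclose : ∀ i, ‖T i‖ ≤ C → dist (T i w) z < ε / 4 → dist (T i v) z < ε / 2 := by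
    intro i h1 h2
    have h3 : dist (T i v) (T i w) ≤ C * dist v w := by
      rw [dist_eq_norm, dist_eq_norm, ← map_sub]
      exact ((T i).le_opNorm _).trans (mul_le_mul_of_nonneg_right h1 (norm_nonneg _))
    have h4 : C * dist v w ≤ (C + 1) * (ε / 4 / (C + 1)) :=
      mul_le_mul (by linarith) hd.le dist_nonneg (by linarith)
    rw [mul_div_cancel₀ _ (by positivity : C + 1 ≠ 0)] at h4
    linarith [dist_triangle (T i v) (T i w) z]
  rintro _ ⟨i, ⟨h1, h2⟩, rfl⟩ _ ⟨j, ⟨h3, h4⟩, rfl⟩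
  have h5 := hclose i h1 h2
  have h6 := hclose j h3 h4
  rw [dist_comm] at h6
  linarith [dist_triangle (T i v) z (T j v)]

/-- `R` extends `ρ` to the multiplier `m`, vanishing off the essential subspace. -/
def IsMultRep (m : 𝓜(ℂ, A)) (R : K →L[ℂ] K) : Prop :=
  (∀ a, R ∘L ρ a = ρ (m.fst a)) ∧ ∀ v, (∀ a, ρ a v = 0) → R v = 0

variable {ρ}

theorem IsMultRep.eq {m : 𝓜(ℂ, A)} {R R' : K →L[ℂ] K} (h : IsMultRep ρ m R)
    (h' : IsMultRep ρ m R') : R = R' := by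
  refine ContinuousLinearMap.ext fun v => ?_
  refine ρ.induction_on_space (p := fun v => R v = R' v)
    (isClosed_eq R.continuous R'.continuous) (fun a v => ?_) (fun v hv => ?_)
    (fun v w h1 h2 => by rw [map_add, map_add, h1, h2])
    (fun r v h1 => by rw [map_smul, map_smul, h1]) v
  · exact congrArg (fun T => T v) ((h.1 a).trans (h'.1 a).symm)
  · rw [h.2 v hv, h'.2 v hv]

variable (ρ) in
-- The extension is the strong limit of ρ(m w) along an approximate unit w: on ρ(a)v it equals the
-- limit of ρ(m(wa))v, namely ρ(ma)v, and it is 0 on vectors killed by ρ.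
theorem exists_isMultRep (m : 𝓜(ℂ, A)) : ∃ R, IsMultRep ρ m R := by
  obtain ⟨l, hl, hl1, hl2, -⟩ := exists_approximateUnit A
  have hbd : ∀ᶠ w in l, ‖ρ (m.fst w)‖ ≤ ‖m.fst‖ := hl1.mono fun w hw =>
    (NonUnitalStarAlgHom.norm_apply_le ρ _).trans ((m.fst.le_opNorm w).trans
      ((mul_le_mul_of_nonneg_left hw (norm_nonneg _)).trans_eq (mul_one _)))
  have hmem : ∀ a v, Tendsto (fun w => ρ (m.fst w) (ρ a v)) l (𝓝 (ρ (m.fst a) v)) := fun a v => by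
    have h1 : ∀ w, ρ (m.fst w) (ρ a v) = ρ (m.fst (w * a)) v := fun w => by
      rw [DoubleCentralizer.fst_mul, map_mul]
      rfl
    simp only [h1]
    exact (((ContinuousLinearMap.apply ℂ K v) ∘L ρ.toCLM ∘L m.fst).continuous.tendsto a).comp
      (hl2 a)
  have hker : ∀ v, (∀ a, ρ a v = 0) → Tendsto (fun w => ρ (m.fst w) v) l (𝓝 0) := fun v hv => by
    simp only [hv]
    exact tendsto_const_nhds
  have hex : ∀ v, ∃ z, Tendsto (fun w => ρ (m.fst w) v) l (𝓝 z) := by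
    refine ρ.induction_on_space (isClosed_setOf_exists_tendsto _ hbd)
      (fun a v => ⟨_, hmem a v⟩) (fun v hv => ⟨0, hker v hv⟩) ?_ ?_
    · rintro v w ⟨z, hz⟩ ⟨z', hz'⟩
      exact ⟨z + z', by simpa only [map_add] using hz.add hz'⟩
    · rintro r v ⟨z, hz⟩
      exact ⟨r • z, by simpa only [map_smul] using hz.const_smul r⟩
  choose R hR using hex
  let R' : K →L[ℂ] K := LinearMap.mkContinuous
    { toFun := R
      map_add' := fun v w => tendsto_nhds_unique (hR (v + w))
        (by simpa only [map_add] using (hR v).add (hR w))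
      map_smul' := fun r v => tendsto_nhds_unique (hR (r • v))
        (by simpa only [map_smul, RingHom.id_apply] using (hR v).const_smul r) } ‖m.fst‖
    fun v => le_of_tendsto (hR v).norm (hbd.mono fun w hw =>
      ((ρ (m.fst w)).le_opNorm v).trans (mul_le_mul_of_nonneg_right hw (norm_nonneg _)))
  exact ⟨R', fun a => ContinuousLinearMap.ext fun v => tendsto_nhds_unique (hR (ρ a v)) (hmem a v),
    fun v hv => tendsto_nhds_unique (hR v) (hker v hv)⟩

theorem IsMultRep.star {m : 𝓜(ℂ, A)} {R : K →L[ℂ] K} (h : IsMultRep ρ m R) :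
    IsMultRep ρ (star m) (star R) := by
  have key : ∀ a (v z : K), ⟪ρ a v, R z⟫_ℂ = ⟪ρ ((Star.star m).fst a) v, z⟫_ℂ := by
    intro a v z
    refine ρ.induction_on_space (p := fun z => ⟪ρ a v, R z⟫_ℂ = ⟪ρ ((Star.star m).fst a) v, z⟫_ℂ)
      (isClosed_eq (by fun_prop) (by fun_prop)) (fun b w => ?_) (fun w hw => ?_)
      (fun v w h1 h2 => by rw [map_add, inner_add_right, inner_add_right, h1, h2])
      (fun r v h1 => by rw [map_smul, inner_smul_right, inner_smul_right, h1]) z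
    · have h1 : R (ρ b w) = ρ (m.fst b) w := congrArg (fun T => T w) (h.1 b)
      rw [h1, ← ContinuousLinearMap.adjoint_inner_left, ← ContinuousLinearMap.adjoint_inner_left,
        ← ContinuousLinearMap.star_eq_adjoint, ← ContinuousLinearMap.star_eq_adjoint, ← map_star ρ,
        ← map_star ρ, ← mul_apply_eq_comp, ← mul_apply_eq_comp, ← map_mul, ← map_mul]
      have h2 : Star.star (m.fst b) * a = Star.star b * (Star.star m).fst a := by
        rw [DoubleCentralizer.star_fst, ← star_inj, star_mul, star_mul, star_star, star_star,
          star_star, m.central]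
      rw [h2]
    · rw [h.2 w hw, inner_zero_right, ← ContinuousLinearMap.adjoint_inner_right,
        ← ContinuousLinearMap.star_eq_adjoint, ← map_star, hw, inner_zero_right]
  constructor
  · intro a
    refine ContinuousLinearMap.ext fun v => ext_inner_right ℂ fun z => ?_
    rw [ContinuousLinearMap.comp_apply, ContinuousLinearMap.star_eq_adjoint,
      ContinuousLinearMap.adjoint_inner_left, key]
  · intro v hv
    refine ext_inner_right ℂ fun z => ?_
    rw [ContinuousLinearMap.star_eq_adjoint, ContinuousLinearMap.adjoint_inner_left,
      inner_zero_left]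
    refine ρ.induction_on_space (p := fun z => ⟪v, R z⟫_ℂ = 0)
      (isClosed_eq (by fun_prop) (by fun_prop)) (fun b w => ?_) (fun w hw => ?_)
      (fun v w h1 h2 => by rw [map_add, inner_add_right, h1, h2, add_zero])
      (fun r v h1 => by rw [map_smul, inner_smul_right, h1, mul_zero]) z
    · have h1 : R (ρ b w) = ρ (m.fst b) w := congrArg (fun T => T w) (h.1 b)
      rw [h1, ← ContinuousLinearMap.adjoint_inner_left,
        ← ContinuousLinearMap.star_eq_adjoint, ← map_star, hv, inner_zero_left]
    · rw [h.2 w hw, inner_zero_right]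

variable (ρ) in
/-- The extension of a representation to the multiplier algebra. -/
theorem exists_multRep : ∃ R : 𝓜(ℂ, A) →⋆ₙₐ[ℂ] (K →L[ℂ] K), ∀ m, IsMultRep ρ m (R m) := by
  choose R hR using exists_isMultRep ρ
  refine ⟨{ toFun := R, map_smul' := fun r m => (hR _).eq ⟨fun a => ?_, fun v hv => ?_⟩,
            map_zero' := (hR _).eq ⟨fun a => ?_, fun v hv => rfl⟩,
            map_add' := fun m m' => (hR _).eq ⟨fun a => ?_, fun v hv => ?_⟩,
            map_mul' := fun m m' => (hR _).eq ⟨fun a => ?_, fun v hv => ?_⟩,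
            map_star' := fun m => (hR _).eq (hR m).star }, hR⟩
  · rw [DoubleCentralizer.smul_fst, smul_apply, map_smul, ← (hR m).1 a]
    rfl
  · change r • R m v = 0
    rw [(hR m).2 v hv, smul_zero]
  · rw [DoubleCentralizer.zero_fst, zero_apply, map_zero]
    rfl
  · rw [DoubleCentralizer.add_fst, add_apply, map_add, ← (hR m).1 a, ← (hR m').1 a]
    rfl
  · change R m v + R m' v = 0
    rw [(hR m).2 v hv, (hR m').2 v hv, add_zero]
  · rw [DoubleCentralizer.mul_fst, mul_apply_eq_comp, ← (hR m).1, ← (hR m').1]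
    rfl
  · change R m (R m' v) = 0
    rw [(hR m').2 v hv, map_zero]

end MultiplierRep

/-! ### Homomorphisms into the multiplier algebra -/

section MultiplierHom

variable {A : Type*} [NonUnitalCStarAlgebra A]

/-- The extension of an automorphism to the multiplier algebra as a ⋆-homomorphism. -/
def multiplierHom (e : A ≃⋆ₐ[ℂ] A) : 𝓜(ℂ, A) →⋆ₙₐ[ℂ] 𝓜(ℂ, A) where
  toFun := multiplierMap e
  map_smul' r m := DoubleCentralizer.ext_fst fun a => map_smul e r _
  map_zero' := DoubleCentralizer.ext_fst fun a => map_zero e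
  map_add' m m' := DoubleCentralizer.ext_fst fun a => map_add e _ _
  map_mul' m m' := DoubleCentralizer.ext_fst fun a => by
    change e (m.fst (m'.fst (e.symm a))) = e (m.fst (e.symm (e (m'.fst (e.symm a)))))
    rw [e.symm_apply_apply]
  map_star' m := DoubleCentralizer.ext_fst fun a => by
    rw [DoubleCentralizer.star_fst]
    change e ((star m).fst (e.symm a)) = star (e (m.snd (e.symm (star a))))
    rw [DoubleCentralizer.star_fst, map_star e, map_star e.symm]

/-- A representation `Ψ` by multipliers of the faithful image `σ(A)` gives a ⋆-homomorphism
into `M(A)`. -/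
theorem exists_multiplierHom {C D : Type*} [NonUnitalCStarAlgebra C] [NonUnitalCStarAlgebra D]
    (σ : A →⋆ₙₐ[ℂ] D) (hσ : Function.Injective σ) (Ψ : C →⋆ₙₐ[ℂ] D)
    (h : ∀ f x, ∃ x', σ x' = Ψ f * σ x) :
    ∃ φ : C →⋆ₙₐ[ℂ] 𝓜(ℂ, A), ∀ f x, σ ((φ f).fst x) = Ψ f * σ x := by
  choose L hL using h
  -- Only left multiplication by Ψ(f) is assumed to preserve σ(A); the right action is obtained from
  -- it by taking adjoints.
  have hR : ∀ f x, σ (star (L (star f) (star x))) = σ x * Ψ f := fun f x => by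
    rw [map_star, hL, star_mul, map_star, map_star, star_star, star_star]
  have hnorm : ∀ x, ‖σ x‖ = ‖x‖ := (AddMonoidHomClass.isometry_iff_norm σ).1
    (NonUnitalStarAlgHom.isometry σ hσ)
  let fst : C → A →L[ℂ] A := fun f => LinearMap.mkContinuous
    { toFun := L f
      map_add' := fun x y => hσ (by rw [hL, map_add, map_add, hL, hL, mul_add])
      map_smul' := fun r x => hσ (by
        rw [hL, map_smul, RingHom.id_apply, map_smul, hL, mul_smul_comm]) } ‖Ψ f‖ fun x => by
        change ‖L f x‖ ≤ _
        rw [← hnorm, hL, ← hnorm x]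
        exact norm_mul_le _ _
  let snd : C → A →L[ℂ] A := fun f => LinearMap.mkContinuous
    { toFun := fun x => star (L (star f) (star x))
      map_add' := fun x y => hσ (by rw [hR, map_add, map_add, hR, hR, add_mul])
      map_smul' := fun r x => hσ (by
        rw [hR, map_smul, RingHom.id_apply, map_smul, hR, smul_mul_assoc]) } ‖Ψ f‖ fun x => by
        change ‖star (L (star f) (star x))‖ ≤ _
        rw [← hnorm, hR, ← hnorm x, mul_comm]
        exact norm_mul_le _ _
  let φ : C → 𝓜(ℂ, A) := fun f =>
    { fst := fst f
      snd := snd f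
      central := fun x y => hσ (by
        change σ (star (L (star f) (star x)) * y) = σ (x * L f y)
        rw [map_mul, map_mul, hR, hL, mul_assoc]) }
  have hφ : ∀ f x, σ ((φ f).fst x) = Ψ f * σ x := hL
  refine ⟨{ toFun := φ, map_smul' := fun r f => DoubleCentralizer.ext_fst fun x => hσ ?_,
            map_zero' := DoubleCentralizer.ext_fst fun x => hσ ?_,
            map_add' := fun f f' => DoubleCentralizer.ext_fst fun x => hσ ?_,
            map_mul' := fun f f' => DoubleCentralizer.ext_fst fun x => hσ ?_,
            map_star' := fun f => DoubleCentralizer.ext_fst fun x => hσ ?_ }, hφ⟩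
  · rw [hφ, map_smul, DoubleCentralizer.smul_fst]
    change _ = σ (r • (φ f).fst x)
    rw [map_smul, hφ, smul_mul_assoc]
  · rw [hφ, map_zero, zero_mul, DoubleCentralizer.zero_fst, zero_apply, map_zero]
  · rw [hφ, map_add, DoubleCentralizer.add_fst, add_apply, map_add, hφ, hφ, add_mul]
  · rw [hφ, map_mul, DoubleCentralizer.mul_fst, mul_apply_eq_comp, hφ, hφ, mul_assoc]
  · rw [hφ, DoubleCentralizer.star_fst]
    change _ = σ (star (star (L (star f) (star (star x)))))
    rw [star_star, star_star, hL]

end MultiplierHom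

/-! ### The stable model of A on L²(Y, K) -/

section RegularModel

open scoped InnerProductSpace
open ContinuousLinearMap (adjoint)

variable {Y : Type*} [MeasurableSpace Y] {ν : Measure Y}
  {H E : Type*} [NormedAddCommGroup H] [InnerProductSpace ℂ H] [CompleteSpace H]
  [NormedAddCommGroup E] [InnerProductSpace ℂ E] [CompleteSpace E]
  (S : H ≃ₗᵢ[ℂ] Lp H 2 ν)

/-- The vector of `H` corresponding to `ξ(·) h` in `L²(Y, H) ≅ H`. -/
def modelVec (ξ : Lp ℂ 2 ν) (h : H) : H :=
  S.symm ((ContinuousLinearMap.toSpanSingleton ℂ h).compLp ξ)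

theorem apply_modelVec (ξ : Lp ℂ 2 ν) (h : H) :
    S (modelVec S ξ h) = (ContinuousLinearMap.toSpanSingleton ℂ h).compLp ξ :=
  S.apply_symm_apply _

theorem mem_closedSpan_modelVec (x : H) : x ∈ closedSpan {y | ∃ ξ h, y = modelVec S ξ h} := by
  rw [← S.symm_apply_apply x]
  refine Lp.induction (by simp) (fun u => S.symm u ∈ closedSpan {y | ∃ ξ h, y = modelVec S ξ h})
    ?_ ?_ ?_ (S x)
  · intro c s hs hμs
    rw [Lp.simpleFunc.coe_indicatorConst, ← toSpanSingleton_compLp_indicatorConstLp]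
    exact subset_closedSpan ⟨_, c, rfl⟩
  · intro f g hf hg _ h1 h2
    rw [map_add]
    exact Submodule.add_mem _ h1 h2
  · exact (isClosed_closedSpan _).preimage S.symm.continuous

/-- `H ⊗ E` embeds into `L²(Y, H ⊗ E)` by means of `H ≅ L²(Y, H)`. -/
theorem exists_amplification (E : Type*) [NormedAddCommGroup E] [InnerProductSpace ℂ E]
    [CompleteSpace E] : ∃ U : HilbertTensor H E →ₗᵢ[ℂ] Lp (HilbertTensor H E) 2 ν,
      ∀ ξ h, U.toContinuousLinearMap ∘L create (modelVec S ξ h) =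
        scalarColumn ν (HilbertTensor H E) ξ ∘L create h := by
  let B := (create (H := H) (E := E)).flip.compLpL₂ 2 ν
  obtain ⟨U, hU⟩ := HilbertTensor.exists_lift (LinearMap.mk₂ ℂ (fun h v => B v (S h))
    (by simp) (by simp) (by simp) (by simp)) (fun h v h' v' => by
      change ⟪(create.flip v).compLp (S h), (create.flip v').compLp (S h')⟫_ℂ = _
      rw [← S.inner_map_map h h', L2.inner_def, L2.inner_def, ← integral_mul_const]
      refine integral_congr_ae ?_
      filter_upwards [(create.flip v).coeFn_compLp (S h), (create.flip v').coeFn_compLp (S h')]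
        with y h1 h2
      rw [h1, h2]
      exact inner_create _ _ _ _)
  refine ⟨U, fun ξ h => ContinuousLinearMap.ext fun v => Lp.ext ?_⟩
  have h0 : U (create (modelVec S ξ h) v) = (create.flip v).compLp
      ((ContinuousLinearMap.toSpanSingleton ℂ h).compLp ξ) := by
    rw [hU, ← apply_modelVec S]
    rfl
  filter_upwards [(create.flip v).coeFn_compLp ((ContinuousLinearMap.toSpanSingleton ℂ h).compLp ξ),
    (ContinuousLinearMap.toSpanSingleton ℂ h).coeFn_compLp ξ,
    coeFn_scalarColumn ξ (create h v)] with y h1 h2 h3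
  refine Eq.trans ?_ h3.symm
  change (U (create (modelVec S ξ h) v)) y = _
  rw [h0, h1, h2]
  simp

variable {A : Type*} [NonUnitalCStarAlgebra A]

/-- The operators `C_ξ ρ(a) C_η⋆` with `a ∈ J`. -/
def sandwiches (ν : Measure Y) {K : Type*} [NormedAddCommGroup K] [InnerProductSpace ℂ K]
    [CompleteSpace K] (ρ : A →⋆ₙₐ[ℂ] (K →L[ℂ] K)) (J : ClosedIdeal A) :
    Set (Lp K 2 ν →L[ℂ] Lp K 2 ν) :=
  {T | ∃ ξ, ∃ a ∈ J.1, ∃ η, T = scalarColumn ν K ξ ∘L ρ a ∘L adjoint (scalarColumn ν K η)}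

/-- A faithful representation `σ` of `A` on `L²(Y, K)` for which `σ(J)` is `𝓚(L²(Y)) ⊗ ρ(J)`, for
all closed ideals `J`. -/
structure IsStableModel (ν : Measure Y) {K : Type*} [NormedAddCommGroup K]
    [InnerProductSpace ℂ K] [CompleteSpace K] (ρ : A →⋆ₙₐ[ℂ] (K →L[ℂ] K))
    (σ : A →⋆ₙₐ[ℂ] (Lp K 2 ν →L[ℂ] Lp K 2 ν)) : Prop where
  injective_coeff : Function.Injective ρ
  injective : Function.Injective σ
  exists_sandwich : ∀ (J : ClosedIdeal A), ∀ a ∈ J.1, ∀ ξ η, ∃ x ∈ J.1,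
    σ x = scalarColumn ν K ξ ∘L ρ a ∘L adjoint (scalarColumn ν K η)
  apply_mem : ∀ (J : ClosedIdeal A), ∀ x ∈ J.1, σ x ∈ closedSpan (sandwiches ν ρ J)

variable {π : A →⋆ₙₐ[ℂ] (E →L[ℂ] E)}
  {ρ : A →⋆ₙₐ[ℂ] (HilbertTensor H E →L[ℂ] HilbertTensor H E)}

/-- Conjugation by an isometry, as a ⋆-homomorphism. -/
def conjHom {K L : Type*} [NormedAddCommGroup K] [InnerProductSpace ℂ K] [CompleteSpace K]
    [NormedAddCommGroup L] [InnerProductSpace ℂ L] [CompleteSpace L] (U : K →ₗᵢ[ℂ] L)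
    (ρ : A →⋆ₙₐ[ℂ] (K →L[ℂ] K)) : A →⋆ₙₐ[ℂ] (L →L[ℂ] L) where
  toFun a := U.toContinuousLinearMap ∘L ρ a ∘L adjoint U.toContinuousLinearMap
  map_smul' r a := by
    rw [map_smul, ContinuousLinearMap.smul_comp, ContinuousLinearMap.comp_smul]
    rfl
  map_zero' := by
    rw [map_zero, ContinuousLinearMap.zero_comp, ContinuousLinearMap.comp_zero]
  map_add' a b := by
    rw [map_add, ContinuousLinearMap.add_comp, ContinuousLinearMap.comp_add]
  map_mul' a b := by
    have h : adjoint U.toContinuousLinearMap ∘L U.toContinuousLinearMap = 1 :=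
      (ContinuousLinearMap.norm_map_iff_adjoint_comp_self _).1 U.norm_map
    ext v
    have := congrArg (fun T => T (ρ b (adjoint U.toContinuousLinearMap v))) h
    simp only [ContinuousLinearMap.comp_apply, one_apply_eq_self] at this
    simp only [ContinuousLinearMap.comp_apply, mul_apply_eq_comp, map_mul, this]
  map_star' a := by
    rw [ContinuousLinearMap.star_eq_adjoint, ContinuousLinearMap.adjoint_comp,
      ContinuousLinearMap.adjoint_comp, ContinuousLinearMap.adjoint_adjoint, map_star,
      ContinuousLinearMap.star_eq_adjoint]
    rfl

theorem conjHom_injective {K L : Type*} [NormedAddCommGroup K] [InnerProductSpace ℂ K]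
    [CompleteSpace K] [NormedAddCommGroup L] [InnerProductSpace ℂ L] [CompleteSpace L]
    (U : K →ₗᵢ[ℂ] L) (ρ : A →⋆ₙₐ[ℂ] (K →L[ℂ] K)) (hρ : Function.Injective ρ) :
    Function.Injective (conjHom U ρ) := by
  have h : adjoint U.toContinuousLinearMap ∘L U.toContinuousLinearMap = 1 :=
    (ContinuousLinearMap.norm_map_iff_adjoint_comp_self _).1 U.norm_map
  intro a b hab
  refine hρ (ContinuousLinearMap.ext fun v => U.injective ?_)
  have h1 : adjoint U.toContinuousLinearMap (U.toContinuousLinearMap v) = v :=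
    congrArg (fun T => T v) h
  have h2 := congrArg (fun T => T (U.toContinuousLinearMap v)) hab
  change U (ρ a (adjoint U.toContinuousLinearMap (U.toContinuousLinearMap v))) =
    U (ρ b (adjoint U.toContinuousLinearMap (U.toContinuousLinearMap v))) at h2
  rwa [h1] at h2

variable {S} {U : HilbertTensor H E →ₗᵢ[ℂ] Lp (HilbertTensor H E) 2 ν}

/-- The isometry U turns |ξ ⊗ h⟩⟨η ⊗ h'| ⊗ π(b) into |ξ⟩⟨η| ⊗ (|h⟩⟨h'| ⊗ π(b)), so that a second
factor of compact operators splits off. -/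
theorem conj_elemOp (hU : ∀ ξ h, U.toContinuousLinearMap ∘L create (modelVec S ξ h) =
      scalarColumn ν (HilbertTensor H E) ξ ∘L create h) (ξ η : Lp ℂ 2 ν) (h h' : H) (b : A) :
    U.toContinuousLinearMap ∘L elemOp π (modelVec S ξ h) b (modelVec S η h') ∘L
        adjoint U.toContinuousLinearMap =
      scalarColumn ν (HilbertTensor H E) ξ ∘L elemOp π h b h' ∘L
        adjoint (scalarColumn ν (HilbertTensor H E) η) := by
  have h2 := congrArg adjoint (hU η h')
  rw [ContinuousLinearMap.adjoint_comp, ContinuousLinearMap.adjoint_comp] at h2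
  simp only [elemOp, ContinuousLinearMap.comp_assoc]
  rw [h2, ← ContinuousLinearMap.comp_assoc, hU]
  rfl

/-- Both ideal statements pass through elementary operators whose coefficients are slices of J. Such
a coefficient remains in J whichever vectors surround it, so vectors of H and of L²(Y, H) may be
exchanged freely. -/
theorem IsCompactRep.isStableModel (hρ : IsCompactRep π ρ)
    (hU : ∀ ξ h, U.toContinuousLinearMap ∘L create (modelVec S ξ h) =
      scalarColumn ν (HilbertTensor H E) ξ ∘L create h) :
    IsStableModel ν ρ (conjHom U ρ) where
  injective_coeff := hρ.injective
  injective := conjHom_injective U ρ hρ.injective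
  exists_sandwich J a ha ξ η := by
    have hcl := NonUnitalStarAlgHom.isClosed_map (conjHom U ρ)
      (conjHom_injective U ρ hρ.injective) J.isClosed_toSubmodule
    refine map_mem_of_mem_closedSpan hcl
      (compLeft (scalarColumn ν (HilbertTensor H E) ξ) ∘L
        compRight (adjoint (scalarColumn ν (HilbertTensor H E) η))) ?_
      (hρ.apply_mem_closedSpan_slices J ha)
    rintro _ ⟨h, b, h', rfl, hb⟩
    obtain ⟨x, hx, hxb⟩ := hb (modelVec S ξ h) (modelVec S η h')
    refine ⟨x, hx, ?_⟩
    refine Eq.trans ?_ (conj_elemOp hU ξ η h h' b)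
    rw [← hxb]
    rfl
  apply_mem J x hx := by
    refine map_mem_closedSpan (compLeft U.toContinuousLinearMap ∘L
      compRight (adjoint U.toContinuousLinearMap)) ?_ (hρ.apply_mem_closedSpan_slices J hx)
    rintro _ ⟨h, b, h', rfl, hb⟩
    change U.toContinuousLinearMap ∘L elemOp π h b h' ∘L adjoint U.toContinuousLinearMap ∈ _
    -- The dependence on h' is conjugate-linear, so the reduction to model vectors is done by
    -- induction here; the variable h is then handled by a linear map.
    refine closedSpan_induction (p := fun h' => U.toContinuousLinearMap ∘L elemOp π h b h' ∘L
      adjoint U.toContinuousLinearMap ∈ closedSpan (sandwiches ν ρ J)) ?_ ?_ ?_ ?_ ?_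
      (mem_closedSpan_modelVec S h')
    · refine (isClosed_closedSpan _).preimage ?_
      have hc : Continuous fun h' : H => adjoint (create (E := E) h') :=
        (LinearIsometryEquiv.continuous _).comp create.continuous
      exact ((compLeft U.toContinuousLinearMap ∘L compRight (adjoint U.toContinuousLinearMap) ∘L
        compLeft (create h) ∘L compLeft (π b)).continuous).comp hc
    · rintro _ ⟨η, h', rfl⟩
      refine map_mem_closedSpan ((compLeft U.toContinuousLinearMap ∘L
        compRight (π b ∘L adjoint (create (modelVec S η h')) ∘L
          adjoint U.toContinuousLinearMap)) ∘L create) ?_ (mem_closedSpan_modelVec S h)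
      rintro _ ⟨ξ, h, rfl⟩
      obtain ⟨y, hy, hyb⟩ := hb h h'
      exact subset_closedSpan ⟨ξ, y, hy, η, by rw [hyb]; exact conj_elemOp hU ξ η h h' b⟩
    · simp [elemOp]
    · intro h₁ h₂ h3 h4
      have := Submodule.add_mem _ h3 h4
      simpa [elemOp, ContinuousLinearMap.comp_add, ContinuousLinearMap.add_comp] using this
    · intro r h₁ h3
      have := Submodule.smul_mem _ (star r) h3
      simpa [elemOp, ContinuousLinearMap.comp_smul, ContinuousLinearMap.smul_comp,
        map_smulₛₗ] using this

end RegularModel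

/-! ### Equivariance of the stable model -/

section Equivariance

open scoped InnerProductSpace
open ContinuousLinearMap (adjoint)

variable {G : Type u} [Group G] [TopologicalSpace G] [IsTopologicalGroup G]
  [LocallyCompactSpace G] [SecondCountableTopology G] [MeasurableSpace G] [BorelSpace G]
  (μ : Measure G) [μ.IsHaarMeasure] {A : Type*} [NonUnitalCStarAlgebra A]

/-- Equivariance of the model: `α` on `A ≅ 𝓚(L²(G × ℕ)) ⊗ ρ(A)` acts as translation tensor `β`. -/
def IsEquivariantModel {K : Type*} [NormedAddCommGroup K]
    [InnerProductSpace ℂ K] [CompleteSpace K] (ρ : A →⋆ₙₐ[ℂ] (K →L[ℂ] K))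
    (σ : A →⋆ₙₐ[ℂ] (Lp K 2 (haarNat μ) →L[ℂ] Lp K 2 (haarNat μ))) (α β : CStarAction G A) : Prop :=
  ∀ (k : G) (u : Lp A 2 (haarNat μ)) (η : Lp ℂ 2 (haarNat μ)), ∃ x,
    σ x = column (haarNat μ) (ρ.toCLM.compLp u) ∘L adjoint (scalarColumn (haarNat μ) K η) ∧
    σ (α.aut k x) = column (haarNat μ) (ρ.toCLM.compLp
      ((β.aut k).toCLM.compLp (translateLp μ A k u))) ∘L
        adjoint (scalarColumn (haarNat μ) K (translateLp μ ℂ k η))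

variable {H E : Type*} [NormedAddCommGroup H] [InnerProductSpace ℂ H] [CompleteSpace H]
  [NormedAddCommGroup E] [InnerProductSpace ℂ E] [CompleteSpace E]
  {π : A →⋆ₙₐ[ℂ] (E →L[ℂ] E)}
  {ρ : A →⋆ₙₐ[ℂ] (HilbertTensor H E →L[ℂ] HilbertTensor H E)}
  {S : H ≃ₗᵢ[ℂ] Lp H 2 (haarNat μ)}
  {U : HilbertTensor H E →ₗᵢ[ℂ] Lp (HilbertTensor H E) 2 (haarNat μ)}

theorem translateLp_compLp {F F' : Type*} [NormedAddCommGroup F] [NormedSpace ℂ F]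
    [NormedAddCommGroup F'] [NormedSpace ℂ F'] (L : F →L[ℂ] F') (k : G)
    (u : Lp F 2 (haarNat μ)) : translateLp μ F' k (L.compLp u) = L.compLp (translateLp μ F k u) := by
  refine Lp.ext ?_
  filter_upwards [coeFn_translateLp μ k (L.compLp u), L.coeFn_compLp (translateLp μ F k u),
    coeFn_translateLp μ k u,
    (measurePreserving_translateFst μ k).quasiMeasurePreserving.ae (L.coeFn_compLp u)]
    with y h1 h2 h3 h4
  rw [h1, h2, h3, h4]

theorem apply_modelVec_translate {w : G → (H →L[ℂ] H)}
    (hS : ∀ k x, S (w k x) = translateLp μ H k (S x)) (k : G) (ξ : Lp ℂ 2 (haarNat μ)) (h : H) :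
    w k (modelVec S ξ h) = modelVec S (translateLp μ ℂ k ξ) h :=
  S.injective (by rw [hS, apply_modelVec, apply_modelVec, translateLp_compLp])

theorem toSpanSingleton_compLp_comp {Y : Type*} [MeasurableSpace Y] {ν : Measure Y}
    {F F' : Type*} [NormedAddCommGroup F] [NormedSpace ℂ F]
    [NormedAddCommGroup F'] [NormedSpace ℂ F'] (L : F →L[ℂ] F') (c : F) (ξ : Lp ℂ 2 ν) :
    L.compLp ((ContinuousLinearMap.toSpanSingleton ℂ c).compLp ξ) =
      (ContinuousLinearMap.toSpanSingleton ℂ (L c)).compLp ξ := by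
  refine Lp.ext ?_
  filter_upwards [L.coeFn_compLp ((ContinuousLinearMap.toSpanSingleton ℂ c).compLp ξ),
    (ContinuousLinearMap.toSpanSingleton ℂ c).coeFn_compLp ξ,
    (ContinuousLinearMap.toSpanSingleton ℂ (L c)).coeFn_compLp ξ] with y h1 h2 h3
  rw [h1, h2, h3]
  exact map_smul L _ _

/-- The conditions on x and α_k(x) are extended together by linearity and limits, first in the
coefficient and then in the function u. -/
theorem isEquivariantModel_of_forall {K : Type*} [NormedAddCommGroup K]
    [InnerProductSpace ℂ K] [CompleteSpace K] {ρ : A →⋆ₙₐ[ℂ] (K →L[ℂ] K)}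
    {σ : A →⋆ₙₐ[ℂ] (Lp K 2 (haarNat μ) →L[ℂ] Lp K 2 (haarNat μ))} (hσ : Function.Injective σ)
    {α β : CStarAction G A} (R : Set A) (hR : ∀ c, c ∈ closedSpan R)
    (h : ∀ (k : G) (ξ η : Lp ℂ 2 (haarNat μ)), ∀ c ∈ R, ∃ x,
      σ x = scalarColumn (haarNat μ) K ξ ∘L ρ c ∘L adjoint (scalarColumn (haarNat μ) K η) ∧
      σ (α.aut k x) = scalarColumn (haarNat μ) K (translateLp μ ℂ k ξ) ∘L ρ (β.aut k c) ∘L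
        adjoint (scalarColumn (haarNat μ) K (translateLp μ ℂ k η))) :
    IsEquivariantModel μ ρ σ α β := by
  intro k u η
  -- The same x has to satisfy both equations. The pair (σ, σ ∘ α_k) is an injective ⋆-homomorphism,
  -- so its range is closed and limits still come from a single x.
  let σ₂ : A →⋆ₙₐ[ℂ] (_ × _) := σ.prod (σ.comp (α.aut k : A →⋆ₙₐ[ℂ] A))
  have hcl := NonUnitalStarAlgHom.isClosed_map σ₂ (fun a b hab => hσ (congrArg Prod.fst hab))
    (W := ⊤) isClosed_univ
  set C := scalarColumn (haarNat μ) K with hC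
  let T₁ : Lp A 2 (haarNat μ) →L[ℂ] _ :=
    compRight (adjoint (C η)) ∘L column (haarNat μ) ∘L ρ.toCLM.compLpL 2 (haarNat μ)
  let T₂ : Lp A 2 (haarNat μ) →L[ℂ] _ :=
    compRight (adjoint (C (translateLp μ ℂ k η))) ∘L column (haarNat μ) ∘L
      ρ.toCLM.compLpL 2 (haarNat μ) ∘L (β.aut k).toCLM.compLpL 2 (haarNat μ) ∘L
      (translateLp μ A k).toContinuousLinearMap
  suffices h : ∀ u, (T₁ u, T₂ u) ∈ (⊤ : Submodule ℂ A).map σ₂.toCLM.toLinearMap by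
    obtain ⟨x, -, hx⟩ := h u
    exact ⟨x, congrArg Prod.fst hx, congrArg Prod.snd hx⟩
  have hone : ∀ (ξ : Lp ℂ 2 (haarNat μ)) (c : A),
      (C ξ ∘L ρ c ∘L adjoint (C η), C (translateLp μ ℂ k ξ) ∘L ρ (β.aut k c) ∘L
        adjoint (C (translateLp μ ℂ k η))) ∈ (⊤ : Submodule ℂ A).map σ₂.toCLM.toLinearMap := by
    intro ξ c
    refine map_mem_of_mem_closedSpan hcl
      ((compLeft (C ξ) ∘L compRight (adjoint (C η)) ∘L ρ.toCLM).prod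
        (compLeft (C (translateLp μ ℂ k ξ)) ∘L compRight (adjoint (C (translateLp μ ℂ k η))) ∘L
          ρ.toCLM ∘L (β.aut k).toCLM)) ?_ (hR c)
    intro c hc
    obtain ⟨x, h1, h2⟩ := h k ξ η c hc
    exact ⟨x, trivial, Prod.ext h1 h2⟩
  have h1 : ∀ ξ c, C ξ ∘L ρ c = column (haarNat μ) (ρ.toCLM.compLp
      ((ContinuousLinearMap.toSpanSingleton ℂ c).compLp ξ)) :=
    fun ξ c => scalarColumn_comp_eq_column ρ.toCLM ξ c
  have hT₁ : ∀ (ξ : Lp ℂ 2 (haarNat μ)) (c : A),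
      T₁ ((ContinuousLinearMap.toSpanSingleton ℂ c).compLp ξ) = C ξ ∘L ρ c ∘L adjoint (C η) := by
    intro ξ c
    rw [← ContinuousLinearMap.comp_assoc, h1]
    rfl
  have hT₂ : ∀ (ξ : Lp ℂ 2 (haarNat μ)) (c : A),
      T₂ ((ContinuousLinearMap.toSpanSingleton ℂ c).compLp ξ) = C (translateLp μ ℂ k ξ) ∘L
        ρ (β.aut k c) ∘L adjoint (C (translateLp μ ℂ k η)) := by
    intro ξ c
    have h2 : (β.aut k).toCLM.compLp (translateLp μ A k
        ((ContinuousLinearMap.toSpanSingleton ℂ c).compLp ξ)) =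
        (ContinuousLinearMap.toSpanSingleton ℂ (β.aut k c)).compLp (translateLp μ ℂ k ξ) := by
      rw [translateLp_compLp, toSpanSingleton_compLp_comp]
      rfl
    rw [← ContinuousLinearMap.comp_assoc, h1, ← h2]
    rfl
  refine Lp.induction (by simp) _ ?_ ?_ ?_
  · intro c s hs hμs
    rw [Lp.simpleFunc.coe_indicatorConst, ← toSpanSingleton_compLp_indicatorConstLp, hT₁, hT₂]
    exact hone _ c
  · intro f g hf hg _ h1 h2
    have := Submodule.add_mem _ h1 h2
    rwa [Prod.mk_add_mk, ← map_add, ← map_add] at this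
  · exact hcl.preimage (T₁.continuous.prodMk T₂.continuous)

theorem IsCompactRep.isEquivariantModel (hρ : IsCompactRep π ρ)
    (hU : ∀ ξ h, U.toContinuousLinearMap ∘L create (modelVec S ξ h) =
      scalarColumn (haarNat μ) (HilbertTensor H E) ξ ∘L create h)
    {w : G → (H →L[ℂ] H)} (hS : ∀ k x, S (w k x) = translateLp μ H k (S x))
    {α β : CStarAction G A} (hα : IsAdTwisted π ρ w α) (hβ : IsUntwisted π ρ α β) :
    IsEquivariantModel μ ρ (conjHom U ρ) α β := by
  refine isEquivariantModel_of_forall μ (conjHom_injective U ρ hρ.injective) _ hρ.mem_closedSpan ?_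
  rintro k ξ η c ⟨h, b, h', hc⟩
  obtain ⟨x, hx⟩ := hρ.exists_elemOp (modelVec S ξ h) b (modelVec S η h')
  refine ⟨x, ?_, ?_⟩
  · change U.toContinuousLinearMap ∘L ρ x ∘L adjoint U.toContinuousLinearMap = _
    rw [hx, hc, conj_elemOp hU]
  · change U.toContinuousLinearMap ∘L ρ (α.aut k x) ∘L adjoint U.toContinuousLinearMap = _
    rw [hα k x _ _ _ hx, hβ k c _ _ _ hc, apply_modelVec_translate μ hS,
      apply_modelVec_translate μ hS, conj_elemOp hU]

end Equivariance

/-! ### Square integrability and dominated convergence -/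

section SmulLp

open Filter Topology

variable {Y : Type*} [MeasurableSpace Y] [TopologicalSpace Y] [BorelSpace Y]
  [SecondCountableTopology Y] {ν : Measure Y} {F : Type*} [NormedAddCommGroup F] [NormedSpace ℂ F]

theorem memLp_smul_of_bounded (ξ : Lp ℂ 2 ν) {v : Y → F} (hv : Continuous v) {C : ℝ}
    (hC : ∀ y, ‖v y‖ ≤ C) : MemLp (fun y => ξ y • v y) 2 ν :=
  MemLp.of_le_mul (c := C) (Lp.memLp ξ)
    ((Lp.aestronglyMeasurable ξ).smul hv.aestronglyMeasurable)
    (Eventually.of_forall fun y => by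
      rw [norm_smul, mul_comm]
      exact mul_le_mul_of_nonneg_right (hC y) (norm_nonneg _))

theorem tendsto_eLpNorm_two_of_dominated {f : ℕ → Y → F} (hf : ∀ n, AEStronglyMeasurable (f n) ν)
    {g : Y → ℝ} (hg : MemLp g 2 ν) (hfg : ∀ n, ∀ᵐ y ∂ν, ‖f n y‖ ≤ g y)
    (hlim : ∀ᵐ y ∂ν, Tendsto (fun n => f n y) atTop (𝓝 0)) :
    Tendsto (fun n => eLpNorm (f n) 2 ν) atTop (𝓝 0) := by
  have hmem : ∀ n, MemLp (f n) 2 ν := fun n => hg.mono (hf n) ((hfg n).mono fun y h =>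
    h.trans (le_abs_self _))
  have h1 : Tendsto (fun n => ∫ y, ‖f n y‖ ^ (2 : ℝ) ∂ν) atTop (𝓝 (∫ _, (0 : ℝ) ∂ν)) := by
    refine tendsto_integral_of_dominated_convergence (fun y => ‖g y‖ ^ 2)
      (fun n => ((hf n).norm.aemeasurable.pow_const _).aestronglyMeasurable)
      ((memLp_two_iff_integrable_sq_norm hg.1).1 hg) (fun n => ?_) ?_
    · filter_upwards [hfg n] with y hy
      rw [Real.rpow_two, norm_pow, norm_norm]
      exact pow_le_pow_left₀ (norm_nonneg _) (hy.trans (le_abs_self _)) 2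
    · filter_upwards [hlim] with y hy
      have := (hy.norm.pow 2)
      simpa using this
  rw [integral_zero] at h1
  have h2 : ∀ n, eLpNorm (f n) 2 ν =
      ENNReal.ofReal ((∫ y, ‖f n y‖ ^ (2 : ℝ) ∂ν) ^ (2 : ℝ)⁻¹) := fun n => by
    have := (hmem n).eLpNorm_eq_integral_rpow_norm (by simp) (by simp)
    simpa using this
  simp only [h2]
  have h3 := (h1.rpow_const (p := (2 : ℝ)⁻¹) (Or.inr (by norm_num)))
  rw [Real.zero_rpow (by norm_num)] at h3
  simpa using ENNReal.tendsto_ofReal h3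

end SmulLp

/-! ### Fields of multipliers acting on the model -/

section Model

open scoped InnerProductSpace
open ContinuousLinearMap (adjoint)
open Filter Topology

variable {Y : Type*} [MeasurableSpace Y] [TopologicalSpace Y] [BorelSpace Y]
  [SecondCountableTopology Y] [TopologicalSpace.MetrizableSpace Y] {ν : Measure Y}
  {A : Type*} [NonUnitalCStarAlgebra A]
  {K : Type*} [NormedAddCommGroup K] [InnerProductSpace ℂ K] [CompleteSpace K]
  {ρ : A →⋆ₙₐ[ℂ] (K →L[ℂ] K)} {σ : A →⋆ₙₐ[ℂ] (Lp K 2 ν →L[ℂ] Lp K 2 ν)}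

/-- The largest ideal. -/
def ClosedIdeal.univ (A : Type*) [NonUnitalCStarAlgebra A] : ClosedIdeal A :=
  ClosedIdeal.ofSet Set.univ isClosed_univ trivial (fun _ _ => trivial)
    (fun _ => trivial) (fun _ => trivial) (fun _ => trivial)

theorem ClosedIdeal.mem_univ (a : A) : a ∈ (ClosedIdeal.univ A).1 := ClosedIdeal.mem_ofSet.2 trivial

theorem scalarColumn_cancel {w : Lp ℂ 2 ν} (hw : ‖w‖ = 1) :
    adjoint (scalarColumn ν K w) ∘L scalarColumn ν K w = 1 := by
  rw [adjoint_scalarColumn_comp, inner_self_eq_norm_sq_to_K, hw]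
  simp

theorem norm_adjoint_scalarColumn_le (w : Lp ℂ 2 ν) : ‖adjoint (scalarColumn ν K w)‖ ≤ ‖w‖ := by
  rw [LinearIsometryEquiv.norm_map]
  exact norm_scalarColumn_le w

theorem norm_column_compLp_le (u : Lp A 2 ν) : ‖column ν (ρ.toCLM.compLp u)‖ ≤ ‖u‖ :=
  (norm_column_le _).trans (Lp.norm_le_norm_of_ae_le (by
    filter_upwards [ρ.toCLM.coeFn_compLp u] with y hy
    rw [hy]
    exact NonUnitalStarAlgHom.norm_apply_le ρ _))

/-- A strongly continuous field of ⋆-homomorphisms into the multiplier algebra. -/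
def IsStronglyContinuous (m : Y → (A →⋆ₙₐ[ℂ] 𝓜(ℂ, A))) : Prop :=
  ∀ f a, Continuous fun y => (m y f).fst a

theorem norm_fst_apply_le (φ : A →⋆ₙₐ[ℂ] 𝓜(ℂ, A)) (f a : A) : ‖(φ f).fst a‖ ≤ ‖f‖ * ‖a‖ := by
  refine ((φ f).fst.le_opNorm a).trans (mul_le_mul_of_nonneg_right ?_ (norm_nonneg _))
  rw [DoubleCentralizer.norm_fst]
  exact NonUnitalStarAlgHom.norm_apply_le φ f

/-- `Ψ(f)` multiplies by the field `m`. -/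
def IsFieldRep (ν : Measure Y) (ρ : A →⋆ₙₐ[ℂ] (K →L[ℂ] K)) (m : Y → (A →⋆ₙₐ[ℂ] 𝓜(ℂ, A)))
    (Ψ : A →⋆ₙₐ[ℂ] (Lp K 2 ν →L[ℂ] Lp K 2 ν)) : Prop :=
  ∀ f (u u' : Lp A 2 ν), (∀ᵐ y ∂ν, u' y = (m y f).fst (u y)) →
    Ψ f ∘L column ν (ρ.toCLM.compLp u) = column ν (ρ.toCLM.compLp u')

/-- Extend ρ to M(A), apply it to the field and integrate. Strong continuity on K is clear on ρ(A)K
and on the killed vectors, and the bound ‖f‖ extends it to limits. -/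
theorem exists_isFieldRep {m : Y → (A →⋆ₙₐ[ℂ] 𝓜(ℂ, A))} (hm : IsStronglyContinuous m) :
    ∃ Ψ, IsFieldRep ν ρ m Ψ := by
  obtain ⟨R, hR⟩ := exists_multRep ρ
  obtain ⟨Ψ, hΨ⟩ := exists_mulRep (ν := ν) (fun y => R.comp (m y)) (fun f ζ => by
    change Continuous fun y => R (m y f) ζ
    refine ρ.induction_on_space (p := fun ζ => Continuous fun y => R (m y f) ζ) ?_ (fun a v => ?_)
      (fun v hv => ?_) (fun v w h1 h2 => ?_) (fun r v h1 => ?_) ζ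
    · refine isClosed_of_closure_subset fun v hv => ?_
      refine continuous_iff_continuousAt.2 fun y₀ => Metric.continuousAt_iff'.2 fun ε hε => ?_
      obtain ⟨w, hw, hd⟩ := Metric.mem_closure_iff.1 hv (ε / 3 / (‖f‖ + 1)) (by positivity)
      have hbd : ∀ y, dist (R (m y f) v) (R (m y f) w) < ε / 3 := fun y => by
        rw [dist_eq_norm, ← map_sub]
        refine ((R (m y f)).le_opNorm _).trans_lt ?_
        have h1 : ‖R (m y f)‖ ≤ ‖f‖ := NonUnitalStarAlgHom.norm_apply_le (R.comp (m y)) f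
        rw [← dist_eq_norm]
        have h2 : (‖f‖ + 1) * (ε / 3 / (‖f‖ + 1)) = ε / 3 := mul_div_cancel₀ _ (by positivity)
        have h3 : ‖R (m y f)‖ * dist v w ≤ (‖f‖ + 1) * dist v w :=
          mul_le_mul_of_nonneg_right (by linarith) dist_nonneg
        have h4 : (‖f‖ + 1) * dist v w < (‖f‖ + 1) * (ε / 3 / (‖f‖ + 1)) :=
          mul_lt_mul_of_pos_left hd (by positivity)
        linarith
      filter_upwards [Metric.continuousAt_iff'.1 (hw.continuousAt (x := y₀)) (ε / 3)
        (by positivity)] with y hy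
      have h1 := hbd y
      have h2 := hbd y₀
      rw [dist_comm] at h2
      have h3 := dist_triangle4 (R (m y f) v) (R (m y f) w) (R (m y₀ f) w) (R (m y₀ f) v)
      linarith
    · have h1 : ∀ y, R (m y f) (ρ a v) = ρ ((m y f).fst a) v := fun y =>
        congrArg (fun T => T v) ((hR (m y f)).1 a)
      simp only [h1]
      exact ((ContinuousLinearMap.apply ℂ K v) ∘L ρ.toCLM).continuous.comp (hm f a)
    · have h1 : ∀ y, R (m y f) v = 0 := fun y => (hR (m y f)).2 v hv
      simp only [h1]
      exact continuous_const
    · simp only [map_add]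
      exact h1.add h2
    · simp only [map_smul]
      exact h1.const_smul r)
  refine ⟨Ψ, fun f u u' hu => (hΨ f).comp_column ?_⟩
  filter_upwards [hu, ρ.toCLM.coeFn_compLp u, ρ.toCLM.coeFn_compLp u'] with y h1 h2 h3
  rw [h2, h3, h1]
  exact ((hR (m y f)).1 (u y)).symm

variable {m : Y → (A →⋆ₙₐ[ℂ] 𝓜(ℂ, A))} {Ψ : A →⋆ₙₐ[ℂ] (Lp K 2 ν →L[ℂ] Lp K 2 ν)}

theorem IsFieldRep.comp_scalarColumn (hΨ : IsFieldRep ν ρ m Ψ) (hm : IsStronglyContinuous m)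
    (f a : A) (ξ : Lp ℂ 2 ν) :
    Ψ f ∘L scalarColumn ν K ξ ∘L ρ a = column ν (ρ.toCLM.compLp
      ((memLp_smul_of_bounded ξ (hm f a) (fun y => norm_fst_apply_le (m y) f a)).toLp _)) := by
  have h := scalarColumn_comp_eq_column ρ.toCLM ξ a
  rw [NonUnitalStarAlgHom.toCLM_apply] at h
  rw [h]
  refine hΨ f _ _ ?_
  filter_upwards [MemLp.coeFn_toLp (memLp_smul_of_bounded ξ (hm f a)
    (fun y => norm_fst_apply_le (m y) f a)),
    (ContinuousLinearMap.toSpanSingleton ℂ a).coeFn_compLp ξ] with y h1 h2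
  rw [h1, h2]
  exact (map_smul (m y f).fst (ξ y) a).symm

/-- Taking u with values in the subspace J keeps all approximating simple functions inside J, so the
preimage found in the limit is in J too. -/
theorem IsStableModel.exists_column (hσ : IsStableModel ν ρ σ) (J : ClosedIdeal A)
    (u : Lp J.toSubmodule 2 ν) (η : Lp ℂ 2 ν) : ∃ x ∈ J.1,
      σ x = column ν (ρ.toCLM.compLp (J.toSubmodule.subtypeL.compLp u)) ∘L
        adjoint (scalarColumn ν K η) := by
  have hcl := NonUnitalStarAlgHom.isClosed_map σ hσ.injective J.isClosed_toSubmodule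
  have key : ∀ T ∈ {T | ∃ ξ a, T = scalarColumn ν K ξ ∘L (ρ.toCLM ∘L J.toSubmodule.subtypeL) a},
      compRight (adjoint (scalarColumn ν K η)) T ∈ J.toSubmodule.map σ.toCLM.toLinearMap := by
    rintro _ ⟨ξ, a, rfl⟩
    obtain ⟨x, hx, h⟩ := hσ.exists_sandwich J a a.2 ξ η
    exact ⟨x, hx, h⟩
  obtain ⟨x, hx, h⟩ := map_mem_of_mem_closedSpan hcl _ key
    (column_compLp_mem_closedSpan (ρ.toCLM ∘L J.toSubmodule.subtypeL) u)
  refine ⟨x, hx, Eq.trans h ?_⟩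
  change column ν _ ∘L _ = _
  congr 2
  refine Lp.ext ?_
  filter_upwards [(ρ.toCLM ∘L J.toSubmodule.subtypeL).coeFn_compLp u,
    J.toSubmodule.subtypeL.coeFn_compLp u,
    ρ.toCLM.coeFn_compLp (J.toSubmodule.subtypeL.compLp u)] with y h1 h2 h3
  rw [h1, h3, h2]
  rfl

/-- Multiplying C_ξ ρ(a) C_η⋆ by the field gives the column of the square integrable J-valued
function y ↦ ξ(y) m_y(f)a, followed by C_η⋆. -/
theorem IsStableModel.exists_mul_sandwich (hσ : IsStableModel ν ρ σ) (hΨ : IsFieldRep ν ρ m Ψ)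
    (hm : IsStronglyContinuous m) (J : ClosedIdeal A) {f a : A}
    (hJ : ∀ y, (m y f).fst a ∈ J.1) (ξ η : Lp ℂ 2 ν) : ∃ x ∈ J.1,
      σ x = Ψ f ∘L scalarColumn ν K ξ ∘L ρ a ∘L adjoint (scalarColumn ν K η) := by
  let v : Y → J.toSubmodule := fun y => ⟨(m y f).fst a, hJ y⟩
  have hv : Continuous v := (hm f a).subtype_mk _
  have hmem := memLp_smul_of_bounded ξ hv (C := ‖f‖ * ‖a‖) (fun y => norm_fst_apply_le (m y) f a)
  obtain ⟨x, hx, h⟩ := hσ.exists_column J (hmem.toLp _) η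
  refine ⟨x, hx, h.trans ?_⟩
  rw [← ContinuousLinearMap.comp_assoc, ← ContinuousLinearMap.comp_assoc,
    ContinuousLinearMap.comp_assoc (Ψ f), hΨ.comp_scalarColumn hm]
  congr 3

theorem IsStableModel.exists_mul_apply (hσ : IsStableModel ν ρ σ) (hΨ : IsFieldRep ν ρ m Ψ)
    (hm : IsStronglyContinuous m) (I J : ClosedIdeal A) {f : A}
    (hJ : ∀ y, ∀ a ∈ I.1, (m y f).fst a ∈ J.1) {x : A} (hx : x ∈ I.1) :
    ∃ x' ∈ J.1, σ x' = Ψ f * σ x := by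
  have hcl := NonUnitalStarAlgHom.isClosed_map σ hσ.injective J.isClosed_toSubmodule
  refine map_mem_of_mem_closedSpan hcl (compLeft (Ψ f)) ?_ (hσ.apply_mem I x hx)
  rintro _ ⟨ξ, a, ha, η, rfl⟩
  exact hσ.exists_mul_sandwich hΨ hm J (fun y => hJ y a ha) ξ η

theorem IsStableModel.exists_hom (hσ : IsStableModel ν ρ σ) (hΨ : IsFieldRep ν ρ m Ψ)
    (hm : IsStronglyContinuous m) :
    ∃ φ : A →⋆ₙₐ[ℂ] 𝓜(ℂ, A), ∀ f x, σ ((φ f).fst x) = Ψ f * σ x :=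
  exists_multiplierHom σ hσ.injective Ψ fun f x => by
    obtain ⟨x', -, h⟩ := hσ.exists_mul_apply hΨ hm (ClosedIdeal.univ A) (ClosedIdeal.univ A)
      (f := f) (fun _ _ _ => ClosedIdeal.mem_univ _) (ClosedIdeal.mem_univ x)
    exact ⟨x', h⟩

/-- Compressing `Ψ(f)` to a region where the field is nearly constant recovers its value. -/
theorem IsFieldRep.norm_compress_sub_le (hΨ : IsFieldRep ν ρ m Ψ) (hm : IsStronglyContinuous m)
    {f b c : A} {V : Set Y} {ε : ℝ} (hV : ∀ y ∈ V, ‖(m y f).fst b - c‖ ≤ ε) {w : Lp ℂ 2 ν}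
    (hw : ‖w‖ = 1) (hwV : ∀ᵐ y ∂ν, y ∉ V → w y = 0) :
    ‖adjoint (scalarColumn ν K w) ∘L Ψ f ∘L scalarColumn ν K w ∘L ρ b - ρ c‖ ≤ ε := by
  have hmem := memLp_smul_of_bounded w (hm f b) (fun y => norm_fst_apply_le (m y) f b)
  set u := hmem.toLp _
  set u' := (ContinuousLinearMap.toSpanSingleton ℂ c).compLp w with hu'
  -- A negative ε would make `V` empty and hence w zero.
  have hε : 0 ≤ ε := by
    by_contra hneg
    have hVe : ∀ y, y ∉ V := fun y hy => hneg ((norm_nonneg _).trans (hV y hy))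
    have : w = 0 := by
      refine Lp.ext ?_
      filter_upwards [hwV, Lp.coeFn_zero ℂ 2 ν] with y h1 h2
      rw [h1 (hVe y), h2]
      rfl
    rw [this, norm_zero] at hw
    exact zero_ne_one hw
  have h1 : ρ c = adjoint (scalarColumn ν K w) ∘L scalarColumn ν K w ∘L ρ c := by
    rw [← ContinuousLinearMap.comp_assoc, scalarColumn_cancel hw]
    rfl
  have h2 : scalarColumn ν K w ∘L ρ c = column ν (ρ.toCLM.compLp u') :=
    scalarColumn_comp_eq_column ρ.toCLM w c
  have h3 : column ν (ρ.toCLM.compLp u) - column ν (ρ.toCLM.compLp u') =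
      column ν (ρ.toCLM.compLp (u - u')) := by
    rw [← map_sub]
    congr 1
    exact ((ρ.toCLM.compLpL 2 ν).map_sub u u').symm
  rw [h1, hΨ.comp_scalarColumn hm, h2, ← ContinuousLinearMap.comp_sub, h3]
  have h4 : ‖u - u'‖ ≤ ε * ‖w‖ := by
    refine Lp.norm_le_mul_norm_of_ae_le_mul ?_
    filter_upwards [Lp.coeFn_sub u u', hmem.coeFn_toLp,
      (ContinuousLinearMap.toSpanSingleton ℂ c).coeFn_compLp w, hwV] with y h1 h2 h3 h4
    rw [h1, Pi.sub_apply, h2, hu', h3]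
    change ‖w y • (m y f).fst b - w y • c‖ ≤ _
    rw [← smul_sub, norm_smul, mul_comm]
    by_cases hy : y ∈ V
    · exact mul_le_mul_of_nonneg_right (hV y hy) (norm_nonneg _)
    · rw [h4 hy, norm_zero, mul_zero, mul_zero]
  rw [hw, mul_one] at h4
  refine (ContinuousLinearMap.opNorm_comp_le _ _).trans ?_
  calc _ ≤ 1 * ‖u - u'‖ := mul_le_mul ((norm_adjoint_scalarColumn_le w).trans_eq hw)
        (norm_column_compLp_le _) (ContinuousLinearMap.opNorm_nonneg _) zero_le_one
    _ ≤ ε := by rwa [one_mul]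

end Model

/-! ### Limits of uniformly bounded operators -/

section Limits

open Filter Topology

theorem isClosed_setOf_tendsto_zero {X Z : Type*} [NormedAddCommGroup X] [NormedSpace ℂ X]
    [NormedAddCommGroup Z] [NormedSpace ℂ Z] (F : ℕ → X →L[ℂ] Z) {C : ℝ} (hF : ∀ n, ‖F n‖ ≤ C) :
    IsClosed {x | Tendsto (fun n => F n x) atTop (𝓝 0)} := by
  have hC : 0 ≤ C := (norm_nonneg _).trans (hF 0)
  refine isClosed_of_closure_subset fun x hx => ?_
  refine Metric.tendsto_atTop.2 fun ε hε => ?_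
  obtain ⟨y, hy, hd⟩ := Metric.mem_closure_iff.1 hx (ε / 2 / (C + 1)) (by positivity)
  obtain ⟨N, hN⟩ := Metric.tendsto_atTop.1 hy (ε / 2) (by positivity)
  refine ⟨N, fun n hn => ?_⟩
  have h1 := hN n hn
  rw [dist_zero_right] at h1 ⊢
  have h2 : ‖F n (x - y)‖ ≤ (C + 1) * (ε / 2 / (C + 1)) := by
    refine ((F n).le_opNorm _).trans ?_
    rw [← dist_eq_norm]
    exact mul_le_mul ((hF n).trans (by linarith)) hd.le dist_nonneg (by linarith)
  rw [mul_div_cancel₀ _ (by positivity)] at h2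
  have h3 : F n x = F n (x - y) + F n y := by rw [map_sub, sub_add_cancel]
  rw [h3]
  refine (norm_add_le _ _).trans_lt ?_
  linarith

end Limits

/-! ### Recovering the field by compression -/

section Model

open scoped InnerProductSpace
open ContinuousLinearMap (adjoint)
open Filter Topology

variable {Y : Type*} [MeasurableSpace Y] [TopologicalSpace Y] [BorelSpace Y]
  [SecondCountableTopology Y] [TopologicalSpace.MetrizableSpace Y] {ν : Measure Y}
  {A : Type*} [NonUnitalCStarAlgebra A]
  {K : Type*} [NormedAddCommGroup K] [InnerProductSpace ℂ K] [CompleteSpace K]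
  {ρ : A →⋆ₙₐ[ℂ] (K →L[ℂ] K)} {σ : A →⋆ₙₐ[ℂ] (Lp K 2 ν →L[ℂ] Lp K 2 ν)}
  {m : Y → (A →⋆ₙₐ[ℂ] 𝓜(ℂ, A))} {Ψ : A →⋆ₙₐ[ℂ] (Lp K 2 ν →L[ℂ] Lp K 2 ν)}
  {φ : A →⋆ₙₐ[ℂ] 𝓜(ℂ, A)}

/-- Every nonempty open set supports a unit vector of `L²`. -/
def HasUnitBumps (ν : Measure Y) : Prop :=
  ∀ V : Set Y, IsOpen V → V.Nonempty → ∃ w : Lp ℂ 2 ν, ‖w‖ = 1 ∧ ∀ᵐ y ∂ν, y ∉ V → w y = 0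

theorem compress_sandwich (w ξ η : Lp ℂ 2 ν) (a : A) :
    adjoint (scalarColumn ν K w) ∘L (scalarColumn ν K ξ ∘L ρ a ∘L
      adjoint (scalarColumn ν K η)) ∘L scalarColumn ν K w = (⟪w, ξ⟫_ℂ * ⟪η, w⟫_ℂ) • ρ a := by
  have h : adjoint (scalarColumn ν K w) ∘L (scalarColumn ν K ξ ∘L ρ a ∘L
      adjoint (scalarColumn ν K η)) ∘L scalarColumn ν K w =
      (adjoint (scalarColumn ν K w) ∘L scalarColumn ν K ξ) ∘L ρ a ∘L
        (adjoint (scalarColumn ν K η) ∘L scalarColumn ν K w) := rfl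
  rw [h, adjoint_scalarColumn_comp, adjoint_scalarColumn_comp]
  refine ContinuousLinearMap.ext fun v => ?_
  change ⟪w, ξ⟫_ℂ • ρ a (⟪η, w⟫_ℂ • v) = (⟪w, ξ⟫_ℂ * ⟪η, w⟫_ℂ) • ρ a v
  rw [map_smul, smul_smul]

/-- Compressing |ξ⟩⟨η| ⊗ ρ(a) by w leaves a scalar multiple of ρ(a), so compression acts as a slice
map that respects ideals. -/
theorem IsStableModel.compress_mem (hσ : IsStableModel ν ρ σ) (J : ClosedIdeal A) (w : Lp ℂ 2 ν)
    {x : A} (hx : x ∈ J.1) : ∃ d ∈ J.1,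
      ρ d = adjoint (scalarColumn ν K w) ∘L σ x ∘L scalarColumn ν K w := by
  have hcl := NonUnitalStarAlgHom.isClosed_map ρ hσ.injective_coeff J.isClosed_toSubmodule
  refine map_mem_of_mem_closedSpan hcl (compLeft (adjoint (scalarColumn ν K w)) ∘L
    compRight (scalarColumn ν K w)) ?_ (hσ.apply_mem J x hx)
  rintro _ ⟨ξ, a, ha, η, rfl⟩
  refine ⟨(⟪w, ξ⟫_ℂ * ⟪η, w⟫_ℂ) • a, J.toSubmodule.smul_mem _ ha, ?_⟩
  refine Eq.trans (map_smul ρ _ a) (compress_sandwich w ξ η a).symm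

/-- For a unit vector w the choice σ(x) = C_w ρ(b) C_w⋆ satisfies σ(x) C_w = C_w ρ(b), so
compressing φ(f)x is compressing the field and applying it to b. -/
theorem IsStableModel.compress_fst (hσ : IsStableModel ν ρ σ)
    (hφ : ∀ f x, σ ((φ f).fst x) = Ψ f * σ x) (f b : A) {w : Lp ℂ 2 ν} (hw : ‖w‖ = 1) :
    ∃ x, adjoint (scalarColumn ν K w) ∘L σ ((φ f).fst x) ∘L scalarColumn ν K w =
      adjoint (scalarColumn ν K w) ∘L Ψ f ∘L scalarColumn ν K w ∘L ρ b ∧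
      σ x = scalarColumn ν K w ∘L ρ b ∘L adjoint (scalarColumn ν K w) := by
  obtain ⟨x, -, hx⟩ := hσ.exists_sandwich (ClosedIdeal.univ A) b (ClosedIdeal.mem_univ b) w w
  refine ⟨x, ?_, hx⟩
  rw [hφ, hx]
  change adjoint (scalarColumn ν K w) ∘L Ψ f ∘L scalarColumn ν K w ∘L ρ b ∘L
    (adjoint (scalarColumn ν K w) ∘L scalarColumn ν K w) = _
  rw [scalarColumn_cancel hw]
  rfl

/-- If `φ(f)` multiplies `A` into `J`, then so do all values of the field at `f`. -/
theorem IsFieldRep.fst_apply_mem (hΨ : IsFieldRep ν ρ m Ψ) (hm : IsStronglyContinuous m)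
    (hσ : IsStableModel ν ρ σ) (hν : HasUnitBumps ν) (hφ : ∀ f x, σ ((φ f).fst x) = Ψ f * σ x)
    (J : ClosedIdeal A) {f : A} (hJ : ∀ x, (φ f).fst x ∈ J.1) (y : Y) (b : A) :
    (m y f).fst b ∈ J.1 := by
  have hcl := NonUnitalStarAlgHom.isClosed_map ρ hσ.injective_coeff J.isClosed_toSubmodule
  suffices h : ρ ((m y f).fst b) ∈ J.toSubmodule.map ρ.toCLM.toLinearMap by
    obtain ⟨d, hd, h⟩ := h
    rw [← hσ.injective_coeff h]
    exact hd
  refine hcl.closure_subset (Metric.mem_closure_iff.2 fun ε hε => ?_)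
  have hV : IsOpen {z | ‖(m z f).fst b - (m y f).fst b‖ < ε / 2} :=
    isOpen_lt ((hm f b).sub continuous_const).norm continuous_const
  obtain ⟨w, hw, hwV⟩ := hν _ hV ⟨y, by simpa using hε⟩
  obtain ⟨x, hx, -⟩ := hσ.compress_fst hφ f b hw
  obtain ⟨d, hd, hdx⟩ := hσ.compress_mem J w (hJ x)
  refine ⟨ρ d, ⟨d, hd, rfl⟩, ?_⟩
  rw [dist_comm, dist_eq_norm, hdx, hx]
  exact (hΨ.norm_compress_sub_le hm (fun z hz => hz.le) hw hwV).trans_lt (by linarith)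

/-- An orthonormal sequence tends weakly to 0, by Bessel, so the compressions of |ξ⟩⟨η| ⊗ ρ(a) do
too in norm; uniform boundedness covers all of σ(A). -/
theorem IsStableModel.tendsto_compress (hσ : IsStableModel ν ρ σ) {w : ℕ → Lp ℂ 2 ν}
    (hw : Orthonormal ℂ w) (x : A) :
    Tendsto (fun n => adjoint (scalarColumn ν K (w n)) ∘L σ x ∘L scalarColumn ν K (w n)) atTop
      (𝓝 0) := by
  let F : ℕ → (Lp K 2 ν →L[ℂ] Lp K 2 ν) →L[ℂ] (K →L[ℂ] K) := fun n =>
    compLeft (adjoint (scalarColumn ν K (w n))) ∘L compRight (scalarColumn ν K (w n))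
  have hF : ∀ n, ‖F n‖ ≤ 1 := fun n => ContinuousLinearMap.opNorm_le_bound _ zero_le_one fun T => by
    have h1 : ‖adjoint (scalarColumn ν K (w n))‖ ≤ 1 :=
      (norm_adjoint_scalarColumn_le _).trans_eq (hw.1 n)
    have h2 : ‖scalarColumn ν K (w n)‖ ≤ 1 := (norm_scalarColumn_le _).trans_eq (hw.1 n)
    refine (ContinuousLinearMap.opNorm_comp_le (adjoint (scalarColumn ν K (w n)))
      (T ∘L scalarColumn ν K (w n))).trans ?_
    refine mul_le_mul h1 ?_ (ContinuousLinearMap.opNorm_nonneg _) zero_le_one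
    refine (ContinuousLinearMap.opNorm_comp_le _ _).trans ?_
    exact mul_le_of_le_one_right (norm_nonneg _) h2
  have hlim : ∀ ξ : Lp ℂ 2 ν, Tendsto (fun n => ⟪w n, ξ⟫_ℂ) atTop (𝓝 0) := fun ξ => by
    have h1 := (hw.inner_products_summable (x := ξ)).tendsto_atTop_zero
    have h2 := h1.sqrt
    simp only [Real.sqrt_sq (norm_nonneg _), Real.sqrt_zero] at h2
    exact tendsto_zero_iff_norm_tendsto_zero.2 h2
  refine closedSpan_induction (p := fun T => Tendsto (fun n => F n T) atTop (𝓝 0))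
    (isClosed_setOf_tendsto_zero F hF) ?_ ?_ ?_ ?_
    (hσ.apply_mem (ClosedIdeal.univ A) x (ClosedIdeal.mem_univ x))
  · rintro _ ⟨ξ, a, -, η, rfl⟩
    have h1 : ∀ n, F n (scalarColumn ν K ξ ∘L ρ a ∘L adjoint (scalarColumn ν K η)) =
      (⟪w n, ξ⟫_ℂ * ⟪η, w n⟫_ℂ) • ρ a := fun n => compress_sandwich (w n) ξ η a
    simp only [h1]
    have h2 : Tendsto (fun n => ⟪η, w n⟫_ℂ) atTop (𝓝 0) := by
      have := (hlim η).star
      simpa using this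
    simpa using ((hlim ξ).mul h2).smul_const (ρ a)
  · simp
  · intro S T hS hT
    simpa using hS.add hT
  · intro r T hT
    simpa using hT.const_smul r

/-- Where the field is nearly constant on infinitely many disjoint open sets, `φ(f)` lies in `A`
only if that constant is small. -/
theorem IsFieldRep.norm_le_of_eq_coe (hΨ : IsFieldRep ν ρ m Ψ) (hm : IsStronglyContinuous m)
    (hσ : IsStableModel ν ρ σ) (hν : HasUnitBumps ν) (hφ : ∀ f x, σ ((φ f).fst x) = Ψ f * σ x)
    {f a b c : A} (hfa : φ f = (a : 𝓜(ℂ, A))) {V : ℕ → Set Y} (hVo : ∀ n, IsOpen (V n))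
    (hVn : ∀ n, (V n).Nonempty) (hVd : Pairwise fun i j => Disjoint (V i) (V j)) {ε : ℝ}
    (hV : ∀ n, ∀ y ∈ V n, ‖(m y f).fst b - c‖ ≤ ε) : ‖c‖ ≤ ε := by
  choose w hw hwV using fun n => hν (V n) (hVo n) (hVn n)
  have hwo : Orthonormal ℂ w := by
    refine ⟨hw, fun i j hij => ?_⟩
    change ⟪w i, w j⟫_ℂ = 0
    rw [L2.inner_def]
    refine integral_eq_zero_of_ae ?_
    filter_upwards [hwV i, hwV j] with y h1 h2
    by_cases hy : y ∈ V i
    · rw [h2 (Set.disjoint_left.1 (hVd hij) hy), inner_zero_right]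
      rfl
    · rw [h1 hy, inner_zero_left]
      rfl
  have hlim := hσ.tendsto_compress hwo a
  have hlim' : Tendsto (fun n => adjoint (scalarColumn ν K (w n)) ∘L Ψ f ∘L
      scalarColumn ν K (w n) ∘L ρ b) atTop (𝓝 0) := by
    -- Since φ(f) is left multiplication by a, the compressed field is the compression of σ(a) times
    -- ρ(b).
    have h1 : ∀ n, adjoint (scalarColumn ν K (w n)) ∘L Ψ f ∘L scalarColumn ν K (w n) ∘L ρ b =
        (adjoint (scalarColumn ν K (w n)) ∘L σ a ∘L scalarColumn ν K (w n)) * ρ b := fun n => by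
      obtain ⟨x, hx, hxb⟩ := hσ.compress_fst hφ f b (hw n)
      have h2 : (φ f).fst x = a * x := by rw [hfa]; rfl
      rw [← hx, h2, map_mul, hxb]
      change adjoint (scalarColumn ν K (w n)) ∘L σ a ∘L scalarColumn ν K (w n) ∘L ρ b ∘L
        (adjoint (scalarColumn ν K (w n)) ∘L scalarColumn ν K (w n)) = _
      rw [scalarColumn_cancel (hw n)]
      rfl
    simp only [h1]
    simpa using hlim.mul_const (ρ b)
  have h1 : ‖(0 : K →L[ℂ] K) - ρ c‖ ≤ ε :=
    le_of_tendsto (hlim'.sub_const (ρ c)).norm (Eventually.of_forall fun n =>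
      hΨ.norm_compress_sub_le hm (hV n) (hw n) (hwV n))
  rw [zero_sub, norm_neg] at h1
  have h2 := (NonUnitalStarAlgHom.isometry ρ hσ.injective_coeff).norm_map_of_map_zero (map_zero ρ) c
  rwa [h2] at h1

/-- On C_ξ ρ(a) C_η⋆ the difference is the column of ξ(y)(m_y(u_n)a - a), whose L² norm tends to 0
by dominated convergence with majorant 2‖a‖|ξ|. -/
theorem IsFieldRep.tendsto_fst_apply (hΨ : IsFieldRep ν ρ m Ψ) (hm : IsStronglyContinuous m)
    (hσ : IsStableModel ν ρ σ) (hφ : ∀ f x, σ ((φ f).fst x) = Ψ f * σ x) {u : ℕ → A}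
    (hu : ∀ n, ‖u n‖ ≤ 1) (hlim : ∀ y a, Tendsto (fun n => (m y (u n)).fst a) atTop (𝓝 a))
    (x : A) : Tendsto (fun n => (φ (u n)).fst x) atTop (𝓝 x) := by
  let F : ℕ → (Lp K 2 ν →L[ℂ] Lp K 2 ν) →L[ℂ] (Lp K 2 ν →L[ℂ] Lp K 2 ν) := fun n =>
    compLeft (Ψ (u n) - 1)
  have hF : ∀ n, ‖F n‖ ≤ 2 := fun n => ContinuousLinearMap.opNorm_le_bound _ zero_le_two fun T => by
    refine (ContinuousLinearMap.opNorm_comp_le (Ψ (u n) - 1) T).trans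
      (mul_le_mul_of_nonneg_right ?_ (norm_nonneg _))
    have h1 : ‖Ψ (u n)‖ ≤ 1 := (NonUnitalStarAlgHom.norm_apply_le Ψ _).trans (hu n)
    have h2 : ‖(1 : Lp K 2 ν →L[ℂ] Lp K 2 ν)‖ ≤ 1 := ContinuousLinearMap.norm_id_le
    exact (norm_sub_le _ _).trans (by linarith)
  have key : Tendsto (fun n => F n (σ x)) atTop (𝓝 0) := by
    refine closedSpan_induction (p := fun T => Tendsto (fun n => F n T) atTop (𝓝 0))
      (isClosed_setOf_tendsto_zero F hF) ?_ ?_ ?_ ?_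
      (hσ.apply_mem (ClosedIdeal.univ A) x (ClosedIdeal.mem_univ x))
    · rintro _ ⟨ξ, a, -, η, rfl⟩
      have hmem : ∀ n, MemLp (fun y => ξ y • ((m y (u n)).fst a - a)) 2 ν := fun n =>
        memLp_smul_of_bounded ξ (C := ‖a‖ + ‖a‖) ((hm (u n) a).sub continuous_const) fun y =>
          (norm_sub_le _ _).trans (add_le_add_left ((norm_fst_apply_le (m y) (u n) a).trans
            (mul_le_of_le_one_left (norm_nonneg _) (hu n))) _)
      have h1 : ∀ n, F n (scalarColumn ν K ξ ∘L ρ a ∘L adjoint (scalarColumn ν K η)) =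
          column ν (ρ.toCLM.compLp ((hmem n).toLp _)) ∘L adjoint (scalarColumn ν K η) := fun n => by
        change (Ψ (u n) - 1) ∘L (scalarColumn ν K ξ ∘L ρ a) ∘L adjoint (scalarColumn ν K η) = _
        rw [← ContinuousLinearMap.comp_assoc]
        congr 1
        rw [ContinuousLinearMap.sub_comp, hΨ.comp_scalarColumn hm]
        have h2 := scalarColumn_comp_eq_column ρ.toCLM ξ a
        rw [NonUnitalStarAlgHom.toCLM_apply] at h2
        change _ - scalarColumn ν K ξ ∘L ρ a = _
        rw [h2, ← map_sub]
        congr 1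
        refine Eq.trans ((ρ.toCLM.compLpL 2 ν).map_sub _ _).symm ?_
        change ρ.toCLM.compLp _ = _
        congr 1
        refine Lp.ext ?_
        filter_upwards [(hmem n).coeFn_toLp, MemLp.coeFn_toLp (memLp_smul_of_bounded ξ (hm (u n) a)
          (fun y => norm_fst_apply_le (m y) (u n) a)),
          (ContinuousLinearMap.toSpanSingleton ℂ a).coeFn_compLp ξ, Lp.coeFn_sub
          ((memLp_smul_of_bounded ξ (hm (u n) a) (fun y => norm_fst_apply_le (m y) (u n) a)).toLp _)
          ((ContinuousLinearMap.toSpanSingleton ℂ a).compLp ξ)] with y e1 e2 e3 e4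
        rw [e1, e4, Pi.sub_apply, e2, e3, smul_sub]
        rfl
      simp only [h1]
      have h3 : Tendsto (fun n => ‖(hmem n).toLp _‖) atTop (𝓝 0) := by
        simp only [Lp.norm_toLp]
        have h4 : Tendsto (fun n => eLpNorm (fun y => ξ y • ((m y (u n)).fst a - a)) 2 ν) atTop
            (𝓝 0) := by
          refine tendsto_eLpNorm_two_of_dominated (fun n => (hmem n).1)
            ((Lp.memLp ξ).norm.mul_const (‖a‖ + ‖a‖)) (fun n => Eventually.of_forall fun y => ?_)
            (Eventually.of_forall fun y => ?_)
          · rw [norm_smul]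
            exact mul_le_mul_of_nonneg_left ((norm_sub_le _ _).trans (add_le_add_left
              ((norm_fst_apply_le (m y) (u n) a).trans
              (mul_le_of_le_one_left (norm_nonneg _) (hu n))) _)) (norm_nonneg _)
          · have := ((hlim y a).sub_const a).const_smul (ξ y)
            simpa using this
        exact (ENNReal.tendsto_toReal ENNReal.zero_ne_top).comp h4
      have h4 := h3.mul_const ‖η‖
      rw [zero_mul] at h4
      refine squeeze_zero_norm (fun n => ?_) h4
      refine (ContinuousLinearMap.opNorm_comp_le _ _).trans ?_
      exact mul_le_mul (norm_column_compLp_le _) (norm_adjoint_scalarColumn_le η)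
        (ContinuousLinearMap.opNorm_nonneg _) (norm_nonneg _)
    · simp
    · intro S T hS hT
      simpa using hS.add hT
    · intro r T hT
      simpa using hT.const_smul r
  have h1 : ∀ n, F n (σ x) = σ ((φ (u n)).fst x - x) := fun n => by
    rw [map_sub, hφ]
    change (Ψ (u n) - 1) * σ x = _
    rw [sub_mul, one_mul]
  simp only [h1] at key
  have h2 := key.norm
  simp only [(NonUnitalStarAlgHom.isometry σ hσ.injective).norm_map_of_map_zero (map_zero σ),
    norm_zero] at h2
  exact tendsto_iff_norm_sub_tendsto_zero.2 h2

end Model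

/-! ### Equivariance of the induced homomorphism -/

section Equivariance

open scoped InnerProductSpace
open ContinuousLinearMap (adjoint)

variable {G : Type u} [Group G] [TopologicalSpace G] [IsTopologicalGroup G] [T2Space G]
  [LocallyCompactSpace G] [SecondCountableTopology G] [MeasurableSpace G] [BorelSpace G]
  {μ : Measure G} [μ.IsHaarMeasure] {A : Type*} [NonUnitalCStarAlgebra A]
  {K : Type*} [NormedAddCommGroup K] [InnerProductSpace ℂ K] [CompleteSpace K]
  {ρ : A →⋆ₙₐ[ℂ] (K →L[ℂ] K)}
  {σ : A →⋆ₙₐ[ℂ] (Lp K 2 (haarNat μ) →L[ℂ] Lp K 2 (haarNat μ))} {α β : CStarAction G A}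
  {m : G × ℕ → (A →⋆ₙₐ[ℂ] 𝓜(ℂ, A))}
  {Ψ : A →⋆ₙₐ[ℂ] (Lp K 2 (haarNat μ) →L[ℂ] Lp K 2 (haarNat μ))} {φ : A →⋆ₙₐ[ℂ] 𝓜(ℂ, A)}

/-- On a function u, acting by k means translating and then applying β_k. The covariance assumption
`hcov` says exactly that this carries multiplication by the field at f to multiplication by the
field at α_k(f). -/
theorem IsFieldRep.isEquivariantHom (hΨ : IsFieldRep (haarNat μ) ρ m Ψ)
    (hm : IsStronglyContinuous m) (hσ : IsStableModel (haarNat μ) ρ σ)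
    (hE : IsEquivariantModel μ ρ σ α β) (hφ : ∀ f x, σ ((φ f).fst x) = Ψ f * σ x)
    (hcov : ∀ k y f a, (m y (α.aut k f)).fst (β.aut k a) =
      β.aut k ((m (translateFst k y) f).fst a)) : IsEquivariantHom α φ := by
  intro k f
  suffices h : ∀ x, (φ (α.aut k f)).fst (α.aut k x) = α.aut k ((φ f).fst x) from
    DoubleCentralizer.ext_fst fun x => by
      have := h ((α.aut k).symm x)
      rwa [StarAlgEquiv.apply_symm_apply] at this
  -- The kernel of this defect is closed, so it is enough to find in it the elements whose images
  -- are sandwiches. For such an image the vector η is the same for x and φ(f)x, and only the column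
  -- changes.
  let D : A →L[ℂ] A :=
    (φ (α.aut k f)).fst ∘L (α.aut k).toCLM - (α.aut k).toCLM ∘L (φ f).fst
  suffices h : ∀ x, x ∈ LinearMap.ker D.toLinearMap from fun x => sub_eq_zero.1 (h x)
  intro x
  have hcl := NonUnitalStarAlgHom.isClosed_map σ hσ.injective (W := LinearMap.ker D.toLinearMap)
    D.isClosed_ker
  obtain ⟨x', hx', hxx⟩ := map_mem_of_mem_closedSpan hcl (ContinuousLinearMap.id ℂ _) (by
    rintro _ ⟨ξ, a, -, η, rfl⟩
    set u := (ContinuousLinearMap.toSpanSingleton ℂ a).compLp ξ with hu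
    have hmem := memLp_smul_of_bounded ξ (hm f a) (fun y => norm_fst_apply_le (m y) f a)
    set u' := hmem.toLp _ with hu'
    obtain ⟨x, hx, hαx⟩ := hE k u η
    obtain ⟨x', hx', hαx'⟩ := hE k u' η
    have h1 : scalarColumn (haarNat μ) K ξ ∘L ρ a = column (haarNat μ) (ρ.toCLM.compLp u) :=
      scalarColumn_comp_eq_column ρ.toCLM ξ a
    refine ⟨x, ?_, ?_⟩
    · have h2 : x' = (φ f).fst x := hσ.injective (by
        rw [hφ, hx', hx, ← h1, ← hΨ.comp_scalarColumn hm]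
        rfl)
      change (φ (α.aut k f)).fst (α.aut k x) - α.aut k ((φ f).fst x) = 0
      rw [sub_eq_zero, ← h2]
      refine hσ.injective ?_
      rw [hφ, hαx, hαx']
      change (Ψ (α.aut k f) ∘L column (haarNat μ) _) ∘L _ = _
      congr 1
      refine hΨ _ _ _ ?_
      have hq := (measurePreserving_translateFst μ k).quasiMeasurePreserving
      filter_upwards [coeFn_translateLp μ k u, coeFn_translateLp μ k u',
        hq.ae ((ContinuousLinearMap.toSpanSingleton ℂ a).coeFn_compLp ξ),
        hq.ae hmem.coeFn_toLp, (β.aut k).toCLM.coeFn_compLp (translateLp μ A k u),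
        (β.aut k).toCLM.coeFn_compLp (translateLp μ A k u')] with y e1 e2 e3 e4 e5 e6
      rw [e5, e6, e1, e2]
      refine Eq.trans (congrArg (β.aut k) e4) ?_
      refine Eq.trans ?_ (congrArg (fun z => (m y (α.aut k f)).fst (β.aut k z)) e3.symm)
      refine Eq.trans ?_ (hcov k y f _).symm
      exact congrArg (β.aut k) (map_smul (m (translateFst k y) f).fst _ _).symm
    · change σ x = _
      rw [hx, ← h1]
      rfl) (hσ.apply_mem (ClosedIdeal.univ A) x (ClosedIdeal.mem_univ x))
  rwa [← hσ.injective hxx]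

end Equivariance

/-! ### Bump vectors for Haar measure on G × ℕ -/

section HaarNat

variable {G : Type u} [Group G] [TopologicalSpace G] [IsTopologicalGroup G] [T2Space G]
  [LocallyCompactSpace G] [SecondCountableTopology G] [MeasurableSpace G] [BorelSpace G]
  (μ : Measure G) [μ.IsHaarMeasure]

theorem hasUnitBumps_of_forall_open {Y : Type*} [MeasurableSpace Y] [TopologicalSpace Y]
    [BorelSpace Y] [SecondCountableTopology Y] [TopologicalSpace.MetrizableSpace Y] {ν : Measure Y}
    (h : ∀ V : Set Y, IsOpen V → V.Nonempty → ∃ W ⊆ V, MeasurableSet W ∧ ν W ≠ 0 ∧ ν W ≠ ⊤) :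
    HasUnitBumps ν := by
  intro V hV hne
  obtain ⟨W, hWV, hW, h0, ht⟩ := h V hV hne
  have hn : ‖indicatorConstLp 2 hW ht (1 : ℂ)‖ ≠ 0 := by
    rw [norm_indicatorConstLp (by simp) (by simp)]
    have : 0 < ν.real W := ENNReal.toReal_pos h0 ht
    exact (mul_pos (norm_pos_iff.2 one_ne_zero) (Real.rpow_pos_of_pos this _)).ne'
  refine ⟨((‖indicatorConstLp 2 hW ht (1 : ℂ)‖⁻¹ : ℝ) : ℂ) • indicatorConstLp 2 hW ht (1 : ℂ),
    ?_, ?_⟩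
  · rw [norm_smul, Complex.norm_real, norm_inv, norm_norm, inv_mul_cancel₀ hn]
  · filter_upwards [Lp.coeFn_smul ((‖indicatorConstLp 2 hW ht (1 : ℂ)‖⁻¹ : ℝ) : ℂ)
      (indicatorConstLp 2 hW ht (1 : ℂ)), indicatorConstLp_coeFn (p := 2) (hs := hW) (hμs := ht)
      (c := (1 : ℂ))] with y h1 h2 hy
    rw [h1, Pi.smul_apply, h2, Set.indicator_of_notMem fun hyW => hy (hWV hyW), smul_zero]

theorem exists_open_subset_haar {U : Set G} (hU : IsOpen U) (hne : U.Nonempty) :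
    ∃ W ⊆ U, MeasurableSet W ∧ μ W ≠ 0 ∧ μ W ≠ ⊤ := by
  obtain ⟨g, hg⟩ := hne
  obtain ⟨C, hC, hgC, hCU⟩ := exists_compact_subset hU hg
  exact ⟨interior C, interior_subset.trans hCU, isOpen_interior.measurableSet,
    (isOpen_interior.measure_pos μ ⟨g, hgC⟩).ne',
    ((measure_mono interior_subset).trans_lt hC.measure_lt_top).ne⟩

theorem hasUnitBumps_haarNat : HasUnitBumps (haarNat μ) :=
  hasUnitBumps_of_forall_open fun V hV hne => by
    obtain ⟨⟨g, n⟩, hgn⟩ := hne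
    obtain ⟨W, hWU, hW, h0, ht⟩ := exists_open_subset_haar μ
      (hV.preimage (Continuous.prodMk continuous_id (continuous_const (y := n)))) ⟨g, hgn⟩
    refine ⟨W ×ˢ {n}, ?_, hW.prod (measurableSet_singleton n), ?_, ?_⟩
    · rintro ⟨a, b⟩ ⟨ha, rfl⟩
      exact hWU ha
    · rw [haarNat, Measure.prod_prod, Measure.count_singleton, mul_one]
      exact h0
    · rw [haarNat, Measure.prod_prod, Measure.count_singleton, mul_one]
      exact ht

instance : Nontrivial (Lp ℂ 2 μ) := by
  obtain ⟨W, -, hW, h0, ht⟩ := exists_open_subset_haar μ isOpen_univ Set.univ_nonempty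
  refine ⟨indicatorConstLp 2 hW ht (1 : ℂ), 0, fun h => ?_⟩
  have h1 := congrArg norm h
  rw [norm_indicatorConstLp (by simp) (by simp), norm_zero] at h1
  have : 0 < μ.real W := ENNReal.toReal_pos h0 ht
  exact (mul_pos (norm_pos_iff.2 one_ne_zero) (Real.rpow_pos_of_pos this _)).ne' h1

instance : TopologicalSpace.SeparableSpace (Lp ℂ 2 μ) :=
  haveI : Fact ((2 : ENNReal) ≠ ⊤) := ⟨by simp⟩
  inferInstance

instance {H E : Type*} [NormedAddCommGroup H] [InnerProductSpace ℂ H] [NormedAddCommGroup E]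
    [InnerProductSpace ℂ E] [Nontrivial H] [Nontrivial E] : Nontrivial (HilbertTensor H E) := by
  obtain ⟨h, hh⟩ := exists_ne (0 : H)
  obtain ⟨e, he⟩ := exists_ne (0 : E)
  refine ⟨create h e, 0, fun h0 => ?_⟩
  have h1 := inner_create h h e e
  rw [h0, inner_zero_left] at h1
  rcases mul_eq_zero.1 h1.symm with h2 | h2
  · exact hh (inner_self_eq_zero.1 h2)
  · exact he (inner_self_eq_zero.1 h2)

end HaarNat

/-! ### Joint continuity and approximate units -/

section Continuity

open Filter Topology

theorem DoubleCentralizer.continuous_fst_apply {A : Type*} [NonUnitalCStarAlgebra A] :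
    Continuous fun p : 𝓜(ℂ, A) × A => p.1.fst p.2 := by
  have h : Isometry fun m : 𝓜(ℂ, A) => m.fst := Isometry.of_dist_eq fun m m' => by
    rw [dist_eq_norm, dist_eq_norm, ← DoubleCentralizer.norm_fst (m - m')]
    rfl
  exact (h.continuous.comp continuous_fst).clm_apply continuous_snd

theorem CStarAction.continuous_apply {G : Type*} [Group G] [TopologicalSpace G] {A : Type*}
    [NonUnitalCStarAlgebra A] (α : CStarAction G A) :
    Continuous fun p : G × A => α.aut p.1 p.2 := by
  refine continuous_iff_continuousAt.2 fun ⟨g₀, a₀⟩ => ?_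
  refine tendsto_iff_norm_sub_tendsto_zero.2 ?_
  have h1 : Tendsto (fun p : G × A => ‖p.2 - a₀‖ + ‖α.aut p.1 a₀ - α.aut g₀ a₀‖) (𝓝 (g₀, a₀))
      (𝓝 0) := by
    have : Continuous fun p : G × A => ‖p.2 - a₀‖ + ‖α.aut p.1 a₀ - α.aut g₀ a₀‖ :=
      (continuous_snd.sub continuous_const).norm.add
        (((α.continuous_aut a₀).comp continuous_fst).sub continuous_const).norm
    simpa using this.tendsto (g₀, a₀)
  refine squeeze_zero (fun _ => norm_nonneg _) (fun p => ?_) h1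
  have h2 : α.aut p.1 p.2 - α.aut g₀ a₀ =
      α.aut p.1 (p.2 - a₀) + (α.aut p.1 a₀ - α.aut g₀ a₀) := by
    rw [map_sub, sub_add_sub_cancel]
  rw [h2]
  exact (norm_add_le _ _).trans_eq (by rw [α.norm_aut])

theorem CStarAction.aut_inv_apply_aut {G : Type*} [Group G] [TopologicalSpace G] {A : Type*}
    [NonUnitalCStarAlgebra A] (α : CStarAction G A) (g : G) (a : A) :
    α.aut g (α.aut g⁻¹ a) = a := by
  have h : (α.aut g * α.aut g⁻¹) a = a := by
    rw [← map_mul, mul_inv_cancel, map_one]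
    rfl
  exact h

theorem CStarAction.aut_mul_apply {G : Type*} [Group G] [TopologicalSpace G] {A : Type*}
    [NonUnitalCStarAlgebra A] (α : CStarAction G A) (g k : G) (a : A) :
    α.aut (g * k) a = α.aut g (α.aut k a) := by
  rw [map_mul]
  rfl

theorem CStarAction.aut_one_apply {G : Type*} [Group G] [TopologicalSpace G] {A : Type*}
    [NonUnitalCStarAlgebra A] (α : CStarAction G A) (a : A) : α.aut 1 a = a := by
  rw [map_one]
  rfl

theorem CStarAction.aut_symm_apply {G : Type*} [Group G] [TopologicalSpace G] {A : Type*}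
    [NonUnitalCStarAlgebra A] (α : CStarAction G A) (g : G) (a : A) :
    (α.aut g).symm a = α.aut g⁻¹ a := by
  rw [map_inv]
  rfl

variable {G : Type u} [TopologicalSpace G] {B : Type v} [NonUnitalCStarAlgebra B]

theorem exists_finite_approx (f : C₀(G, B)) {ε : ℝ} (hε : 0 < ε) :
    ∃ s : Set B, s.Finite ∧ ∀ h, ∃ c ∈ s, ‖f h - c‖ < ε := by
  have h0 := (tendsto_zero_iff_norm_tendsto_zero.1 f.zero_at_infty').eventually
    (gt_mem_nhds hε)
  obtain ⟨L, hL, hLf⟩ := mem_cocompact.1 h0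
  obtain ⟨s, -, hsf, hsc⟩ := (hL.image (map_continuous f)).finite_cover_balls hε
  refine ⟨insert 0 s, hsf.insert 0, fun h => ?_⟩
  by_cases hh : h ∈ L
  · obtain ⟨c, hc, hfc⟩ := Set.mem_iUnion₂.1 (hsc ⟨h, hh, rfl⟩)
    rw [Metric.mem_ball, dist_eq_norm] at hfc
    exact ⟨c, Set.mem_insert_of_mem _ hc, hfc⟩
  · refine ⟨0, Set.mem_insert _ _, ?_⟩
    rw [sub_zero]
    exact hLf hh

/-- A function vanishing at infinity has totally bounded range, so pointwise convergence of v_n b on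
finitely many values already gives uniform convergence of v_n f. -/
theorem tendsto_constMultiplier {v : ℕ → B} (hv1 : ∀ n, ‖v n‖ ≤ 1)
    (hv : ∀ b, Tendsto (fun n => v n * b) atTop (𝓝 b)) (f : C₀(G, B)) :
    Tendsto (fun n => (constMultiplier G (v n)).fst f) atTop (𝓝 f) := by
  refine Metric.tendsto_atTop.2 fun ε hε => ?_
  obtain ⟨s, hsf, hs⟩ := exists_finite_approx f (show 0 < ε / 8 by positivity)
  have hev : ∀ᶠ n in atTop, ∀ c ∈ s, ‖v n * c - c‖ < ε / 8 := by
    rw [Set.Finite.eventually_all hsf]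
    intro c _
    have := Metric.tendsto_nhds.1 (hv c) (ε / 8) (by positivity)
    simpa [dist_eq_norm] using this
  obtain ⟨N, hN⟩ := eventually_atTop.1 hev
  refine ⟨N, fun n hn => ?_⟩
  rw [dist_eq_norm]
  refine lt_of_le_of_lt (b := ε / 2)
    (ZeroAtInftyContinuousMap.norm_le_of_forall (by positivity) fun h => ?_) (by linarith)
  rw [ZeroAtInftyContinuousMap.sub_apply, constMultiplier_fst_apply]
  obtain ⟨c, hc, hfc⟩ := hs h
  have h1 := hN n hn c hc
  have e : v n * f h - f h = v n * (f h - c) + (v n * c - c) - (f h - c) := by rw [mul_sub]; abel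
  have h2 : ‖v n * (f h - c)‖ ≤ ‖f h - c‖ :=
    (norm_mul_le _ _).trans (mul_le_of_le_one_left (norm_nonneg _) (hv1 n))
  rw [e]
  calc _ ≤ ‖v n * (f h - c)‖ + ‖v n * c - c‖ + ‖f h - c‖ :=
        (norm_sub_le _ _).trans (add_le_add_left (norm_add_le _ _) _)
    _ ≤ ε / 2 := by linarith

theorem continuous_constMultiplier_fst_apply :
    Continuous fun p : B × C₀(G, B) => (constMultiplier G p.1).fst p.2 :=
  DoubleCentralizer.continuous_fst_apply.comp
    (((constMultiplier G (B := B)).toCLM.continuous.comp continuous_fst).prodMk continuous_snd)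

end Continuity

/-! ### The covariant field of evaluations -/

section Field

open Filter Topology

variable {G : Type u} [Group G] [TopologicalSpace G] {B : Type v} [NonUnitalCStarAlgebra B]
  (α β : CStarAction G C₀(G, B)) (t : ℕ → G)

/-- The field of multipliers `(g, n) ↦ β_g(1 ⊗ (α_{g⁻¹} f)(t_n))`. -/
def translatedEval (y : G × ℕ) : C₀(G, B) →⋆ₙₐ[ℂ] 𝓜(ℂ, C₀(G, B)) :=
  (multiplierHom (β.aut y.1)).comp ((constMultiplier G).comp ((evalHom (t y.2)).comp
    (α.aut y.1⁻¹ : C₀(G, B) →⋆ₙₐ[ℂ] C₀(G, B))))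

theorem translatedEval_fst_apply (y : G × ℕ) (f a : C₀(G, B)) :
    (translatedEval α β t y f).fst a =
      β.aut y.1 ((constMultiplier G (α.aut y.1⁻¹ f (t y.2))).fst (β.aut y.1⁻¹ a)) := by
  rw [← β.aut_symm_apply]
  rfl

theorem translatedEval_one_fst_apply (n : ℕ) (f a : C₀(G, B)) :
    (translatedEval α β t (1, n) f).fst a = (constMultiplier G (f (t n))).fst a := by
  rw [translatedEval_fst_apply]
  simp only [inv_one, CStarAction.aut_one_apply]

theorem isStronglyContinuous_translatedEval [IsTopologicalGroup G] :
    IsStronglyContinuous (translatedEval α β t) := fun f a => by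
  simp only [translatedEval_fst_apply]
  refine continuous_prod_of_discrete_right.2 fun n => ?_
  refine β.continuous_apply.comp (continuous_id.prodMk ?_)
  refine continuous_constMultiplier_fst_apply.comp (Continuous.prodMk ?_ ?_)
  · exact (continuous_evalZeroAtInfty (t n)).comp ((α.continuous_aut f).comp continuous_inv)
  · exact (β.continuous_aut a).comp continuous_inv

/-- Substituting α_k(f) and β_k(a) replaces g⁻¹ by g⁻¹k = (k⁻¹g)⁻¹ in both places, and the outer β_g
is β_k β_{k⁻¹g}. -/
theorem translatedEval_aut (k : G) (y : G × ℕ) (f a : C₀(G, B)) :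
    (translatedEval α β t y (α.aut k f)).fst (β.aut k a) =
      β.aut k ((translatedEval α β t (translateFst k y) f).fst a) := by
  rw [translatedEval_fst_apply, translatedEval_fst_apply, ← β.aut_mul_apply, ← α.aut_mul_apply,
    ← β.aut_mul_apply]
  simp [translateFst]

/-- Automorphisms preserve approximate units and evaluation at a point is onto B, so the values at
t_n form a contractive approximate unit of B. -/
theorem tendsto_translatedEval [T2Space G] [LocallyCompactSpace G] {w : ℕ → C₀(G, B)}
    (hw1 : ∀ n, ‖w n‖ ≤ 1) (hw : ∀ f, Tendsto (fun n => w n * f) atTop (𝓝 f)) (y : G × ℕ)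
    (a : C₀(G, B)) : Tendsto (fun n => (translatedEval α β t y (w n)).fst a) atTop (𝓝 a) := by
  simp only [translatedEval_fst_apply]
  have h1 : Tendsto (fun n => (constMultiplier G (α.aut y.1⁻¹ (w n) (t y.2))).fst (β.aut y.1⁻¹ a))
      atTop (𝓝 (β.aut y.1⁻¹ a)) := by
    refine tendsto_constMultiplier (fun n => ?_) (fun b => ?_) _
    · exact (ZeroAtInftyContinuousMap.norm_apply_le _ _).trans
        ((α.norm_aut _ _).trans_le (hw1 n))
    · obtain ⟨h, rfl⟩ := exists_zeroAtInfty_apply_eq (t y.2) b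
      have hc : Continuous fun f : C₀(G, B) => α.aut y.1⁻¹ f (t y.2) :=
        (continuous_evalZeroAtInfty (t y.2)).comp (α.aut y.1⁻¹).toCLM.continuous
      have h2 := (hc.tendsto _).comp (hw (α.aut y.1 h))
      have h3 : α.aut y.1⁻¹ (α.aut y.1 h) = h := by
        have := α.aut_inv_apply_aut y.1⁻¹ h
        rwa [inv_inv] at this
      rw [h3] at h2
      refine h2.congr fun n => ?_
      change α.aut y.1⁻¹ (w n * α.aut y.1 h) (t y.2) = _
      rw [map_mul, h3]
      rfl
  have h2 := ((β.aut y.1).toCLM.continuous.tendsto _).comp h1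
  have h3 : (β.aut y.1).toCLM (β.aut y.1⁻¹ a) = a := β.aut_inv_apply_aut y.1 a
  rw [h3] at h2
  exact h2

/-- For f in C₀(G) ⊗ I, the product form of α♯ controls spreading a value of α_{g⁻¹} f and moving
back by α_g; since β_g(x) lies in each closed ideal containing α_g(x), the same holds for β_g. -/
theorem translatedEval_mem {τ : ContinuousAction G G} {γ : ContinuousAction G (PrimitiveIdeals B)}
    (hprod : α.SharpEqProd τ γ)
    (hβ : ∀ (J : ClosedIdeal C₀(G, B)) (g : G) (x : C₀(G, B)), α.aut g x ∈ J.1 → β.aut g x ∈ J.1)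
    (I : ClosedIdeal B) {f : C₀(G, B)} (hf : f ∈ (tensorIdeal G I).1) (y : G × ℕ)
    (a : C₀(G, B)) : (translatedEval α β t y f).fst a ∈ (tensorIdeal G I).1 := by
  rw [translatedEval_fst_apply]
  refine hβ _ _ _ (hprod.constMultiplier_mem I y.1 ?_ _ _)
  rwa [α.aut_inv_apply_aut]

end Field

/-! ### Construction of φ -/

section Existence

open Filter Topology

variable {G : Type u} [Group G] [TopologicalSpace G] [IsTopologicalGroup G] [T2Space G]
  [LocallyCompactSpace G] [SecondCountableTopology G] [MeasurableSpace G] [BorelSpace G]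
  (μ : Measure G) [μ.IsHaarMeasure]

instance : Nontrivial (lp (fun _ : ℕ => ℂ) 2) :=
  ⟨lp.single 2 0 1, 0, fun h => by
    have h1 := congrArg (fun x : lp (fun _ : ℕ => ℂ) 2 => x 0) h
    rw [lp.single_apply_self] at h1
    exact one_ne_zero h1⟩

/-- An action absorbing the regular representation is modelled on `L²(G × ℕ, K)`. -/
theorem CStarAction.AbsorbsRegular.exists_model {A : Type v} [NonUnitalCStarAlgebra A]
    {α : CStarAction G A} (hα : α.AbsorbsRegular μ) :
    ∃ (K : Type (max u v)) (_ : NormedAddCommGroup K) (_ : InnerProductSpace ℂ K)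
      (_ : CompleteSpace K) (ρ : A →⋆ₙₐ[ℂ] (K →L[ℂ] K))
      (σ : A →⋆ₙₐ[ℂ] (Lp K 2 (haarNat μ) →L[ℂ] Lp K 2 (haarNat μ))) (β : CStarAction G A),
      IsStableModel (haarNat μ) ρ σ ∧ IsEquivariantModel μ ρ σ α β ∧
      ∀ (J : ClosedIdeal A) (g : G) (x : A), α.aut g x ∈ J.1 → β.aut g x ∈ J.1 := by
  obtain ⟨E, _, _, _, π, ρ, hρ, hρα⟩ := hα.exists_isCompactRep
  obtain ⟨β, hβ, hβJ⟩ := hρ.exists_untwist (adjoint_leftRegularInfty_comp μ)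
    (leftRegularInfty_comp_adjoint μ) hρα
  obtain ⟨S, hS⟩ := exists_regularDecomposition μ (H := RegularHilbert μ)
  obtain ⟨U, hU⟩ := exists_amplification S E
  exact ⟨_, _, _, inferInstance, ρ, conjHom U ρ, β, hρ.isStableModel hU,
    hρ.isEquivariantModel μ hU hS hρα hβ, hβJ⟩

/-- What the model yields for an arbitrary sequence t: equivariance, convergence on approximate
units, preservation of C₀(G) ⊗ I, recovery of the values f(t_n), and the vanishing of f at points
that occur infinitely often in t once φ(f) lies in A. -/
theorem exists_equivariantHom {B : Type v} [NonUnitalCStarAlgebra B]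
    {α : CStarAction G C₀(G, B)} (hα : α.AbsorbsRegular μ)
    {τ : ContinuousAction G G} {γ : ContinuousAction G (PrimitiveIdeals B)}
    (hprod : α.SharpEqProd τ γ) (t : ℕ → G) :
    ∃ φ : C₀(G, B) →⋆ₙₐ[ℂ] 𝓜(ℂ, C₀(G, B)), IsEquivariantHom α φ ∧
      (∀ w : ℕ → C₀(G, B), (∀ n, ‖w n‖ ≤ 1) → (∀ f, Tendsto (fun n => w n * f) atTop (𝓝 f)) →
        ∀ x, Tendsto (fun n => (φ (w n)).fst x) atTop (𝓝 x)) ∧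
      (∀ I : ClosedIdeal B, ∀ f ∈ (tensorIdeal G I).1, ∀ x, (φ f).fst x ∈ (tensorIdeal G I).1) ∧
      (∀ (J : ClosedIdeal C₀(G, B)) f, (∀ x, (φ f).fst x ∈ J.1) →
        ∀ n a, (constMultiplier G (f (t n))).fst a ∈ J.1) ∧
      ∀ f a : C₀(G, B), φ f = (a : 𝓜(ℂ, C₀(G, B))) → ∀ i : ℕ → ℕ, Function.Injective i →
        ∀ s, (∀ n, t (i n) = s) → ∀ b, (constMultiplier G (f s)).fst b = 0 := by
  obtain ⟨K, _, _, _, ρ, σ, β, hσ, hE, hβ⟩ := hα.exists_model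
  have hm := isStronglyContinuous_translatedEval α β t
  obtain ⟨Ψ, hΨ⟩ := exists_isFieldRep (ν := haarNat μ) (ρ := ρ) hm
  obtain ⟨φ, hφ⟩ := hσ.exists_hom hΨ hm
  have hν := hasUnitBumps_haarNat μ
  refine ⟨φ, hΨ.isEquivariantHom hm hσ hE hφ (translatedEval_aut α β t), fun w hw1 hw x => ?_,
    fun I f hf x => ?_, fun J f hf n a => ?_, fun f a hfa i hi s hs b => ?_⟩
  · exact hΨ.tendsto_fst_apply hm hσ hφ hw1 (tendsto_translatedEval α β t hw1 hw) x
  · obtain ⟨x', hx', h⟩ := hσ.exists_mul_apply hΨ hm (ClosedIdeal.univ _) (tensorIdeal G I)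
      (fun y a _ => translatedEval_mem α β t hprod hβ I hf y a) (ClosedIdeal.mem_univ x)
    rw [← hφ] at h
    rwa [← hσ.injective h]
  · have := hΨ.fst_apply_mem hm hσ hν hφ J hf (1, n) a
    rwa [translatedEval_one_fst_apply] at this
  · set c := (constMultiplier G (f s)).fst b with hc
    refine norm_le_zero_iff.1 (le_of_forall_pos_le_add fun ε hε => ?_)
    rw [zero_add]
    -- For each index with t_{i(n)} = s, take a neighbourhood of (1, i(n)) inside the sheet G ×
    -- {i(n)} on which the field stays near 1 ⊗ f(s); different sheets are disjoint.
    refine hΨ.norm_le_of_eq_coe hm hσ hν hφ hfa (b := b) (V := fun n =>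
      Prod.snd ⁻¹' {i n} ∩ {y | ‖(translatedEval α β t y f).fst b - c‖ < ε})
      (fun n => ?_) (fun n => ⟨(1, i n), rfl, ?_⟩) (fun j k hjk => ?_) (fun n y hy => hy.2.le)
    · exact ((isOpen_discrete _).preimage continuous_snd).inter
        (isOpen_lt ((hm f b).sub continuous_const).norm continuous_const)
    · change ‖(translatedEval α β t (1, i n) f).fst b - c‖ < ε
      rw [translatedEval_one_fst_apply, hs, ← hc, sub_self, norm_zero]
      exact hε
    · refine Set.disjoint_left.2 fun y h1 h2 => hjk (hi ?_)
      exact h1.1.symm.trans h2.1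

end Existence

/-! ### The main theorem -/

theorem mainTheorem7 {G : Type u} [Group G] [TopologicalSpace G] [IsTopologicalGroup G]
    [T2Space G] [LocallyCompactSpace G] [SecondCountableTopology G]
    [MeasurableSpace G] [BorelSpace G] (μ : Measure G) [μ.IsHaarMeasure]
    {B : Type v} [NonUnitalCStarAlgebra B] [TopologicalSpace.SeparableSpace B]
    (hB : IsStableCStar B)
    (α : CStarAction G C₀(G, B)) (hα : α.AbsorbsRegular μ)
    (τ : ContinuousAction G G) (γ : ContinuousAction G (PrimitiveIdeals B))
    (hprod : α.SharpEqProd τ γ) :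
    ∃ φ : C₀(G, B) →⋆ₙₐ[ℂ] 𝓜(ℂ, C₀(G, B)),
      IsEquivariantHom α φ ∧ IsNondegenerateHom φ ∧ Function.Injective φ ∧
      Set.range φ ∩ Set.range (DoubleCentralizer.coeHom (𝕜 := ℂ) (A := C₀(G, B))) = {0} ∧
      ∀ J : ClosedIdeal C₀(G, B),
        List.TFAE
          [φ '' (J.1 : Set C₀(G, B)) ⊆ Set.range φ ∩ multiplierIdeal J,
           ∃ I : ClosedIdeal B, J = tensorIdeal G I,
           φ '' (J.1 : Set C₀(G, B)) = Set.range φ ∩ multiplierIdeal J] := by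
  let s : ℕ → G := TopologicalSpace.denseSeq G
  have hs : DenseRange s := TopologicalSpace.denseRange_denseSeq G
  -- Unpairing indices repeats each term of the dense sequence infinitely often, at the indices
  -- `Nat.pair n j`.
  obtain ⟨φ, hφα, hφw, hφI, hφJ, hφc⟩ :=
    exists_equivariantHom μ hα hprod (fun n => s (Nat.unpair n).1)
  have hvan : ∀ (f a : C₀(G, B)), φ f = (a : 𝓜(ℂ, C₀(G, B))) → f = 0 := by
    intro f a hfa
    have h0 : ∀ n, f (s n) = 0 := fun n => by
      have h1 := hφc f a hfa (fun j => Nat.pair n j) (fun j k hjk => (Nat.pair_eq_pair.1 hjk).2)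
        (s n) (fun j => by rw [Nat.unpair_pair])
      -- A test function with value f(s_n)⋆ turns the vanishing of the multiplier into f(s_n)
      -- f(s_n)⋆ = 0.
      obtain ⟨b, hb⟩ := exists_zeroAtInfty_apply_eq (s n) (star (f (s n)))
      have h2 := congrArg (fun c : C₀(G, B) => c (s n)) (h1 b)
      change f (s n) * b (s n) = 0 at h2
      rwa [hb, CStarRing.mul_star_self_eq_zero_iff] at h2
    ext x
    exact congrFun (hs.equalizer (map_continuous f) continuous_const (funext h0)) x
  have hmem : ∀ (J : ClosedIdeal C₀(G, B)) f, (∀ x, (φ f).fst x ∈ J.1) →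
      ∀ x a, (constMultiplier G (f x)).fst a ∈ J.1 := by
    intro J f hf x a
    have hcl : IsClosed {x | (constMultiplier G (f x)).fst a ∈ (J.1 : Set C₀(G, B))} :=
      J.2.preimage (continuous_constMultiplier_fst_apply.comp
        ((map_continuous f).prodMk continuous_const))
    have h1 : Set.range s ⊆ {x | (constMultiplier G (f x)).fst a ∈ (J.1 : Set C₀(G, B))} := by
      rintro _ ⟨n, rfl⟩
      have := hφJ J f hf (Nat.pair n 0) a
      rwa [Nat.unpair_pair] at this
    exact closure_minimal h1 hcl (hs x)
  refine ⟨φ, hφα, ?_, ?_, ?_, fun J => ?_⟩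
  · obtain ⟨w, hw1, hw⟩ := exists_seq_approximateUnit_zeroAtInfty (G := G) (B := B)
    intro x
    exact mem_closure_of_tendsto (hφw w hw1 hw x)
      (Filter.Eventually.of_forall fun n => Submodule.subset_span ⟨w n, x, rfl⟩)
  -- Zero lies in A, so the kernel is covered by the argument for φ(A) ∩ A.
  · exact (injective_iff_map_eq_zero φ).2 fun f hf =>
      hvan f 0 (hf.trans (map_zero (DoubleCentralizer.coeHom (𝕜 := ℂ) (A := C₀(G, B)))).symm)
  · ext m
    constructor
    · rintro ⟨⟨f, rfl⟩, a, ha⟩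
      rw [hvan f a ha.symm]
      exact map_zero φ
    · rintro rfl
      exact ⟨⟨0, map_zero φ⟩, 0, map_zero _⟩
  · tfae_have 1 → 2 := fun h => exists_eq_tensorIdeal J fun f hf => hmem J f (h ⟨f, hf, rfl⟩).2
    tfae_have 2 → 3 := by
      rintro ⟨I, rfl⟩
      refine Set.Subset.antisymm ?_ ?_
      · rintro _ ⟨f, hf, rfl⟩
        exact ⟨⟨f, rfl⟩, hφI I f hf⟩
      -- Here φ(f)A ⊆ C₀(G) ⊗ I puts every value f(x) in I, so f itself is in the ideal.
      · rintro _ ⟨⟨f, rfl⟩, hf⟩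
        exact ⟨f, mem_tensorIdeal.2 fun x =>
          mem_of_forall_constMultiplier_mem I x (hmem _ f hf x), rfl⟩
    tfae_have 3 → 1 := fun h => h.subset
    tfae_finish

end
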